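/- **Setting.** Let $G$ be a nontrivial Garside group of finite type, with Garside structure $(G,P,\Delta)$: $P$ is a submonoid of $G$ with $P\cap P^{-1}=\{1\}$ and $\Delta\in P$; the relation $a\preccurlyeq b\Leftrightarrow a^{-1}b\in P$ is a lattice order with operations $\wedge$ (gcd) and $\vee$ (lcm); the set $[1,\Delta]$ of simple elements is finite and generates $G$; $\Delta^{-1}P\Delta=P$; and for $x\in P$ the maximal number $\|x\|$ of factors in a decomposition of $x$ into elements of $P\setminus\{1\}$ is finite. Put $a\succcurlyeq b\Leftrightarrow ab^{-1}\in P$, with gcd $\wedge^{R}$ and lcm $\vee^{R}$. Let $\mathcal A=\{a_1,\dots,a_\lambda\}$ be the set of atoms, i.e. the elements $a\in P\setminus\{1\}$ such that $a=bc$ with $b,c\in P$ implies $b=1$ or $c=1$. Write $x^c=c^{-1}xc$, $\tau(x)=\Delta^{-1}x\Delta$, and $\partial(s)=s^{-1}\Delta$, $\partial^{-1}(s)=\Delta s^{-1}$ for $s$ simple. The left normal form of $x$ is $x=\Delta^px_1\cdots x_r$ with $x_i\in[1,\Delta]\setminus\{1,\Delta\}$ and $\partial(x_i)\wedge x_{i+1}=1$;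 the right normal form is $x=y_1\cdots y_r\Delta^p$ with $y_i\in[1,\Delta]\setminus\{1,\Delta\}$ and $y_i\wedge^R\partial^{-1}(y_{i+1})=1$. Put $\inf x=p$ and $\sup x=p+r$. The super summit set $\mathrm{SSS}(x)$ consists of the conjugates of $x$ with maximal $\inf$ and minimal $\sup$ in the conjugacy class. The local left sliding of a product $s\cdot t$ of simple elements replaces it by $(su)\cdot(u^{-1}t)$ with $u=\partial(s)\wedge t$; the local right sliding replaces it by $(sv^{-1})\cdot(vt)$ with $v=s\wedge^R\partial^{-1}(t)$. Put $$\mathfrak p(x)=x\Delta^{-\inf x}\wedge x^{-1}\Delta^{\sup x}\wedge\Delta,\qquad \mathfrak s(x)=x^{\mathfrak p(x)},$$ $$\mathfrak p^R(x)=\Delta^{-\inf x}x\wedge^R\Delta^{\sup x}x^{-1}\wedge^R\Delta,\qquad \mathfrak s^R(x)=x^{\mathfrak p^R(x)^{-1}}.$$ $\mathrm{SC}(x)$ (resp. $\mathrm{SC}^R(x)$) is the set of conjugates $y$ of $x$ with $\mathfrak s^m(y)=y$ (resp. $(\mathfrak s^R)^m(y)=y$) for some $m\ge1$. The left transport of $\alpha$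 at $x$ is $\mathfrak p(x)^{-1}\alpha\,\mathfrak p(x^\alpha)$; the right transport is $\mathfrak p^R(x^{\alpha^{-1}})\,\alpha\,\mathfrak p^R(x)^{-1}$. If $z\in\mathrm{SC}(x)$, $\mathfrak s(z)=x$ and $\alpha\in P$, the left pullback of $\alpha$ at $x$ is the $\preccurlyeq$-least $u\in P$ such that $z^u\in\mathrm{SSS}(x)$ and $\alpha\preccurlyeq$ the left transport of $u$ at $z$. If $z\in\mathrm{SC}^R(x)$, $\mathfrak s^R(z)=x$ and $\alpha\in P$, the right pullback of $\alpha$ at $x$ is the $\succcurlyeq$-least $u\in P$ such that $z^{u^{-1}}\in\mathrm{SSS}(x)$ and (the right transport of $u$ at $z$) $\succcurlyeq\alpha$. **Model and assumption.** Programs run on a random access machine (unit cost for elementary operations) and do not depend on $G$. Simple elements are opaque; elements of $G$ are stored as sequences of simple elements and inverses of simple elements, and normal forms as the exponent $p$ together with the sequence of simple factors. The list of atoms and $\Delta$ are known, and the following oracle calls cost $C\ge1$ each: compute a hash value of a simple element $s$; for an atom $a$ and a simple element $s$, test whether $a\preccurlyeq s$ (resp. $s\succcurlyeq a$) and, if so,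 compute $a^{-1}s$ (resp. $sa^{-1}$). **Theorem.** Let $k\ge1$, let $a$ be an atom, $s,t$ simple elements, and $x,y,\alpha$ elements of $G$ that are products of at most $k$ simple elements or inverses of simple elements. The following operations can be performed by programs at the stated costs, where the constants in $O(\cdot)$ are absolute (they do not depend on $G$, $C$, $k$ or the arguments). 1. In $O(C\lambda)$: test whether $s=1$. 2. In $O(C\lambda\|\Delta\|)$: test whether $s=t$; compute $\partial(s)$, $\partial^{-1}(s)$, $\tau(s)$ or $\tau^{-1}(s)$; test whether $as$ (resp. $sa$) is simple and, if so, compute it; compute $s\wedge t$, $s\wedge^Rt$, $s\vee t$ or $s\vee^Rt$; perform a local left or right sliding on $s\cdot t$. 3. In $O(C\lambda k\|\Delta\|)$: - test whether $x=y$, if the left normal forms or the right normal forms of $x$ and $y$ are known; - compute the left [resp. right] normal form of $xs$, $sx$, $xs^{-1}$, $s^{-1}x$, $x^s$ or $x^{s^{-1}}$, if the left [resp. right] normal form of $x$ is known; - compute $\mathfrak p(x)$ or the left normal form of $\mathfrak s(x)$ [resp. $\mathfrak p^R(x)$ or the right normal form of $\mathfrak s^R(x)$], if the left [resp. right] normal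 form of $x$ is known; - compute the left [resp. right] transport of $s$ at $x$, if the left [resp. right] normal form of $x$ is known; - compute the left [resp. right] pullback of $s$ at $x$, if $x^s\in\mathrm{SSS}(x)$ [resp. $x^{s^{-1}}\in\mathrm{SSS}(x)$] and if the right [resp. left] normal form of $x$ and the left [resp. right] normal form of an element $z\in\mathrm{SC}(x)$ with $\mathfrak s(z)=x$ [resp. $z\in\mathrm{SC}^R(x)$ with $\mathfrak s^R(z)=x$] are known. 4. In $O(C\lambda k^2\|\Delta\|)$: - compute the left or the right normal form of $x$; - compute $x\wedge y$, $x\wedge^Ry$, $x\vee y$ or $x\vee^Ry$; - compute $\mathfrak p(x)$, $\mathfrak p^R(x)$, the left normal form of $\mathfrak s(x)$ or the right normal form of $\mathfrak s^R(x)$; - compute the left or the right transport of $\alpha$ at $x$; - compute the left [resp. right] pullback of $\alpha$ at $x$, if $\alpha$ is positive, $x^\alpha\in\mathrm{SSS}(x)$ [resp. $x^{\alpha^{-1}}\in\mathrm{SSS}(x)$] and an element $z\in\mathrm{SC}(x)$ with $\mathfrak s(z)=x$ [resp. $z\in\mathrm{SC}^R(x)$ with $\mathfrak s^R(z)=x$],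 given as a product of at most $k$ simple elements or inverses of simple elements, is known. -/

import Mathlib

universe u

/-! ### Garside structures -/

/-- `a ≼ b`: `a` is a prefix of `b`. -/
def PrefixOf {G : Type u} [Group G] (P : Submonoid G) (a b : G) : Prop := a⁻¹ * b ∈ P

/-- `a ≽ b`: `b` is a suffix of `a`. -/
def HasSuffix {G : Type u} [Group G] (P : Submonoid G) (a b : G) : Prop := a * b⁻¹ ∈ P

/-- `d` is a greatest common divisor of `a` and `b` for `≼`. -/
def IsLeftGcd {G : Type u} [Group G] (P : Submonoid G) (a b d : G) : Prop :=
  PrefixOf P d a ∧ PrefixOf P d b ∧ ∀ c, PrefixOf P c a → PrefixOf P c b → PrefixOf P c d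

/-- `m` is a least common multiple of `a` and `b` for `≼`. -/
def IsLeftLcm {G : Type u} [Group G] (P : Submonoid G) (a b m : G) : Prop :=
  PrefixOf P a m ∧ PrefixOf P b m ∧ ∀ c, PrefixOf P a c → PrefixOf P b c → PrefixOf P m c

/-- `d` is a greatest common divisor of `a` and `b` for `≽`. -/
def IsRightGcd {G : Type u} [Group G] (P : Submonoid G) (a b d : G) : Prop :=
  HasSuffix P a d ∧ HasSuffix P b d ∧ ∀ c, HasSuffix P a c → HasSuffix P b c → HasSuffix P d c

/-- `m` is a least common multiple of `a` and `b` for `≽`. -/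
def IsRightLcm {G : Type u} [Group G] (P : Submonoid G) (a b m : G) : Prop :=
  HasSuffix P m a ∧ HasSuffix P m b ∧ ∀ c, HasSuffix P c a → HasSuffix P c b → HasSuffix P c m

/-- The lengths of the decompositions of `x` as a product of nontrivial positive elements. -/
def decompositionLengths {G : Type u} [Group G] (P : Submonoid G) (x : G) : Set ℕ :=
  {n | ∃ l : List G, l.length = n ∧ (∀ a ∈ l, a ∈ P ∧ a ≠ 1) ∧ l.prod = x}

/-- A Garside structure `(G, P, Δ)` on the group `G`. -/
structure GarsideStructure (G : Type u) [Group G] where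
  /-- the monoid of positive elements -/
  P : Submonoid G
  /-- the Garside element -/
  Δ : G
  delta_mem : Δ ∈ P
  eq_one_of_mem_of_inv_mem : ∀ x, x ∈ P → x⁻¹ ∈ P → x = 1
  exists_gcd : ∀ a b : G, ∃ d, IsLeftGcd P a b d
  exists_lcm : ∀ a b : G, ∃ m, IsLeftLcm P a b m
  closure_simple : Subgroup.closure {s : G | PrefixOf P 1 s ∧ PrefixOf P s Δ} = ⊤
  conj_delta : ∀ x : G, Δ⁻¹ * x * Δ ∈ P ↔ x ∈ P
  norm_finite : ∀ x ∈ P, x ≠ 1 → BddAbove (decompositionLengths P x)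

namespace GarsideStructure

variable {G : Type u} [Group G] (S : GarsideStructure G)

/-- `s ∈ [1, Δ]`. -/
def IsSimple (s : G) : Prop := PrefixOf S.P 1 s ∧ PrefixOf S.P s S.Δ

/-- The set `[1, Δ]` of simple elements, as a type. -/
def Simple : Type u := {s : G // S.IsSimple s}

def FiniteType : Prop := {s : G | S.IsSimple s}.Finite

def IsAtom (a : G) : Prop :=
  a ∈ S.P ∧ a ≠ 1 ∧ ∀ b ∈ S.P, ∀ c ∈ S.P, a = b * c → b = 1 ∨ c = 1

/-- `‖x‖`, the maximal length of a decomposition of the positive element `x` into nontrivial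
positive elements (so that `‖1‖ = 0`). -/
noncomputable def norm (x : G) : ℕ := sSup (decompositionLengths S.P x)

theorem hasSuffix_iff_prefixOf_inv (a b : G) :
    HasSuffix S.P a b ↔ PrefixOf S.P a⁻¹ b⁻¹ := by
  simp [HasSuffix, PrefixOf]

theorem exists_rightGcd (a b : G) : ∃ d, IsRightGcd S.P a b d := by
  obtain ⟨m, h1, h2, h3⟩ := S.exists_lcm a⁻¹ b⁻¹
  refine ⟨m⁻¹, ?_, ?_, ?_⟩
  · simpa [hasSuffix_iff_prefixOf_inv] using h1
  · simpa [hasSuffix_iff_prefixOf_inv] using h2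
  · intro c hc hd
    simp only [hasSuffix_iff_prefixOf_inv, inv_inv] at *
    exact h3 _ hc hd

theorem exists_rightLcm (a b : G) : ∃ m, IsRightLcm S.P a b m := by
  obtain ⟨d, h1, h2, h3⟩ := S.exists_gcd a⁻¹ b⁻¹
  refine ⟨d⁻¹, ?_, ?_, ?_⟩
  · simpa [hasSuffix_iff_prefixOf_inv] using h1
  · simpa [hasSuffix_iff_prefixOf_inv] using h2
  · intro c hc hd
    simp only [hasSuffix_iff_prefixOf_inv, inv_inv] at *
    exact h3 _ hc hd

/-- `a ∧ b` -/
noncomputable def leftGcd (a b : G) : G := (S.exists_gcd a b).choose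

/-- `a ∨ b` -/
noncomputable def leftLcm (a b : G) : G := (S.exists_lcm a b).choose

/-- `a ∧ b` for the suffix order -/
noncomputable def rightGcd (a b : G) : G := (S.exists_rightGcd a b).choose

/-- `a ∨ b` for the suffix order -/
noncomputable def rightLcm (a b : G) : G := (S.exists_rightLcm a b).choose

/-- The right complement `∂ s`. -/
def rightCompl (s : G) : G := s⁻¹ * S.Δ

/-- The left complement `∂⁻¹ s`. -/
def leftCompl (s : G) : G := S.Δ * s⁻¹

def tau (x : G) : G := S.Δ⁻¹ * x * S.Δ

def tauInv (x : G) : G := S.Δ * x * S.Δ⁻¹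

def LeftWeighted (a b : G) : Prop := S.leftGcd (S.rightCompl a) b = 1

def RightWeighted (a b : G) : Prop := S.rightGcd a (S.leftCompl b) = 1

/-- `x = Δ ^ p * x₁ * ⋯ * xᵣ` is the left normal form of `x`, where `l = [x₁, …, xᵣ]`. -/
def IsLeftNormalForm (p : ℤ) (l : List G) (x : G) : Prop :=
  x = S.Δ ^ p * l.prod ∧ (∀ y ∈ l, S.IsSimple y ∧ y ≠ 1 ∧ y ≠ S.Δ) ∧ l.IsChain S.LeftWeighted

/-- `x = y₁ * ⋯ * yᵣ * Δ ^ p` is the right normal form of `x`, where `l = [y₁, …, yᵣ]`. -/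
def IsRightNormalForm (p : ℤ) (l : List G) (x : G) : Prop :=
  x = l.prod * S.Δ ^ p ∧ (∀ y ∈ l, S.IsSimple y ∧ y ≠ 1 ∧ y ≠ S.Δ) ∧ l.IsChain S.RightWeighted

/-- The left normal form of `x` (which exists and is unique). -/
noncomputable def leftNormalForm (x : G) : ℤ × List G :=
  Classical.epsilon fun n : ℤ × List G => S.IsLeftNormalForm n.1 n.2 x

noncomputable def inf (x : G) : ℤ := (S.leftNormalForm x).1

noncomputable def canonicalLength (x : G) : ℕ := (S.leftNormalForm x).2.length

noncomputable def sup (x : G) : ℤ := S.inf x + S.canonicalLength x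

/-- `x ^ c` -/
def conj (x c : G) : G := c⁻¹ * x * c

/-- The super summit set: the conjugates of `x` whose infimum is maximal and whose supremum is
minimal in the conjugacy class of `x`. -/
def SSS (x : G) : Set G :=
  {y | IsConj x y ∧ IsGreatest (S.inf '' {w | IsConj x w}) (S.inf y) ∧
    IsLeast (S.sup '' {w | IsConj x w}) (S.sup y)}

/-! ### Cyclic sliding -/

noncomputable def prefPrefix (x : G) : G :=
  S.leftGcd (S.leftGcd (x * S.Δ ^ (-S.inf x)) (x⁻¹ * S.Δ ^ S.sup x)) S.Δ

noncomputable def prefSuffix (x : G) : G :=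
  S.rightGcd (S.rightGcd (S.Δ ^ (-S.inf x) * x) (S.Δ ^ S.sup x * x⁻¹)) S.Δ

/-- Cyclic (left) sliding. -/
noncomputable def slide (x : G) : G := conj x (S.prefPrefix x)

/-- Cyclic right sliding. -/
noncomputable def rightSlide (x : G) : G := conj x (S.prefSuffix x)⁻¹

/-- The set of sliding circuits of `x`. -/
def SC (x : G) : Set G := {y | IsConj x y ∧ ∃ m : ℕ, 1 ≤ m ∧ S.slide^[m] y = y}

/-- The set of right sliding circuits of `x`. -/
def rightSC (x : G) : Set G := {y | IsConj x y ∧ ∃ m : ℕ, 1 ≤ m ∧ S.rightSlide^[m] y = y}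

/-- The transport of `α` at `x`. -/
noncomputable def transport (x α : G) : G :=
  (S.prefPrefix x)⁻¹ * α * S.prefPrefix (conj x α)

/-- The right transport of `α` at `x`. -/
noncomputable def rightTransport (x α : G) : G :=
  S.prefSuffix (conj x α⁻¹) * α * (S.prefSuffix x)⁻¹

/-- `v` is positive, conjugates `z` into `SSS(x)` and its transport at `z` has the prefix `s`. -/
def PullbackCandidate (x z s v : G) : Prop :=
  v ∈ S.P ∧ conj z v ∈ S.SSS x ∧ PrefixOf S.P s (S.transport z v)

/-- `u` is the pullback of `s` at `x = 𝔰(z)`. -/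
def IsPullback (x z s u : G) : Prop :=
  S.PullbackCandidate x z s u ∧ ∀ v, S.PullbackCandidate x z s v → PrefixOf S.P u v

def RightPullbackCandidate (x z s v : G) : Prop :=
  v ∈ S.P ∧ conj z v⁻¹ ∈ S.SSS x ∧ HasSuffix S.P (S.rightTransport z v) s

/-- `u` is the right pullback of `s` at `x`, where `x` is the cyclic right sliding of `z`. -/
def IsRightPullback (x z s u : G) : Prop :=
  S.RightPullbackCandidate x z s u ∧ ∀ v, S.RightPullbackCandidate x z s v → HasSuffix S.P v u

/-! ### Words -/

/-- Sequences of simple elements and inverses of simple elements: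
`(s, true)` stands for `s` and `(s, false)` for `s⁻¹`. -/
abbrev Word : Type u := List (S.Simple × Bool)

/-- The element of `G` represented by a word. -/
def wordVal (w : S.Word) : G := (w.map fun l => cond l.2 l.1.1 l.1.1⁻¹).prod

/-- `x` is a product of at most `k` simple elements or inverses of simple elements. -/
def HasLengthAtMost (k : ℕ) (x : G) : Prop := ∃ w : S.Word, w.length ≤ k ∧ S.wordVal w = x

/-- The data behind the oracle: the list of the atoms, without repetition, and a hash function on
simple elements. -/
structure Oracle where
  numAtoms : ℕ
  atom : Fin numAtoms → G
  atom_injective : Function.Injective atom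
  range_atom : Set.range atom = {a | S.IsAtom a}
  hash : S.Simple → ℤ

/-! ### The machine

A program does not depend on the group. It works with registers for integers, for simple elements
and for words. Simple elements are opaque: besides being copied and stored in words, they can
only be handed to the oracle. -/

structure State where
  int : ℕ → ℤ
  simp : ℕ → S.Simple
  word : ℕ → S.Word

end GarsideStructure

/-- Elementary instructions. Their effect is given by `Step` below. -/
inductive Instr : Type
  | setInt (d : ℕ) (c : ℤ)
  | add (d i j : ℕ)
  | sub (d i j : ℕ)
  | numAtoms (d : ℕ)
  | delta (d : ℕ)
  | copySimple (d s : ℕ)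
  | pushFront (q s : ℕ) (b : Bool)
  | pushBack (q s : ℕ) (b : Bool)
  | popFront (q d f : ℕ)
  | popBack (q d f : ℕ)
  | clear (q : ℕ)
  | copyWord (d q : ℕ)
  | hash (d s : ℕ)
  | divLeft (d s i f : ℕ)
  | divRight (d s i f : ℕ)

/-- Conditions that can be tested. -/
inductive Condition : Type
  | le (i j : ℕ)
  | isEmpty (q : ℕ)

inductive Prog : Type
  | skip
  | instr (a : Instr)
  | comp (p q : Prog)
  | branch (c : Condition) (p q : Prog)
  | loop (c : Condition) (p : Prog)

namespace GarsideStructure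

variable {G : Type u} [Group G] {S : GarsideStructure G}

namespace State

def setInt (σ : S.State) (d : ℕ) (c : ℤ) : S.State := { σ with int := Function.update σ.int d c }

def setSimp (σ : S.State) (d : ℕ) (s : S.Simple) : S.State :=
  { σ with simp := Function.update σ.simp d s }

def setWord (σ : S.State) (q : ℕ) (w : S.Word) : S.State :=
  { σ with word := Function.update σ.word q w }

end State

/-- `Step O C a σ σ' n`: the instruction `a` leads from the state `σ` to the state `σ'` at cost
`n`, where a call of the oracle costs `C`. There is no step if an instruction is not applicable
(popping from an empty word, or an atom index out of range). -/
inductive Step (O : S.Oracle) (C : ℕ) : Instr → S.State → S.State → ℕ → Prop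
  | setInt (σ : S.State) (d : ℕ) (c : ℤ) : Step O C (.setInt d c) σ (σ.setInt d c) 1
  | add (σ : S.State) (d i j : ℕ) : Step O C (.add d i j) σ (σ.setInt d (σ.int i + σ.int j)) 1
  | sub (σ : S.State) (d i j : ℕ) : Step O C (.sub d i j) σ (σ.setInt d (σ.int i - σ.int j)) 1
  | numAtoms (σ : S.State) (d : ℕ) : Step O C (.numAtoms d) σ (σ.setInt d O.numAtoms) 1
  | delta (σ : S.State) (d : ℕ) (s : S.Simple) (hs : s.1 = S.Δ) :
      Step O C (.delta d) σ (σ.setSimp d s) 1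
  | copySimple (σ : S.State) (d s : ℕ) : Step O C (.copySimple d s) σ (σ.setSimp d (σ.simp s)) 1
  | pushFront (σ : S.State) (q s : ℕ) (b : Bool) :
      Step O C (.pushFront q s b) σ (σ.setWord q ((σ.simp s, b) :: σ.word q)) 1
  | pushBack (σ : S.State) (q s : ℕ) (b : Bool) :
      Step O C (.pushBack q s b) σ (σ.setWord q (σ.word q ++ [(σ.simp s, b)])) 1
  | popFront (σ : S.State) (q d f : ℕ) (s : S.Simple) (b : Bool) (w : S.Word)
      (h : σ.word q = (s, b) :: w) :
      Step O C (.popFront q d f) σ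
        (((σ.setWord q w).setSimp d s).setInt f (cond b 1 0)) 1
  | popBack (σ : S.State) (q d f : ℕ) (s : S.Simple) (b : Bool) (w : S.Word)
      (h : σ.word q = w ++ [(s, b)]) :
      Step O C (.popBack q d f) σ
        (((σ.setWord q w).setSimp d s).setInt f (cond b 1 0)) 1
  | clear (σ : S.State) (q : ℕ) : Step O C (.clear q) σ (σ.setWord q []) 1
  | copyWord (σ : S.State) (d q : ℕ) :
      Step O C (.copyWord d q) σ (σ.setWord d (σ.word q)) ((σ.word q).length + 1)
  | hash (σ : S.State) (d s : ℕ) : Step O C (.hash d s) σ (σ.setInt d (O.hash (σ.simp s))) C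
  | divLeft_true (σ : S.State) (d s i f : ℕ) (j : Fin O.numAtoms) (hj : σ.int i = (j : ℕ))
      (h : PrefixOf S.P (O.atom j) (σ.simp s).1) (t : S.Simple)
      (ht : t.1 = (O.atom j)⁻¹ * (σ.simp s).1) :
      Step O C (.divLeft d s i f) σ ((σ.setSimp d t).setInt f 1) C
  | divLeft_false (σ : S.State) (d s i f : ℕ) (j : Fin O.numAtoms) (hj : σ.int i = (j : ℕ))
      (h : ¬ PrefixOf S.P (O.atom j) (σ.simp s).1) :
      Step O C (.divLeft d s i f) σ (σ.setInt f 0) C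
  | divRight_true (σ : S.State) (d s i f : ℕ) (j : Fin O.numAtoms) (hj : σ.int i = (j : ℕ))
      (h : HasSuffix S.P (σ.simp s).1 (O.atom j)) (t : S.Simple)
      (ht : t.1 = (σ.simp s).1 * (O.atom j)⁻¹) :
      Step O C (.divRight d s i f) σ ((σ.setSimp d t).setInt f 1) C
  | divRight_false (σ : S.State) (d s i f : ℕ) (j : Fin O.numAtoms) (hj : σ.int i = (j : ℕ))
      (h : ¬ HasSuffix S.P (σ.simp s).1 (O.atom j)) :
      Step O C (.divRight d s i f) σ (σ.setInt f 0) C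

/-- The condition `c` holds in the state `σ`. -/
def Holds (c : Condition) (σ : S.State) : Prop :=
  match c with
  | .le i j => σ.int i ≤ σ.int j
  | .isEmpty q => σ.word q = []

/-- `Exec O C p σ σ' n`: the program `p`, started in the state `σ`, terminates in the state `σ'`,
and the total cost is `n`. Every test costs `1`. -/
inductive Exec (O : S.Oracle) (C : ℕ) : Prog → S.State → S.State → ℕ → Prop
  | skip (σ : S.State) : Exec O C .skip σ σ 1
  | instr {a : Instr} {σ σ' : S.State} {n : ℕ} (h : Step O C a σ σ' n) :
      Exec O C (.instr a) σ σ' n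
  | comp {p q : Prog} {σ σ' σ'' : S.State} {m n : ℕ} (hp : Exec O C p σ σ' m)
      (hq : Exec O C q σ' σ'' n) : Exec O C (.comp p q) σ σ'' (m + n)
  | branch_true {c : Condition} {p q : Prog} {σ σ' : S.State} {n : ℕ} (hc : Holds c σ)
      (h : Exec O C p σ σ' n) : Exec O C (.branch c p q) σ σ' (n + 1)
  | branch_false {c : Condition} {p q : Prog} {σ σ' : S.State} {n : ℕ} (hc : ¬ Holds c σ)
      (h : Exec O C q σ σ' n) : Exec O C (.branch c p q) σ σ' (n + 1)
  | loop_true {c : Condition} {p : Prog} {σ σ' σ'' : S.State} {m n : ℕ} (hc : Holds c σ)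
      (hp : Exec O C p σ σ' m) (h : Exec O C (.loop c p) σ' σ'' n) :
      Exec O C (.loop c p) σ σ'' (m + n + 1)
  | loop_false {c : Condition} {p : Prog} {σ : S.State} (hc : ¬ Holds c σ) :
      Exec O C (.loop c p) σ σ 1

namespace State

/-! ### Input and output conventions -/

/-- The simple register `i` holds `s`. -/
def HasSimple (σ : S.State) (i : ℕ) (s : G) : Prop := (σ.simp i).1 = s

/-- The integer register `i` holds the index of the atom `a`. -/
def HasAtom (σ : S.State) (O : S.Oracle) (i : ℕ) (a : G) : Prop :=
  ∃ j : Fin O.numAtoms, σ.int i = (j : ℕ) ∧ O.atom j = a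

/-- The word register `i` holds a word that represents `x`. -/
def HasElt (σ : S.State) (i : ℕ) (x : G) : Prop := S.wordVal (σ.word i) = x

/-- The word register `i` holds a word with at most `k` letters that represents `x`. -/
def HasEltLE (σ : S.State) (i k : ℕ) (x : G) : Prop :=
  (σ.word i).length ≤ k ∧ S.wordVal (σ.word i) = x

/-- The integer register `i` and the word register `i` hold the exponent of `Δ` and the simple
factors of the left normal form of `x`. -/
def HasLNF (σ : S.State) (i : ℕ) (x : G) : Prop :=
  (∀ l ∈ σ.word i, l.2 = true) ∧
    S.IsLeftNormalForm (σ.int i) ((σ.word i).map fun l => l.1.1) x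

/-- The same for the right normal form. -/
def HasRNF (σ : S.State) (i : ℕ) (x : G) : Prop :=
  (∀ l ∈ σ.word i, l.2 = true) ∧
    S.IsRightNormalForm (σ.int i) ((σ.word i).map fun l => l.1.1) x

/-- The integer register `0` holds the truth value of `A`. -/
def Answers (σ : S.State) (A : Prop) : Prop := (A → σ.int 0 = 1) ∧ (¬ A → σ.int 0 = 0)

end State

/-- One program performs the following task at cost `O(bound C λ k ‖Δ‖)`, in every nontrivial
Garside group of finite type with `λ` atoms, with an oracle of cost `C`: for all `x y z : G`, from
every state that satisfies `input` to a state that satisfies `output`. The registers that `input`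
does not mention have arbitrary contents. -/
def PerformedIn (bound : ℕ → ℕ → ℕ → ℕ → ℕ)
    (input : ∀ (G : Type u) [Group G] (S : GarsideStructure G),
      S.Oracle → ℕ → S.State → G → G → G → Prop)
    (output : ∀ (G : Type u) [Group G] (S : GarsideStructure G), S.State → G → G → G → Prop) :
    Prop :=
  ∃ (p : Prog) (K : ℕ), ∀ (G : Type u) [Group G] [Nontrivial G] (S : GarsideStructure G),
    S.FiniteType → ∀ (O : S.Oracle) (C k : ℕ), 1 ≤ C → 1 ≤ k → ∀ (x y z : G) (σ : S.State),
      input G S O k σ x y z → ∃ (σ' : S.State) (n : ℕ),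
        Exec O C p σ σ' n ∧ n ≤ K * bound C O.numAtoms k (S.norm S.Δ) ∧ output G S σ' x y z

end GarsideStructure

/-! Everything rests on one routine for simple elements: strip common atoms from a pair `s`, `t`
until none is left. The stripped product is then the left gcd. Every success lowers `‖s‖ ≤ ‖Δ‖` and
every search tries at most `λ` atoms, so `runs_cancelLeft` costs `O(Cλ‖Δ‖)`. Complements, equality,
gcds, lcms and local slidings of simple elements are obtained from boundedly many such cancellations
and their mirror images.

Multiplying a normal form by a simple element is one pass of local slidings. That left-weightedness
survives is `isChain_mulFront` for multiplication on the left and the domino rule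
`leftWeighted_slideSnd` for multiplication on the right; afterwards factors `Δ` sit only at the
front and factors `1` only at the end. Inverses are reduced to complements by `s⁻¹ = ∂(s) Δ⁻¹ = Δ⁻¹
∂⁻¹(s)`. A product of `k` letters lies between `Δ⁻ᵏ` and `Δᵏ`, hence has at most `2k` simple
factors: one multiplication is linear in `k`, and reading a whole word is quadratic. Gcds of
arbitrary elements follow from `x ∧ y = x (1 ∧ x⁻¹y)`, because `1 ∧ z` can be read off the left
normal form of `z` (`IsLeftNormalForm.one_gcd`), and `𝔭(x)` needs only the first and the last factor
of the normal form (`IsLeftNormalForm.prefPrefix_eq`).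

The pullback has a closed formula, `isPullback_lcm`: it is `1 ∨ 𝔭(z) s 𝔭ᴿ(xˢ)⁻¹`. Within the super
summit set, `β ≼ 𝔭(y)` holds exactly if `β` is a suffix of `𝔭ᴿ(y^β)` (`pre_prefPrefix_iff`), and
this turns the condition on the transport of `v` into a lower bound for `v`; conjugators into the
super summit set are closed under lcms. The formula needs `SC ⊆ SSS`. To prove this, sliding and
cycling are considered with fixed bounds for `inf` and `sup`, where they commute. If `inf` were not
maximal on a circuit, iterated cycling would eventually raise it; just before that moment sliding
would raise it as well, and irrevocably, against periodicity (`inf_le_of_periodic`). The statement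
on `sup` follows by inversion.

Right-hand versions are not proved separately. The opposite group is again a Garside group, with
prefixes and suffixes exchanged, and an execution there is an execution of the mirrored program in
the original group (`Exec.unop`, `PerformedIn.mirror`). -/

namespace GarsideStructure

section Order

variable {G : Type u} [Group G] (S : GarsideStructure G)

local infix:50 "≼" => PrefixOf (GarsideStructure.P S)

/-! ### The prefix order -/

theorem pre_refl (a : G) : a ≼ a := by simp [PrefixOf, S.P.one_mem]

theorem pre_trans {a b c : G} (h : a ≼ b) (h' : b ≼ c) : a ≼ c := by
  have := S.P.mul_mem h h'
  simpa [PrefixOf, mul_assoc] using this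

theorem pre_antisymm {a b : G} (h : a ≼ b) (h' : b ≼ a) : a = b := by
  have := S.eq_one_of_mem_of_inv_mem _ h (by simpa [PrefixOf] using h')
  exact inv_mul_eq_one.mp this

theorem mul_pre_mul_iff (c a b : G) : c * a ≼ c * b ↔ a ≼ b := by
  simp [PrefixOf, mul_assoc]

theorem mul_pre_mul (c : G) {a b : G} (h : a ≼ b) : c * a ≼ c * b :=
  (S.mul_pre_mul_iff c a b).2 h

theorem pre_mul_iff (a b : G) : a ≼ a * b ↔ b ∈ S.P := by simp [PrefixOf]

theorem pre_mul (a : G) {b : G} (h : b ∈ S.P) : a ≼ a * b := (S.pre_mul_iff a b).2 h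

theorem one_pre_iff (a : G) : (1 : G) ≼ a ↔ a ∈ S.P := by simp [PrefixOf]

theorem pre_iff_inv_mul (a b c : G) : a * b ≼ c ↔ b ≼ a⁻¹ * c := by
  simp [PrefixOf, mul_assoc]

theorem eq_of_pre_iff {a b : G} (h : ∀ c, c ≼ a ↔ c ≼ b) : a = b :=
  S.pre_antisymm ((h a).1 (S.pre_refl a)) ((h b).2 (S.pre_refl b))

theorem eq_of_iff_pre {a b : G} (h : ∀ c, a ≼ c ↔ b ≼ c) : a = b :=
  S.pre_antisymm ((h b).2 (S.pre_refl b)) ((h a).1 (S.pre_refl a))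

/-! ### Conjugation by `Δ` -/

theorem conj_delta_pow (n : ℕ) (x : G) : (S.Δ ^ n)⁻¹ * x * S.Δ ^ n ∈ S.P ↔ x ∈ S.P := by
  induction n generalizing x with
  | zero => simp
  | succ n ih =>
    rw [← ih x, ← S.conj_delta ((S.Δ ^ n)⁻¹ * x * S.Δ ^ n)]
    simp [pow_succ, mul_assoc]

theorem conj_delta_zpow (n : ℤ) (x : G) : (S.Δ ^ n)⁻¹ * x * S.Δ ^ n ∈ S.P ↔ x ∈ S.P := by
  obtain ⟨m, rfl | rfl⟩ := n.eq_nat_or_neg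
  · simpa using S.conj_delta_pow m x
  · rw [← S.conj_delta_pow m]
    simp [mul_assoc]

theorem mul_zpow_pre_mul_zpow_iff (n : ℤ) (a b : G) :
    a * S.Δ ^ n ≼ b * S.Δ ^ n ↔ a ≼ b := by
  rw [PrefixOf, PrefixOf, ← S.conj_delta_zpow n (a⁻¹ * b)]
  simp [mul_assoc]

theorem mul_zpow_pre_iff (n : ℤ) (a b : G) : a * S.Δ ^ n ≼ b ↔ a ≼ b * S.Δ ^ (-n) := by
  rw [← S.mul_zpow_pre_mul_zpow_iff n a]
  simp

theorem pre_mul_zpow_iff (n : ℤ) (a b : G) : a ≼ b * S.Δ ^ n ↔ a * S.Δ ^ (-n) ≼ b := by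
  rw [mul_zpow_pre_iff, neg_neg]

theorem mul_delta_pre_mul_delta_iff (a b : G) : a * S.Δ ≼ b * S.Δ ↔ a ≼ b := by
  simpa using S.mul_zpow_pre_mul_zpow_iff 1 a b

theorem delta_zpow_mem {n : ℤ} (hn : 0 ≤ n) : S.Δ ^ n ∈ S.P := by
  lift n to ℕ using hn
  simpa using S.P.pow_mem S.delta_mem n

theorem zpow_pre_zpow {m n : ℤ} (h : m ≤ n) : S.Δ ^ m ≼ S.Δ ^ n := by
  have := S.delta_zpow_mem (sub_nonneg.2 h)
  rwa [PrefixOf, ← zpow_neg, ← zpow_add, neg_add_eq_sub]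

theorem mul_zpow_pre_mul_zpow (a : G) {m n : ℤ} (h : m ≤ n) : a * S.Δ ^ m ≼ a * S.Δ ^ n :=
  S.mul_pre_mul _ (S.zpow_pre_zpow h)

/-- For powers of `Δ`, prefixes and suffixes coincide. -/
theorem pre_delta_zpow_iff (n : ℤ) (a : G) : a ≼ S.Δ ^ n ↔ S.Δ ^ n * a⁻¹ ∈ S.P := by
  rw [PrefixOf, ← S.conj_delta_zpow n (S.Δ ^ n * a⁻¹)]
  simp

theorem pre_delta_iff (a : G) : a ≼ S.Δ ↔ S.Δ * a⁻¹ ∈ S.P := by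
  simpa using S.pre_delta_zpow_iff 1 a

theorem delta_zpow_pre_iff (n : ℤ) (a : G) : S.Δ ^ n ≼ a ↔ a * (S.Δ ^ n)⁻¹ ∈ S.P := by
  rw [PrefixOf, ← S.conj_delta_zpow n (a * (S.Δ ^ n)⁻¹)]
  simp [mul_assoc]

/-! ### Lattice operations -/

theorem gcd_pre_left (a b : G) : S.leftGcd a b ≼ a := (S.exists_gcd a b).choose_spec.1

theorem gcd_pre_right (a b : G) : S.leftGcd a b ≼ b := (S.exists_gcd a b).choose_spec.2.1

theorem pre_gcd_iff (a b c : G) : c ≼ S.leftGcd a b ↔ c ≼ a ∧ c ≼ b :=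
  ⟨fun h => ⟨S.pre_trans h (S.gcd_pre_left a b), S.pre_trans h (S.gcd_pre_right a b)⟩,
    fun h => (S.exists_gcd a b).choose_spec.2.2 c h.1 h.2⟩

theorem lcm_pre_iff (a b c : G) : S.leftLcm a b ≼ c ↔ a ≼ c ∧ b ≼ c :=
  ⟨fun h => ⟨S.pre_trans (S.exists_lcm a b).choose_spec.1 h,
      S.pre_trans (S.exists_lcm a b).choose_spec.2.1 h⟩,
    fun h => (S.exists_lcm a b).choose_spec.2.2 c h.1 h.2⟩

theorem pre_lcm_left (a b : G) : a ≼ S.leftLcm a b := (S.exists_lcm a b).choose_spec.1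

theorem pre_lcm_right (a b : G) : b ≼ S.leftLcm a b := (S.exists_lcm a b).choose_spec.2.1

theorem gcd_comm (a b : G) : S.leftGcd a b = S.leftGcd b a :=
  S.eq_of_pre_iff fun c => by simp only [pre_gcd_iff, and_comm]

theorem mul_gcd (c a b : G) : c * S.leftGcd a b = S.leftGcd (c * a) (c * b) :=
  S.eq_of_pre_iff fun d => by
    have key : ∀ e, d ≼ c * e ↔ c⁻¹ * d ≼ e := fun e => by rw [pre_iff_inv_mul, inv_inv]
    simp only [pre_gcd_iff, key]

theorem mul_lcm (c a b : G) : c * S.leftLcm a b = S.leftLcm (c * a) (c * b) :=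
  S.eq_of_iff_pre fun d => by simp only [lcm_pre_iff, pre_iff_inv_mul]

theorem gcd_mul_zpow (a b : G) (n : ℤ) :
    S.leftGcd a b * S.Δ ^ n = S.leftGcd (a * S.Δ ^ n) (b * S.Δ ^ n) :=
  S.eq_of_pre_iff fun d => by simp only [pre_gcd_iff, pre_mul_zpow_iff]

theorem lcm_mul_zpow (a b : G) (n : ℤ) :
    S.leftLcm a b * S.Δ ^ n = S.leftLcm (a * S.Δ ^ n) (b * S.Δ ^ n) :=
  S.eq_of_iff_pre fun d => by simp only [lcm_pre_iff, mul_zpow_pre_iff]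

theorem gcd_mem {a b : G} (ha : a ∈ S.P) (hb : b ∈ S.P) : S.leftGcd a b ∈ S.P := by
  rw [← one_pre_iff] at *
  exact (S.pre_gcd_iff _ _ _).2 ⟨ha, hb⟩

theorem mem_of_pre {a b : G} (ha : a ∈ S.P) (h : a ≼ b) : b ∈ S.P := by
  rw [← one_pre_iff] at *
  exact S.pre_trans ha h

theorem eq_one_of_pre_one {a : G} (ha : a ∈ S.P) (h : a ≼ 1) : a = 1 :=
  S.pre_antisymm h ((S.one_pre_iff a).2 ha)

theorem gcd_eq_left {a b : G} (h : a ≼ b) : S.leftGcd a b = a :=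
  S.pre_antisymm (S.gcd_pre_left a b) ((S.pre_gcd_iff _ _ _).2 ⟨S.pre_refl a, h⟩)

theorem gcd_eq_of_isLeftGcd {a b d : G} (h : IsLeftGcd S.P a b d) : S.leftGcd a b = d :=
  S.pre_antisymm (h.2.2 _ (S.gcd_pre_left a b) (S.gcd_pre_right a b))
    ((S.pre_gcd_iff _ _ _).2 ⟨h.1, h.2.1⟩)

theorem lcm_eq_of_isLeftLcm {a b m : G} (h : IsLeftLcm S.P a b m) : S.leftLcm a b = m :=
  S.pre_antisymm ((S.lcm_pre_iff _ _ _).2 ⟨h.1, h.2.1⟩)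
    (h.2.2 _ (S.pre_lcm_left a b) (S.pre_lcm_right a b))

theorem isLeftGcd_leftGcd (a b : G) : IsLeftGcd S.P a b (S.leftGcd a b) :=
  (S.exists_gcd a b).choose_spec

/-! ### Simple elements -/

variable {S} in
theorem IsSimple.mem {s : G} (h : S.IsSimple s) : s ∈ S.P := (S.one_pre_iff s).1 h.1

theorem isSimple_iff (s : G) : S.IsSimple s ↔ s ∈ S.P ∧ s ≼ S.Δ := by
  rw [IsSimple, one_pre_iff]

theorem isSimple_one : S.IsSimple 1 :=
  ⟨S.pre_refl 1, (S.one_pre_iff _).2 S.delta_mem⟩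

theorem isSimple_delta : S.IsSimple S.Δ :=
  ⟨(S.one_pre_iff _).2 S.delta_mem, S.pre_refl _⟩

variable {S} in
theorem IsSimple.of_pre {s t : G} (ht : S.IsSimple t) (hs : s ∈ S.P) (h : s ≼ t) :
    S.IsSimple s := (S.isSimple_iff s).2 ⟨hs, S.pre_trans h ht.2⟩

variable {S} in
/-- A suffix of a simple element is simple. -/
theorem IsSimple.inv_mul {s t : G} (ht : S.IsSimple t) (hs : s ∈ S.P) (h : s ≼ t) :
    S.IsSimple (s⁻¹ * t) := by
  refine (S.isSimple_iff _).2 ⟨h, ?_⟩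
  rw [pre_delta_iff]
  have h1 := S.P.mul_mem ((S.pre_delta_iff t).1 ht.2) hs
  simpa [mul_assoc] using h1

variable {S} in
theorem IsSimple.mul_inv {s t : G} (ht : S.IsSimple t) (hs : s ∈ S.P) (h : t * s⁻¹ ∈ S.P) :
    S.IsSimple (t * s⁻¹) :=
  ht.of_pre h (by simpa [PrefixOf] using hs)

variable {S} in
theorem IsSimple.rightCompl {s : G} (h : S.IsSimple s) : S.IsSimple (S.rightCompl s) :=
  S.isSimple_delta.inv_mul h.mem h.2

variable {S} in
theorem IsSimple.leftCompl {s : G} (h : S.IsSimple s) : S.IsSimple (S.leftCompl s) :=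
  S.isSimple_delta.mul_inv h.mem ((S.pre_delta_iff s).1 h.2)

theorem rightCompl_leftCompl (s : G) : S.rightCompl (S.leftCompl s) = s := by
  simp [GarsideStructure.rightCompl, GarsideStructure.leftCompl]

theorem leftCompl_rightCompl (s : G) : S.leftCompl (S.rightCompl s) = s := by
  simp [GarsideStructure.rightCompl, GarsideStructure.leftCompl]

theorem rightCompl_rightCompl (s : G) : S.rightCompl (S.rightCompl s) = S.tau s := by
  simp [GarsideStructure.rightCompl, GarsideStructure.tau, mul_assoc]

theorem leftCompl_leftCompl (s : G) : S.leftCompl (S.leftCompl s) = S.tauInv s := by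
  simp [GarsideStructure.leftCompl, GarsideStructure.tauInv, mul_assoc]

variable {S} in
theorem IsSimple.tauInv {s : G} (h : S.IsSimple s) : S.IsSimple (S.tauInv s) := by
  rw [← leftCompl_leftCompl]; exact h.leftCompl.leftCompl

/-- If `Δ = 1`, then `1` is the only simple element, and simple elements generate `G`. This is where
nontriviality of the group enters. -/
theorem delta_ne_one [Nontrivial G] : S.Δ ≠ 1 := by
  intro h
  have h1 : {s : G | PrefixOf S.P 1 s ∧ PrefixOf S.P s S.Δ} ⊆ {1} := by
    rintro s ⟨h2, h3⟩
    rw [h] at h3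
    exact S.pre_antisymm h3 h2
  have h2 := S.closure_simple
  rw [eq_top_iff] at h2
  have h3 : (⊤ : Subgroup G) ≤ ⊥ :=
    h2.trans ((Subgroup.closure_le _).2 (h1.trans (by simp)))
  exact bot_ne_top (le_bot_iff.1 h3).symm

/-! ### Lengths of decompositions and atoms -/

/-- The axiom `norm_finite` leaves out the element `1`; there the bound comes from the absence of
nontrivial units in `P`. -/
theorem decompositionLengths_one {n : ℕ} (h : n ∈ decompositionLengths S.P (1 : G)) :
    n = 0 := by
  obtain ⟨l, rfl, h1, h2⟩ := h
  cases l with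
  | nil => rfl
  | cons a l =>
    exfalso
    rw [List.prod_cons] at h2
    have h3 : l.prod ∈ S.P := S.P.list_prod_mem fun x hx => (h1 x (by simp [hx])).1
    refine (h1 a (by simp)).2 (S.eq_one_of_mem_of_inv_mem a (h1 a (by simp)).1 ?_)
    rwa [← eq_inv_of_mul_eq_one_right h2]

theorem bddAbove_decompositionLengths {x : G} (hx : x ∈ S.P) :
    BddAbove (decompositionLengths S.P x) := by
  by_cases h : x = 1
  · exact ⟨0, fun n hn => (S.decompositionLengths_one (h ▸ hn)).le⟩
  · exact S.norm_finite x hx h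

theorem le_norm {x : G} (hx : x ∈ S.P) {n : ℕ} (h : n ∈ decompositionLengths S.P x) :
    n ≤ S.norm x := le_csSup (S.bddAbove_decompositionLengths hx) h

theorem norm_mem {x : G} (hx : x ∈ S.P) : S.norm x ∈ decompositionLengths S.P x := by
  refine Nat.sSup_mem ?_ (S.bddAbove_decompositionLengths hx)
  by_cases h : x = 1
  · exact ⟨0, [], rfl, by simp, by simp [h]⟩
  · exact ⟨1, [x], rfl, by simp [hx, h], by simp⟩

theorem norm_add_le {x y : G} (hx : x ∈ S.P) (hy : y ∈ S.P) :
    S.norm x + S.norm y ≤ S.norm (x * y) := by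
  obtain ⟨l, h1, h2, h3⟩ := S.norm_mem hx
  obtain ⟨l', h1', h2', h3'⟩ := S.norm_mem hy
  refine S.le_norm (S.P.mul_mem hx hy) ⟨l ++ l', by simp [h1, h1'], ?_, by simp [h3, h3']⟩
  intro a ha
  rcases List.mem_append.1 ha with h | h
  exacts [h2 a h, h2' a h]

theorem norm_pos {x : G} (hx : x ∈ S.P) (h : x ≠ 1) : 0 < S.norm x :=
  S.le_norm hx ⟨[x], rfl, by simp [hx, h], by simp⟩

/-- Conjugation by `Δ` is an automorphism of `P`, so it carries decompositions to decompositions of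
the same length, in both directions. -/
theorem norm_tau {x : G} (hx : x ∈ S.P) : S.norm (S.tau x) ≤ S.norm x ∧
    S.norm x ≤ S.norm (S.tau x) := by
  have hx' : S.tau x ∈ S.P := (S.conj_delta x).2 hx
  constructor
  · obtain ⟨l, h1, h2, h3⟩ := S.norm_mem hx'
    refine S.le_norm hx ⟨l.map (MulAut.conj S.Δ), by simp [h1], ?_, ?_⟩
    · intro a ha
      obtain ⟨b, hb, rfl⟩ := List.mem_map.1 ha
      refine ⟨?_, by simpa using (h2 b hb).2⟩
      rw [← S.conj_delta]
      simpa [mul_assoc] using (h2 b hb).1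
    · rw [← map_list_prod, h3]
      simp [GarsideStructure.tau, mul_assoc]
  · obtain ⟨l, h1, h2, h3⟩ := S.norm_mem hx
    refine S.le_norm hx' ⟨l.map (MulAut.conj S.Δ⁻¹), by simp [h1], ?_, ?_⟩
    · intro a ha
      obtain ⟨b, hb, rfl⟩ := List.mem_map.1 ha
      refine ⟨?_, by rw [Ne, EmbeddingLike.map_eq_one_iff]; exact (h2 b hb).2⟩
      simpa using (S.conj_delta b).2 (h2 b hb).1
    · rw [← map_list_prod, h3]
      simp [GarsideStructure.tau]

theorem norm_le_norm_delta {s : G} (h : S.IsSimple s) : S.norm s ≤ S.norm S.Δ := by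
  have := S.norm_add_le h.mem h.2
  rw [mul_inv_cancel_left] at this
  omega

/-- A proper left factor of a nontrivial factorization has strictly smaller norm, so splitting must
end at an atom. -/
theorem exists_atom_pre {x : G} (hx : x ∈ S.P) (h : x ≠ 1) : ∃ a, S.IsAtom a ∧ a ≼ x := by
  induction hn : S.norm x using Nat.strong_induction_on generalizing x with
  | _ n ih =>
    by_cases ha : S.IsAtom x
    · exact ⟨x, ha, S.pre_refl x⟩
    · simp only [IsAtom, not_and, not_forall, not_or] at ha
      obtain ⟨b, hb, c, hc, rfl, h1, h2⟩ := ha hx h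
      have h3 := S.norm_add_le hb hc
      have h4 := S.norm_pos hc h2
      obtain ⟨a, ha, hab⟩ := ih _ (by omega) hb h1 rfl
      exact ⟨a, ha, S.pre_trans hab (S.pre_mul b hc)⟩

end Order

end GarsideStructure

namespace GarsideStructure

/-! ### Accumulating along a list -/

/-- Run through a list from the front, passing on a carry. -/
def accFront {G : Type u} (f g : G → G → G) : G → List G → G × List G
  | c, [] => (c, [])
  | c, x :: l => ((accFront f g (f c x) l).1, g c x :: (accFront f g (f c x) l).2)

/-- Run through a list from the back, passing on a carry. -/
def accBack {G : Type u} (f g : G → G → G) (c : G) : List G → G × List G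
  | [] => (c, [])
  | x :: l => (f (accBack f g c l).1 x, g (accBack f g c l).1 x :: (accBack f g c l).2)

section NormalForm

variable {G : Type u} [Group G] (S : GarsideStructure G)

local infix:50 "≼" => PrefixOf (GarsideStructure.P S)

/-! ### Left-weighted lists -/

/-- Since `aΔ = Δ τ(a)`, a divisor of `Δ` divides `aΔ` anyway; only the part of `b` inside `Δ` can
contribute to the simple prefix of `ab`. -/
theorem gcd_delta_mul {a : G} (ha : a ∈ S.P) (b : G) :
    S.leftGcd S.Δ (a * b) = S.leftGcd S.Δ (a * S.leftGcd S.Δ b) := by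
  refine S.eq_of_pre_iff fun c => ?_
  have h : S.Δ ≼ a * S.Δ := by
    rw [PrefixOf, ← mul_assoc]
    exact (S.conj_delta a).2 ha
  simp only [pre_gcd_iff, mul_gcd]
  exact ⟨fun hc => ⟨hc.1, S.pre_trans hc.1 h, hc.2⟩, fun hc => ⟨hc.1, hc.2.2⟩⟩

/-- From `Δ ∧ ab = a (∂(a) ∧ b)`: the pair is weighted exactly if `a` is the maximal simple prefix
of `ab`. All weightedness proofs below use this form. -/
theorem leftWeighted_iff (a b : G) : S.LeftWeighted a b ↔ S.leftGcd S.Δ (a * b) = a := by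
  have : S.leftGcd S.Δ (a * b) = a * S.leftGcd (S.rightCompl a) b := by
    rw [mul_gcd]; simp [rightCompl]
  rw [this, LeftWeighted, mul_eq_left]

/-- By `gcd_delta_mul` the tail may be replaced by its own maximal simple prefix, which is its head
by induction; then weightedness of the first two factors applies. The head of a weighted list can
thus be recovered from the product. -/
theorem gcd_delta_prod {x : G} {l : List G} (hl : ∀ y ∈ x :: l, S.IsSimple y)
    (h : (x :: l).IsChain S.LeftWeighted) : S.leftGcd S.Δ (x :: l).prod = x := by
  induction l generalizing x with
  | nil => rw [List.prod_singleton, gcd_comm]; exact S.gcd_eq_left (hl x (by simp)).2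
  | cons y l ih =>
    rw [List.isChain_cons_cons] at h
    rw [List.prod_cons, S.gcd_delta_mul (hl x (by simp)).mem,
      ih (fun z hz => hl z (by simp [List.mem_cons.1 hz])) h.2]
    exact (S.leftWeighted_iff x y).1 h.1

theorem prod_mem {l : List G} (hl : ∀ y ∈ l, S.IsSimple y) : l.prod ∈ S.P :=
  S.P.list_prod_mem fun y hy => (hl y hy).mem

theorem prod_pre_delta_pow {l : List G} (hl : ∀ y ∈ l, S.IsSimple y) :
    l.prod ≼ S.Δ ^ (l.length : ℤ) := by
  induction l with
  | nil => simpa using S.pre_refl (1 : G)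
  | cons x l ih =>
    have h1 := ih fun z hz => hl z (by simp [hz])
    have h2 : x ≼ S.Δ ^ (1 : ℤ) := by simpa using (hl x (by simp)).2
    rw [← S.mul_zpow_pre_mul_zpow_iff (l.length : ℤ), ← zpow_add] at h2
    rw [List.prod_cons, List.length_cons, Nat.cast_add, Nat.cast_one, add_comm]
    exact S.pre_trans (S.mul_pre_mul x h1) h2

/-- The element `cΔ⁻ᵐ` divides both `Δ` and `c`, hence their gcd. So removing the maximal simple
prefix uses up a full power of `Δ`. -/
theorem gcd_delta_inv_mul_pre {c : G} {m : ℤ} (hm : 0 ≤ m) (h : c ≼ S.Δ ^ (m + 1)) :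
    (S.leftGcd S.Δ c)⁻¹ * c ≼ S.Δ ^ m := by
  rw [pre_delta_zpow_iff, mul_inv_rev, inv_inv, ← mul_assoc]
  have h1 : c * S.Δ ^ (-m) ≼ S.leftGcd S.Δ c := by
    refine (S.pre_gcd_iff _ _ _).2 ⟨?_, ?_⟩
    · rw [mul_zpow_pre_iff, neg_neg, ← zpow_one_add, add_comm]
      exact h
    · simpa using S.mul_zpow_pre_mul_zpow c (neg_nonpos.2 hm)
  simpa [PrefixOf] using h1

/-- Each removal of the head lowers the admissible exponent by one, by `gcd_delta_inv_mul_pre`; the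
number of factors is therefore determined by the order. -/
theorem prod_pre_delta_zpow_iff {l : List G} (hl : ∀ y ∈ l, S.IsSimple y ∧ y ≠ 1)
    (h : l.IsChain S.LeftWeighted) (hd : S.Δ ≠ 1) (m : ℤ) :
    l.prod ≼ S.Δ ^ m ↔ (l.length : ℤ) ≤ m := by
  refine ⟨fun hm => ?_, fun hm => S.pre_trans (S.prod_pre_delta_pow fun y hy => (hl y hy).1)
    (S.zpow_pre_zpow hm)⟩
  induction l generalizing m with
  | nil =>
    by_contra! hneg
    have h1 : (1 : G) ≼ S.Δ ^ (-1 : ℤ) :=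
      S.pre_trans (by simpa using hm) (S.zpow_pre_zpow (by simp at hneg; omega))
    refine hd (S.eq_one_of_mem_of_inv_mem _ S.delta_mem ?_)
    simpa [PrefixOf] using h1
  | cons x l ih =>
    have hx := S.gcd_delta_prod (fun y hy => (hl y hy).1) h
    by_cases h0 : m ≤ 0
    · exfalso
      have h1 : x ≼ 1 := by
        have h2 : x ≼ (x :: l).prod := by
          rw [List.prod_cons]
          exact S.pre_mul x (S.prod_mem fun y hy => (hl y (by simp [hy])).1)
        simpa using S.pre_trans (S.pre_trans h2 hm) (S.zpow_pre_zpow h0)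
      exact (hl x (by simp)).2 (S.eq_one_of_pre_one (hl x (by simp)).1.mem h1)
    · have h1 := S.gcd_delta_inv_mul_pre (c := (x :: l).prod) (m := m - 1) (by omega)
        (by simpa using hm)
      rw [hx, List.prod_cons, inv_mul_cancel_left] at h1
      have h2 := ih (fun y hy => hl y (by simp [hy])) h.tail (m - 1) h1
      rw [List.length_cons]; push_cast; omega

/-! ### Uniqueness of the normal form -/

variable {S} in
-- If `Δ^(p+1)` divided `x`, then `Δ` would divide the product of the factors and so equal the first
-- of them, which is excluded. Together with `pre_zpow_iff` this describes `inf` and `sup` by the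
-- order alone.
theorem IsLeftNormalForm.zpow_pre_iff [Nontrivial G] {p : ℤ} {l : List G} {x : G}
    (h : S.IsLeftNormalForm p l x) (m : ℤ) : S.Δ ^ m ≼ x ↔ m ≤ p := by
  obtain ⟨rfl, h1, h2⟩ := h
  constructor
  · intro hm
    by_contra! hp
    have h3 : S.Δ ≼ l.prod := by
      have h4 : S.Δ ^ (p + 1) ≼ S.Δ ^ p * l.prod := S.pre_trans (S.zpow_pre_zpow hp) hm
      rwa [zpow_add_one, mul_pre_mul_iff] at h4
    cases l with
    | nil => exact S.delta_ne_one (S.eq_one_of_pre_one S.delta_mem h3)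
    | cons y l =>
      have h4 := S.gcd_delta_prod (fun z hz => (h1 z hz).1) h2
      rw [S.gcd_eq_left h3] at h4
      exact (h1 y (by simp)).2.2 h4.symm
  · intro hm
    exact S.pre_trans (S.zpow_pre_zpow hm) (S.pre_mul _ (S.prod_mem fun z hz => (h1 z hz).1))

variable {S} in
theorem IsLeftNormalForm.pre_zpow_iff [Nontrivial G] {p : ℤ} {l : List G} {x : G}
    (h : S.IsLeftNormalForm p l x) (m : ℤ) : x ≼ S.Δ ^ m ↔ p + l.length ≤ m := by
  obtain ⟨rfl, h1, h2⟩ := h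
  rw [pre_iff_inv_mul, ← zpow_neg, ← zpow_add,
    S.prod_pre_delta_zpow_iff (fun z hz => ⟨(h1 z hz).1, (h1 z hz).2.1⟩) h2 S.delta_ne_one]
  omega

variable {S} in
-- Both heads equal the gcd of `Δ` with the common product; cancel and repeat.
theorem eq_of_prod_eq {l l' : List G} (hl : ∀ y ∈ l, S.IsSimple y ∧ y ≠ 1)
    (hl' : ∀ y ∈ l', S.IsSimple y ∧ y ≠ 1) (h : l.IsChain S.LeftWeighted)
    (h' : l'.IsChain S.LeftWeighted) (he : l.prod = l'.prod) : l = l' := by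
  have key : ∀ {x : G} {l : List G}, (∀ y ∈ x :: l, S.IsSimple y ∧ y ≠ 1) →
      (x :: l).IsChain S.LeftWeighted → (x :: l).prod ≠ 1 := by
    intro x l hl h h1
    have h2 := S.gcd_delta_prod (fun y hy => (hl y hy).1) h
    rw [h1, gcd_comm, S.gcd_eq_left S.isSimple_one.2] at h2
    exact (hl x (by simp)).2 h2.symm
  induction l generalizing l' with
  | nil =>
    cases l' with
    | nil => rfl
    | cons y l' => exact absurd he.symm (key hl' h')
  | cons x l ih =>
    cases l' with
    | nil => exact absurd he (key hl h)
    | cons y l' =>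
      have hx := S.gcd_delta_prod (fun y hy => (hl y hy).1) h
      have hy := S.gcd_delta_prod (fun y hy => (hl' y hy).1) h'
      rw [he, hy] at hx
      subst hx
      have hll : l = l' := ih (fun z hz => hl z (by simp [hz]))
        (fun z hz => hl' z (by simp [hz])) h.tail h'.tail (by simpa using he)
      rw [hll]

variable {S} in
theorem IsLeftNormalForm.unique [Nontrivial G] {p q : ℤ} {l l' : List G} {x : G}
    (h : S.IsLeftNormalForm p l x) (h' : S.IsLeftNormalForm q l' x) : p = q ∧ l = l' := by
  have hp : p = q := le_antisymm
    ((h'.zpow_pre_iff p).1 ((h.zpow_pre_iff p).2 le_rfl))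
    ((h.zpow_pre_iff q).1 ((h'.zpow_pre_iff q).2 le_rfl))
  subst hp
  refine ⟨rfl, eq_of_prod_eq (fun y hy => ⟨(h.2.1 y hy).1, (h.2.1 y hy).2.1⟩)
    (fun y hy => ⟨(h'.2.1 y hy).1, (h'.2.1 y hy).2.1⟩) h.2.2 h'.2.2 ?_⟩
  have := h.1.symm.trans h'.1
  exact mul_left_cancel this

/-! ### Local sliding and multiplication by a simple element -/

/-- First factor of the local sliding of `s · t`. -/
noncomputable def slideFst (s t : G) : G := s * S.leftGcd (S.rightCompl s) t

/-- Second factor of the local sliding of `s · t`. -/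
noncomputable def slideSnd (s t : G) : G := (S.leftGcd (S.rightCompl s) t)⁻¹ * t

theorem slideFst_mul_slideSnd (s t : G) : S.slideFst s t * S.slideSnd s t = s * t := by
  simp [slideFst, slideSnd, mul_assoc]

theorem slideFst_eq (s t : G) : S.slideFst s t = S.leftGcd S.Δ (s * t) := by
  rw [slideFst, mul_gcd]; simp [rightCompl]

theorem isSimple_slideFst {s t : G} (hs : S.IsSimple s) (ht : S.IsSimple t) :
    S.IsSimple (S.slideFst s t) := by
  rw [slideFst_eq]
  exact S.isSimple_delta.of_pre (S.gcd_mem S.delta_mem (S.P.mul_mem hs.mem ht.mem))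
    (S.gcd_pre_left _ _)

theorem isSimple_slideSnd {s t : G} (hs : S.IsSimple s) (ht : S.IsSimple t) :
    S.IsSimple (S.slideSnd s t) :=
  ht.inv_mul (S.gcd_mem hs.rightCompl.mem ht.mem) (S.gcd_pre_right _ _)

theorem leftWeighted_slide (s t : G) : S.LeftWeighted (S.slideFst s t) (S.slideSnd s t) := by
  rw [leftWeighted_iff, slideFst_mul_slideSnd, slideFst_eq]

/-- The lists obtained by multiplying a left-weighted list by a simple element on the left. -/
noncomputable def mulFront (s : G) (l : List G) : List G :=
  (accFront S.slideSnd S.slideFst s l).2 ++ [(accFront S.slideSnd S.slideFst s l).1]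

@[simp] theorem mulFront_nil (s : G) : S.mulFront s [] = [s] := rfl

@[simp] theorem mulFront_cons (s x : G) (l : List G) :
    S.mulFront s (x :: l) = S.slideFst s x :: S.mulFront (S.slideSnd s x) l := rfl

theorem prod_mulFront (s : G) (l : List G) : (S.mulFront s l).prod = s * l.prod := by
  induction l generalizing s with
  | nil => simp
  | cons x l ih =>
    rw [mulFront_cons, List.prod_cons, ih, ← mul_assoc, slideFst_mul_slideSnd, List.prod_cons,
      mul_assoc]

theorem isSimple_mulFront {s : G} {l : List G} (hs : S.IsSimple s)
    (hl : ∀ y ∈ l, S.IsSimple y) : ∀ y ∈ S.mulFront s l, S.IsSimple y := by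
  induction l generalizing s with
  | nil => simpa using hs
  | cons x l ih =>
    have hx := hl x (by simp)
    intro y hy
    rw [mulFront_cons, List.mem_cons] at hy
    rcases hy with rfl | hy
    · exact S.isSimple_slideFst hs hx
    · exact ih (S.isSimple_slideSnd hs hx) (fun z hz => hl z (by simp [hz])) y hy

/-- Only the junction between the first two new factors is in question. Their product divides `s x
y`, and `Δ ∧ sxy = Δ ∧ sx` because `x` is already the maximal simple prefix of `xy`; the latter gcd
is the first new factor. -/
theorem isChain_mulFront {s : G} {l : List G} (hs : S.IsSimple s) (hl : ∀ y ∈ l, S.IsSimple y)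
    (h : l.IsChain S.LeftWeighted) : (S.mulFront s l).IsChain S.LeftWeighted := by
  induction l generalizing s with
  | nil => simp
  | cons x l ih =>
    have hx := hl x (by simp)
    have hs' := S.isSimple_slideSnd hs hx
    have h1 := ih hs' (fun z hz => hl z (by simp [hz])) h.tail
    cases l with
    | nil => simpa using S.leftWeighted_slide s x
    | cons y l =>
      rw [mulFront_cons, mulFront_cons, List.isChain_cons_cons]
      refine ⟨?_, h1⟩
      have hy := hl y (by simp)
      rw [List.isChain_cons_cons] at h
      rw [leftWeighted_iff]
      refine S.pre_antisymm ?_ ((S.pre_gcd_iff _ _ _).2 ⟨(S.isSimple_slideFst hs hx).2,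
        S.pre_mul _ (S.isSimple_slideFst hs' hy).mem⟩)
      have h2 : S.slideFst s x * S.slideFst (S.slideSnd s x) y ≼ s * (x * y) := by
        have h3 := S.mul_pre_mul (S.slideFst s x)
          (S.pre_mul (S.slideFst (S.slideSnd s x) y) (S.isSimple_slideSnd hs' hy).mem)
        rwa [slideFst_mul_slideSnd, ← mul_assoc, slideFst_mul_slideSnd,
          mul_assoc s] at h3
      have h4 : S.leftGcd S.Δ (S.slideFst s x * S.slideFst (S.slideSnd s x) y) ≼
          S.leftGcd S.Δ (s * (x * y)) :=
        (S.pre_gcd_iff _ _ _).2 ⟨S.gcd_pre_left _ _, S.pre_trans (S.gcd_pre_right _ _) h2⟩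
      rwa [S.gcd_delta_mul hs.mem (x * y), (S.leftWeighted_iff x y).1 h.1, ← S.slideFst_eq s] at h4

/-- The list obtained by multiplying a left-weighted list by a simple element on the right. -/
noncomputable def mulBack (l : List G) (s : G) : List G :=
  (accBack (fun c x => S.slideFst x c) (fun c x => S.slideSnd x c) s l).1 ::
    (accBack (fun c x => S.slideFst x c) (fun c x => S.slideSnd x c) s l).2

@[simp] theorem mulBack_nil (s : G) : S.mulBack [] s = [s] := rfl

/-- The list `mulBack l s` is never empty, so the default value `1` of `headD` is not reached. -/
theorem mulBack_cons (x : G) (l : List G) (s : G) : S.mulBack (x :: l) s =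
    S.slideFst x ((S.mulBack l s).headD 1) :: S.slideSnd x ((S.mulBack l s).headD 1) ::
      (S.mulBack l s).tail := rfl

theorem prod_mulBack (l : List G) (s : G) : (S.mulBack l s).prod = l.prod * s := by
  induction l with
  | nil => simp
  | cons x l ih =>
    rw [mulBack_cons, List.prod_cons, List.prod_cons, ← mul_assoc, slideFst_mul_slideSnd,
      List.prod_cons, mul_assoc, mul_assoc, ← ih]
    rfl

theorem isSimple_mulBack {s : G} {l : List G} (hs : S.IsSimple s)
    (hl : ∀ y ∈ l, S.IsSimple y) : ∀ y ∈ S.mulBack l s, S.IsSimple y := by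
  induction l with
  | nil => simpa using hs
  | cons x l ih =>
    have hx := hl x (by simp)
    have h1 := ih fun z hz => hl z (by simp [hz])
    have h2 : S.IsSimple ((S.mulBack l s).headD 1) := h1 _ (by simp [mulBack])
    intro y hy
    rw [mulBack_cons, List.mem_cons, List.mem_cons] at hy
    rcases hy with rfl | rfl | hy
    exacts [S.isSimple_slideFst hx h2, S.isSimple_slideSnd hx h2, h1 y (List.mem_of_mem_tail hy)]

/-- Domino rule for the multiplication on the right. -/
theorem leftWeighted_slideSnd {x₁ x₂ y : G} (h₁ : S.IsSimple x₁) (h₂ : S.IsSimple x₂)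
    (hy : S.IsSimple y) (h : S.LeftWeighted x₁ x₂) :
    S.LeftWeighted (S.slideSnd x₁ (S.slideFst x₂ y)) (S.slideSnd x₂ y) := by
  have hxs := S.isSimple_slideFst h₂ hy
  set x₂' := S.slideFst x₂ y with hx₂'
  set y' := S.slideSnd x₂ y with hy'
  have e1 : x₂' * y' = x₂ * y := S.slideFst_mul_slideSnd x₂ y
  set v := S.leftGcd (S.rightCompl x₁) x₂' with hv
  have hvP : v ∈ S.P := S.gcd_mem h₁.rightCompl.mem hxs.mem
  have e2 : S.slideSnd x₁ x₂' = v⁻¹ * x₂' := rfl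
  set w := S.slideSnd x₁ x₂' with hw
  have hws : S.IsSimple w := S.isSimple_slideSnd h₁ hxs
  have hys : S.IsSimple y' := S.isSimple_slideSnd h₂ hy
  -- a common extension `c` of `w` inside `Δ`
  rw [leftWeighted_iff]
  refine S.pre_antisymm ?_ ((S.pre_gcd_iff _ _ _).2 ⟨hws.2, S.pre_mul _ hys.mem⟩)
  set c := S.leftGcd S.Δ (w * y') with hc
  have hcw : w ≼ c := (S.pre_gcd_iff _ _ _).2 ⟨hws.2, S.pre_mul _ hys.mem⟩
  have hcP : c ∈ S.P := S.mem_of_pre hws.mem hcw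
  have hcs : S.IsSimple c := S.isSimple_delta.of_pre hcP (S.gcd_pre_left _ _)
  have e3 : v * w = x₂' := by rw [e2]; simp
  -- If `v c` divides `Δ`, it divides `x₂' = Δ ∧ x₂ y = v w`; cancelling `v` leaves the desired `c ≼
  -- w`.
  suffices hs : v * c ≼ S.Δ by
    have h1 : v * c ≼ x₂' := by
      rw [hx₂', slideFst_eq]
      refine (S.pre_gcd_iff _ _ _).2 ⟨hs, ?_⟩
      rw [← e1, ← e3, mul_assoc]
      exact S.mul_pre_mul v (S.gcd_pre_right _ _)
    rw [← e3] at h1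
    exact (S.mul_pre_mul_iff _ _ _).1 h1
  -- the element `b` with `v * c = x₂ * b`
  have hx₂x : x₂ ≼ x₂' := S.pre_mul _ (S.gcd_mem h₂.rightCompl.mem hy.mem)
  have hx₂c : x₂ ≼ v * c := S.pre_trans hx₂x (by rw [← e3]; exact S.mul_pre_mul v hcw)
  set b := x₂⁻¹ * (v * c) with hb
  have hbP : b ∈ S.P := hx₂c
  have hby : b ≼ y := by
    rw [hb, ← S.mul_pre_mul_iff x₂, mul_inv_cancel_left, ← e1, ← e3, mul_assoc]
    exact S.mul_pre_mul v (S.gcd_pre_right _ _)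
  have hbs : S.IsSimple b := hy.of_pre hbP hby
  -- the right lcm of `c` and `b` is simple
  obtain ⟨m, hm1, hm2, hm3⟩ := S.exists_rightLcm c b
  have hm4 : S.Δ * m⁻¹ ∈ S.P :=
    hm3 S.Δ ((S.pre_delta_iff c).1 hcs.2) ((S.pre_delta_iff b).1 hbs.2)
  have hm5 : v * c * m⁻¹ ∈ S.P := by
    refine hm3 (v * c) (by simpa [HasSuffix] using hvP) ?_
    have : v * c = x₂ * b := by simp [hb]
    rw [this]
    simpa [HasSuffix] using h₂.mem
  have hm6 : v * c * m⁻¹ ≼ v := by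
    have : (v * c * m⁻¹)⁻¹ * v = m * c⁻¹ := by group
    rw [PrefixOf, this]
    exact hm1
  have hm7 : v * c * m⁻¹ ≼ x₂ := by
    have : (v * c * m⁻¹)⁻¹ * x₂ = m * b⁻¹ := by rw [hb]; group
    rw [PrefixOf, this]
    exact hm2
  -- `v` divides `∂(x₁)`, which is coprime to `x₂`. Hence `v c m⁻¹`, a common prefix of `v` and
  -- `x₂`, is trivial, and `v c` is the right lcm `m`, which divides `Δ`.
  have hone : S.leftGcd v x₂ = 1 := by
    refine S.eq_one_of_pre_one (S.gcd_mem hvP h₂.mem) ?_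
    have h' : S.leftGcd (S.rightCompl x₁) x₂ = 1 := h
    rw [← h']
    exact (S.pre_gcd_iff _ _ _).2 ⟨S.pre_trans (S.gcd_pre_left _ _) (S.gcd_pre_left _ _),
      S.gcd_pre_right _ _⟩
  have hm8 : v * c * m⁻¹ = 1 := by
    refine S.eq_one_of_pre_one hm5 ?_
    rw [← hone]
    exact (S.pre_gcd_iff _ _ _).2 ⟨hm6, hm7⟩
  rw [mul_inv_eq_one.1 hm8]
  exact (S.pre_delta_iff m).2 hm4

/-- The first junction is weighted by construction of the local sliding; the next one, where both
factors have changed, is the domino rule. -/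
theorem isChain_mulBack {s : G} {l : List G} (hs : S.IsSimple s) (hl : ∀ y ∈ l, S.IsSimple y)
    (h : l.IsChain S.LeftWeighted) : (S.mulBack l s).IsChain S.LeftWeighted := by
  induction l with
  | nil => simp
  | cons x l ih =>
    have hx := hl x (by simp)
    have h1 := ih (fun z hz => hl z (by simp [hz])) h.tail
    rw [mulBack_cons, List.isChain_cons_cons]
    refine ⟨S.leftWeighted_slide _ _, ?_⟩
    cases l with
    | nil => simp
    | cons y l =>
      have hy := hl y (by simp)
      have h2 : S.IsSimple ((S.mulBack l s).headD 1) :=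
        S.isSimple_mulBack (l := l) hs (fun z hz => hl z (by simp [hz])) _ (by simp [mulBack])
      rw [List.isChain_cons_cons] at h
      rw [mulBack_cons, List.isChain_cons_cons] at h1
      rw [mulBack_cons, List.headD_cons, List.tail_cons, List.isChain_cons]
      refine ⟨fun z hz => ?_, h1.2⟩
      simp only [List.head?_cons, Option.mem_def, Option.some.injEq] at hz
      subst hz
      exact S.leftWeighted_slideSnd hx hy h2 h.1

/-! ### Removing trivial factors -/

/-- `Δ ^ p * x₁ * ⋯ * xᵣ` with `l = [x₁, …, xᵣ]` is a left-weighted product, where the factors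
may be trivial. -/
def IsWeightedForm (p : ℤ) (l : List G) (x : G) : Prop :=
  x = S.Δ ^ p * l.prod ∧ (∀ y ∈ l, S.IsSimple y) ∧ l.IsChain S.LeftWeighted

variable {S}

theorem IsLeftNormalForm.isWeightedForm {p : ℤ} {l : List G} {x : G}
    (h : S.IsLeftNormalForm p l x) : S.IsWeightedForm p l x :=
  ⟨h.1, fun y hy => (h.2.1 y hy).1, h.2.2⟩

theorem IsWeightedForm.of_cons_delta {p : ℤ} {l : List G} {x : G}
    (h : S.IsWeightedForm p (S.Δ :: l) x) : S.IsWeightedForm (p + 1) l x :=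
  ⟨by rw [h.1, List.prod_cons, zpow_add_one, mul_assoc], fun y hy => h.2.1 y (by simp [hy]),
    h.2.2.tail⟩

theorem IsWeightedForm.of_append_one {p : ℤ} {l : List G} {x : G}
    (h : S.IsWeightedForm p (l ++ [1]) x) : S.IsWeightedForm p l x :=
  ⟨by rw [h.1]; simp, fun y hy => h.2.1 y (by simp [hy]), (List.isChain_append.1 h.2.2).1⟩

/-- In a weighted pair `x`, `Δ` the complement `∂(x)` must be trivial, so `x = Δ`: factors `Δ` can
only occur in an initial run, and it suffices to look at the head. -/
theorem ne_delta_of_isChain {l : List G} (hl : ∀ y ∈ l, S.IsSimple y)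
    (h : l.IsChain S.LeftWeighted) (h1 : ∀ y ∈ l.head?, y ≠ S.Δ) : ∀ y ∈ l, y ≠ S.Δ := by
  induction l with
  | nil => simp
  | cons x l ih =>
    intro y hy
    have hx : x ≠ S.Δ := h1 x (by simp)
    rcases List.mem_cons.1 hy with rfl | hy
    · exact hx
    · refine ih (fun z hz => hl z (by simp [hz])) h.tail (fun z hz => ?_) y hy
      rintro rfl
      have h2 : S.leftGcd (S.rightCompl x) S.Δ = 1 := (List.isChain_cons.1 h).1 _ hz
      rw [S.gcd_eq_left (hl x (by simp)).rightCompl.2, rightCompl, inv_mul_eq_one] at h2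
      exact hx h2

/-- In a weighted pair `1`, `z` one has `z = Δ ∧ z = 1`: trivial factors form a final run, and it
suffices to look at the last entry. -/
theorem ne_one_of_isChain {l : List G} (hl : ∀ y ∈ l, S.IsSimple y)
    (h : l.IsChain S.LeftWeighted) (h1 : ∀ y ∈ l.getLast?, y ≠ 1) : ∀ y ∈ l, y ≠ 1 := by
  induction l with
  | nil => simp
  | cons x l ih =>
    cases l with
    | nil => simpa using h1
    | cons z l =>
      have h2 := ih (fun z hz => hl z (by simp [hz])) h.tail (by simpa using h1)
      intro y hy
      rcases List.mem_cons.1 hy with rfl | hy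
      · rintro rfl
        have h3 := (S.leftWeighted_iff _ _).1 (List.isChain_cons_cons.1 h).1
        rw [one_mul, gcd_comm, S.gcd_eq_left (hl z (by simp)).2] at h3
        exact h2 z (by simp) h3
      · exact h2 y hy

theorem IsWeightedForm.isLeftNormalForm {p : ℤ} {l : List G} {x : G}
    (h : S.IsWeightedForm p l x) (h1 : ∀ y ∈ l.head?, y ≠ S.Δ) (h2 : ∀ y ∈ l.getLast?, y ≠ 1) :
    S.IsLeftNormalForm p l x :=
  ⟨h.1, fun y hy => ⟨h.2.1 y hy, ne_one_of_isChain h.2.1 h.2.2 h2 y hy,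
    ne_delta_of_isChain h.2.1 h.2.2 h1 y hy⟩, h.2.2⟩

theorem IsWeightedForm.exists_isLeftNormalForm {p : ℤ} {l : List G} {x : G}
    (h : S.IsWeightedForm p l x) : ∃ q l', S.IsLeftNormalForm q l' x := by
  induction hn : l.length using Nat.strong_induction_on generalizing p l with
  | _ n ih =>
    by_cases h1 : ∀ y ∈ l.head?, y ≠ S.Δ
    · by_cases h2 : ∀ y ∈ l.getLast?, y ≠ 1
      · exact ⟨p, l, h.isLeftNormalForm h1 h2⟩
      · push Not at h2
        obtain ⟨y, hy, rfl⟩ := h2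
        obtain ⟨l', rfl⟩ := List.getLast?_eq_some_iff.1 hy
        exact ih _ (by rw [← hn]; simp) h.of_append_one rfl
    · push Not at h1
      obtain ⟨y, hy, rfl⟩ := h1
      cases l with
      | nil => simp at hy
      | cons z l =>
        simp only [List.head?_cons, Option.mem_def, Option.some.injEq] at hy
        subst hy
        exact ih _ (by rw [← hn]; simp) h.of_cons_delta rfl

/-! ### Multiplication of normal forms by simple elements -/

theorem isWeightedForm_mul {p : ℤ} {l : List G} {x s : G} (h : S.IsWeightedForm p l x)
    (hs : S.IsSimple s) : S.IsWeightedForm p (S.mulBack l s) (x * s) :=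
  ⟨by rw [prod_mulBack, h.1, mul_assoc], S.isSimple_mulBack hs h.2.1,
    S.isChain_mulBack hs h.2.1 h.2.2⟩

variable (S) in
/-- Conjugation by `Δ ^ n`. -/
def tauPow (n : ℤ) (s : G) : G := S.Δ ^ (-n) * s * S.Δ ^ n

theorem tauPow_add_one (n : ℤ) (s : G) : S.tauPow (n + 1) s = S.tauPow n (S.tau s) := by
  have : n + 1 = 1 + n := add_comm _ _
  rw [tauPow, tauPow, tau, this, neg_add_rev, zpow_add, zpow_add]
  simp [mul_assoc]

theorem tauPow_sub_one (n : ℤ) (s : G) : S.tauPow (n - 1) s = S.tauPow n (S.tauInv s) := by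
  have : n - 1 = -1 + n := by ring
  rw [tauPow, tauPow, tauInv, this, neg_add_rev, zpow_add, zpow_add]
  simp [mul_assoc]

@[simp] theorem tauPow_zero (s : G) : S.tauPow 0 s = s := by simp [tauPow]

theorem IsSimple.tauPow {s : G} (h : S.IsSimple s) (n : ℤ) : S.IsSimple (S.tauPow n s) := by
  refine (S.isSimple_iff _).2 ⟨?_, ?_⟩
  · simpa [GarsideStructure.tauPow] using (S.conj_delta_zpow n s).2 h.mem
  · have h1 := (S.conj_delta_zpow n (s⁻¹ * S.Δ)).2 h.2
    have h2 : S.Δ * S.Δ ^ n = S.Δ ^ n * S.Δ := by rw [← zpow_one_add, ← zpow_add_one, add_comm]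
    simpa [PrefixOf, GarsideStructure.tauPow, mul_assoc, h2] using h1

/-- The new factor has to pass `Δᵖ` before it meets the other factors, and this changes it to
`τᵖ(s)`. -/
theorem isWeightedForm_simple_mul {p : ℤ} {l : List G} {x s : G} (h : S.IsWeightedForm p l x)
    (hs : S.IsSimple s) : S.IsWeightedForm p (S.mulFront (S.tauPow p s) l) (s * x) :=
  ⟨by rw [prod_mulFront, h.1, tauPow]; simp [mul_assoc],
    S.isSimple_mulFront (hs.tauPow p) h.2.1, S.isChain_mulFront (hs.tauPow p) h.2.1 h.2.2⟩

theorem tauInv_gcd (a b : G) :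
    S.tauInv (S.leftGcd a b) = S.leftGcd (S.tauInv a) (S.tauInv b) := by
  simp only [tauInv, mul_gcd]
  simpa using S.gcd_mul_zpow (S.Δ * a) (S.Δ * b) (-1)

theorem leftWeighted_tauInv {a b : G} (h : S.LeftWeighted a b) :
    S.LeftWeighted (S.tauInv a) (S.tauInv b) := by
  have h1 : S.rightCompl (S.tauInv a) = S.tauInv (S.rightCompl a) := by
    simp [rightCompl, tauInv, mul_assoc]
  rw [LeftWeighted, h1, ← tauInv_gcd, show S.leftGcd _ _ = 1 from h]
  simp [tauInv]

theorem prod_map_tauInv (l : List G) : (l.map S.tauInv).prod = S.tauInv l.prod := by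
  induction l with
  | nil => simp [tauInv]
  | cons x l ih => rw [List.map_cons, List.prod_cons, ih, List.prod_cons]; simp [tauInv, mul_assoc]

/-- Moving `Δ⁻¹` from the right end to the front applies `τ⁻¹` to every factor, and `τ⁻¹` preserves
weightedness. -/
theorem IsLeftNormalForm.mul_delta_inv {p : ℤ} {l : List G} {x : G}
    (h : S.IsLeftNormalForm p l x) :
    S.IsLeftNormalForm (p - 1) (l.map S.tauInv) (x * S.Δ⁻¹) := by
  refine ⟨?_, ?_, ?_⟩
  · rw [h.1, prod_map_tauInv, tauInv, zpow_sub_one]; group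
  · intro y hy
    obtain ⟨z, hz, rfl⟩ := List.mem_map.1 hy
    obtain ⟨h1, h2, h3⟩ := h.2.1 z hz
    refine ⟨h1.tauInv, fun h4 => h2 ?_, fun h4 => h3 ?_⟩
    · have : z = S.tau (S.tauInv z) := by simp [tau, tauInv, mul_assoc]
      rw [this, h4]; simp [tau]
    · have : z = S.tau (S.tauInv z) := by simp [tau, tauInv, mul_assoc]
      rw [this, h4]; simp [tau]
  · rw [List.isChain_map]
    exact h.2.2.imp fun a b => leftWeighted_tauInv

theorem IsLeftNormalForm.delta_inv_mul {p : ℤ} {l : List G} {x : G}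
    (h : S.IsLeftNormalForm p l x) : S.IsLeftNormalForm (p - 1) l (S.Δ⁻¹ * x) := by
  refine ⟨?_, h.2⟩
  rw [h.1, zpow_sub_one, ← mul_assoc, ← zpow_neg_one, ← zpow_add, ← zpow_add, add_comm]

variable (S) in
theorem exists_isLeftNormalForm (x : G) : ∃ p l, S.IsLeftNormalForm p l x := by
  have hx : x ∈ Subgroup.closure {s : G | PrefixOf S.P 1 s ∧ PrefixOf S.P s S.Δ} := by
    rw [S.closure_simple]; trivial
  induction hx using Subgroup.closure_induction_right with
  | one => exact ⟨0, [], by simp [IsLeftNormalForm]⟩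
  | mul_right x _ s hs ih =>
    obtain ⟨p, l, h⟩ := ih
    exact (isWeightedForm_mul h.isWeightedForm hs).exists_isLeftNormalForm
  -- Division by `s` is multiplication by `∂(s)` followed by division by `Δ`.
  | mul_inv_cancel x _ s hs ih =>
    obtain ⟨p, l, h⟩ := ih
    have hs' : S.IsSimple s := hs
    obtain ⟨q, l', h'⟩ :=
      (isWeightedForm_mul h.isWeightedForm hs'.rightCompl).exists_isLeftNormalForm
    refine ⟨q - 1, l'.map S.tauInv, ?_⟩
    have h2 := h'.mul_delta_inv
    rwa [rightCompl, show x * (s⁻¹ * S.Δ) * S.Δ⁻¹ = x * s⁻¹ by group] at h2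

variable (S)

theorem isLeftNormalForm_leftNormalForm (x : G) :
    S.IsLeftNormalForm (S.leftNormalForm x).1 (S.leftNormalForm x).2 x := by
  obtain ⟨p, l, h⟩ := S.exists_isLeftNormalForm x
  exact Classical.epsilon_spec (p := fun n : ℤ × List G => S.IsLeftNormalForm n.1 n.2 x)
    ⟨(p, l), h⟩

variable [Nontrivial G]

theorem zpow_pre_iff_le_inf (m : ℤ) (x : G) : S.Δ ^ m ≼ x ↔ m ≤ S.inf x :=
  (S.isLeftNormalForm_leftNormalForm x).zpow_pre_iff m

theorem pre_zpow_iff_sup_le (m : ℤ) (x : G) : x ≼ S.Δ ^ m ↔ S.sup x ≤ m :=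
  (S.isLeftNormalForm_leftNormalForm x).pre_zpow_iff m

theorem zpow_inf_pre (x : G) : S.Δ ^ S.inf x ≼ x := (S.zpow_pre_iff_le_inf _ _).2 le_rfl

theorem pre_zpow_sup (x : G) : x ≼ S.Δ ^ S.sup x := (S.pre_zpow_iff_sup_le _ _).2 le_rfl

variable {S} in
theorem IsLeftNormalForm.inf_eq {p : ℤ} {l : List G} {x : G} (h : S.IsLeftNormalForm p l x) :
    S.inf x = p := ((S.isLeftNormalForm_leftNormalForm x).unique h).1

variable {S} in
theorem IsLeftNormalForm.sup_eq {p : ℤ} {l : List G} {x : G} (h : S.IsLeftNormalForm p l x) :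
    S.sup x = p + l.length := by
  rw [sup, canonicalLength, h.inf_eq, ((S.isLeftNormalForm_leftNormalForm x).unique h).2]

theorem inf_eq_iff {x : G} {p : ℤ} (h : ∀ m, S.Δ ^ m ≼ x ↔ m ≤ p) : S.inf x = p :=
  le_antisymm ((h _).1 (S.zpow_inf_pre x)) ((S.zpow_pre_iff_le_inf _ _).1 ((h p).2 le_rfl))

theorem sup_eq_iff {x : G} {p : ℤ} (h : ∀ m, x ≼ S.Δ ^ m ↔ p ≤ m) : S.sup x = p :=
  le_antisymm ((S.pre_zpow_iff_sup_le _ _).1 ((h p).2 le_rfl)) ((h _).1 (S.pre_zpow_sup x))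

/-- For a power of `Δ`, being a prefix and being a suffix amount to the same, so the order relation
with `x⁻¹` can be turned around. -/
theorem inf_inv (x : G) : S.inf x⁻¹ = - S.sup x := by
  refine S.inf_eq_iff fun m => ?_
  rw [le_neg, ← pre_zpow_iff_sup_le, PrefixOf, pre_delta_zpow_iff, ← inv_zpow', inv_zpow]

theorem sup_inv (x : G) : S.sup x⁻¹ = - S.inf x := by
  have := S.inf_inv x⁻¹
  rw [inv_inv] at this
  omega

end NormalForm

end GarsideStructure

namespace GarsideStructure

section Sliding

variable {G : Type u} [Group G] (S : GarsideStructure G)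

local infix:50 "≼" => PrefixOf (GarsideStructure.P S)

/-! ### The preferred prefix in terms of the normal form -/

theorem tauPow_gcd_delta (n : ℤ) (a : G) :
    S.leftGcd (S.tauPow n a) S.Δ = S.tauPow n (S.leftGcd S.Δ a) := by
  have h : S.tauPow n S.Δ = S.Δ := by
    rw [tauPow, ← zpow_add_one, ← zpow_add]; simp
  rw [gcd_comm]
  nth_rewrite 1 [← h]
  simp only [tauPow, gcd_mul_zpow, mul_gcd, mul_assoc]

theorem mul_zpow_add (y : G) (m n : ℤ) : y * S.Δ ^ m * S.Δ ^ n = y * S.Δ ^ (m + n) := by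
  rw [mul_assoc, zpow_add]

/-- Multiply the hypothesis by `Δ` on the right and by `y⁻¹` on the left. -/
theorem gcd_inv_mul_eq_rightCompl {n : ℤ} {g y : G} (h : S.leftGcd (g * S.Δ ^ n) y = 1) :
    S.leftGcd (y⁻¹ * g * S.Δ ^ (n + 1)) S.Δ = S.rightCompl y := by
  have h2 := congrArg (fun g => y⁻¹ * (g * S.Δ ^ (1 : ℤ))) h
  simp only [gcd_mul_zpow, mul_gcd, mul_zpow_add] at h2
  simpa [rightCompl, mul_assoc, zpow_add] using h2

/-- The initial simple factor of the inverse is the complement of the last factor. In the induction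
the shorter list contributes `∂(w)`, which is coprime to `y` by weightedness, and
`gcd_inv_mul_eq_rightCompl` applies. -/
theorem gcd_prod_inv_eq_rightCompl {l : List G} {y : G}
    (hl : ∀ z ∈ l ++ [y], S.IsSimple z) (h : (l ++ [y]).IsChain S.LeftWeighted) :
    S.leftGcd ((l ++ [y]).prod⁻¹ * S.Δ ^ ((l.length : ℤ) + 1)) S.Δ = S.rightCompl y := by
  have hy := hl y (by simp)
  rw [List.prod_append, List.prod_singleton, mul_inv_rev]
  apply gcd_inv_mul_eq_rightCompl
  induction l using List.reverseRecOn generalizing y with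
  | nil => simpa using S.gcd_eq_left hy.1
  | append_singleton l w ih =>
    have hl' : ∀ z ∈ l ++ [w], S.IsSimple z := fun z hz => hl z (by
      rw [List.mem_append]; exact Or.inl hz)
    have hw : S.LeftWeighted w y := by
      rw [List.append_assoc] at h
      have := (List.isChain_append.1 h).2.1
      simpa using this
    have h2 := S.gcd_inv_mul_eq_rightCompl
      (ih hl' (List.isChain_append.1 h).1 (hl' w (by simp)))
    refine Eq.trans (S.eq_of_pre_iff fun c => ?_) hw
    rw [← h2]
    simp only [pre_gcd_iff, List.length_append, List.length_singleton, Nat.cast_add, Nat.cast_one,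
      List.prod_append, List.prod_singleton, mul_inv_rev]
    exact ⟨fun hc => ⟨⟨hc.1, S.pre_trans hc.2 hy.2⟩, hc.2⟩, fun hc => ⟨hc.1.1, hc.2⟩⟩

variable {S} in
theorem IsLeftNormalForm.prefPrefix_nil [Nontrivial G] {p : ℤ} {x : G}
    (h : S.IsLeftNormalForm p [] x) : S.prefPrefix x = 1 := by
  have hx : x = S.Δ ^ p := by simpa using h.1
  have h1 : S.sup x = p := by simp [h.sup_eq]
  rw [prefPrefix, h.inf_eq, h1, hx, ← zpow_add]
  simp [S.gcd_eq_left (S.pre_refl 1), S.gcd_eq_left S.isSimple_one.2]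

variable {S} in
-- The two outer gcds with `Δ` are the initial factor of `x`, by `gcd_delta_prod`, and that of
-- `x⁻¹`, by `gcd_prod_inv_eq_rightCompl`. Thus one gcd of simple elements suffices to find the
-- preferred prefix.
theorem IsLeftNormalForm.prefPrefix_eq [Nontrivial G] {p : ℤ} {y z : G} {l l' : List G} {x : G}
    (h : S.IsLeftNormalForm p (y :: l) x) (hl : y :: l = l' ++ [z]) :
    S.prefPrefix x = S.leftGcd (S.tauPow (-p) y) (S.rightCompl z) := by
  have hs : ∀ a ∈ y :: l, S.IsSimple a := fun a ha => (h.2.1 a ha).1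
  have h1 : S.leftGcd (x * S.Δ ^ (-S.inf x)) S.Δ = S.tauPow (-p) y := by
    rw [h.inf_eq, h.1]
    have := S.tauPow_gcd_delta (-p) (y :: l).prod
    rw [S.gcd_delta_prod hs h.2.2] at this
    rw [← this, tauPow, neg_neg]
  have h2 : S.leftGcd (x⁻¹ * S.Δ ^ S.sup x) S.Δ = S.rightCompl z := by
    rw [h.sup_eq, h.1]
    have hs' := hs
    have hc := h.2.2
    rw [hl] at hs' hc ⊢
    rw [← S.gcd_prod_inv_eq_rightCompl hs' hc]
    simp [zpow_add, mul_assoc]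
  rw [← h1, ← h2]
  refine S.eq_of_pre_iff fun c => ?_
  simp only [prefPrefix, pre_gcd_iff]
  tauto

theorem isSimple_prefPrefix [Nontrivial G] (x : G) : S.IsSimple (S.prefPrefix x) := by
  refine S.isSimple_delta.of_pre (S.gcd_mem (S.gcd_mem ?_ ?_) S.delta_mem) (S.gcd_pre_right _ _)
  · rw [← one_pre_iff, pre_mul_zpow_iff]; simpa using S.zpow_inf_pre x
  · exact S.pre_zpow_sup x

/-! ### Sliding with fixed bounds for the infimum and the supremum -/

/-- The preferred prefix with `inf` and `sup` replaced by prescribed bounds. -/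
noncomputable def boundedPrefix (p q : ℤ) (z : G) : G :=
  S.leftGcd (S.leftGcd (z * S.Δ ^ (-p)) (z⁻¹ * S.Δ ^ q)) S.Δ

noncomputable def boundedSlide (p q : ℤ) (z : G) : G := conj z (S.boundedPrefix p q z)

/-- The initial factor with respect to a prescribed bound for the infimum. -/
noncomputable def boundedInitial (p : ℤ) (z : G) : G := S.leftGcd (z * S.Δ ^ (-p)) S.Δ

/-- Cycling with respect to a prescribed bound for the infimum. -/
noncomputable def boundedCycle (p : ℤ) (z : G) : G := conj z (S.boundedInitial p z)

/-- Multiplication on the left, and by powers of `Δ` on the right, distributes over gcds; a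
translated preferred prefix is therefore described by three inequalities. -/
theorem pre_mul_boundedPrefix_iff (p q n : ℤ) (c y z : G) :
    c ≼ y * S.boundedPrefix p q z * S.Δ ^ n ↔
      c ≼ y * z * S.Δ ^ (n - p) ∧ c ≼ y * z⁻¹ * S.Δ ^ (q + n) ∧ c ≼ y * S.Δ ^ (n + 1) := by
  rw [boundedPrefix]
  simp only [mul_gcd, gcd_mul_zpow, pre_gcd_iff, ← mul_assoc, mul_zpow_add]
  rw [show y * S.Δ * S.Δ ^ n = y * S.Δ ^ (n + 1) by rw [mul_assoc, ← zpow_one_add, add_comm],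
    show -p + n = n - p by ring, and_assoc]

theorem pre_mul_boundedInitial_iff (p n : ℤ) (c y z : G) :
    c ≼ y * S.boundedInitial p z * S.Δ ^ n ↔
      c ≼ y * z * S.Δ ^ (n - p) ∧ c ≼ y * S.Δ ^ (n + 1) := by
  rw [boundedInitial]
  simp only [mul_gcd, gcd_mul_zpow, pre_gcd_iff, ← mul_assoc, mul_zpow_add]
  rw [show y * S.Δ * S.Δ ^ n = y * S.Δ ^ (n + 1) by rw [mul_assoc, ← zpow_one_add, add_comm],
    show -p + n = n - p by ring]

/-- After moving `z` across the conjugators by `c · zᶜ = z · c`, both sides expand to the gcd of the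
same five elements `z²Δ^(-2p)`, `zΔ^(1-p)`, `Δ^(q-p)`, `z⁻¹Δ^(q+1)` and `Δ²`. -/
theorem boundedInitial_mul_boundedPrefix (p q : ℤ) (z : G) :
    S.boundedInitial p z * S.boundedPrefix p q (S.boundedCycle p z) =
      S.boundedPrefix p q z * S.boundedInitial p (S.boundedSlide p q z) := by
  refine S.eq_of_pre_iff fun c => ?_
  have h1 := S.pre_mul_boundedPrefix_iff p q 0 c (S.boundedInitial p z) (S.boundedCycle p z)
  have h2 := S.pre_mul_boundedInitial_iff p 0 c (S.boundedPrefix p q z) (S.boundedSlide p q z)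
  have e1 : S.boundedInitial p z * S.boundedCycle p z = z * S.boundedInitial p z := by
    simp [boundedCycle, conj, mul_assoc]
  have e2 : S.boundedInitial p z * (S.boundedCycle p z)⁻¹ = z⁻¹ * S.boundedInitial p z := by
    simp [boundedCycle, conj, mul_assoc]
  have e3 : S.boundedPrefix p q z * S.boundedSlide p q z = z * S.boundedPrefix p q z := by
    simp [boundedSlide, conj, mul_assoc]
  rw [zpow_zero, mul_one, e1, e2] at h1
  rw [zpow_zero, mul_one, e3] at h2
  have h3 := S.pre_mul_boundedInitial_iff p (0 + 1) c 1 z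
  have h4 := S.pre_mul_boundedPrefix_iff p q (0 + 1) c 1 z
  simp only [one_mul] at h3 h4
  rw [h1, h2, pre_mul_boundedInitial_iff, pre_mul_boundedInitial_iff, h3,
    pre_mul_boundedPrefix_iff, h4]
  rw [show q + 0 - p = 0 - p + q by ring, show q + (0 - p) = 0 - p + q by ring,
    show (0 : ℤ) - p + 1 = 1 - p by ring, show (0 : ℤ) + 1 - p = 1 - p by ring,
    show q + 0 + 1 = q + 1 by ring, show q + (0 + 1) = q + 1 by ring,
    mul_inv_cancel, inv_mul_cancel]
  tauto

/-- The bounds are fixed in advance because the true infimum and supremum may change along the way;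
with fixed bounds the commutation holds for every element. -/
theorem boundedCycle_boundedSlide (p q : ℤ) (z : G) :
    S.boundedSlide p q (S.boundedCycle p z) = S.boundedCycle p (S.boundedSlide p q z) := by
  have h1 : ∀ a b : G, conj (conj z a) b = conj z (a * b) := fun a b => by
    simp [conj, mul_assoc]
  change conj (conj z (S.boundedInitial p z)) (S.boundedPrefix p q (S.boundedCycle p z)) =
    conj (conj z (S.boundedPrefix p q z)) (S.boundedInitial p (S.boundedSlide p q z))
  rw [h1, h1, boundedInitial_mul_boundedPrefix]

theorem pre_conj_iff (m : ℤ) (z c : G) : S.Δ ^ m ≼ conj z c ↔ c * S.Δ ^ m ≼ z * c := by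
  rw [conj, ← S.mul_pre_mul_iff c]; simp [mul_assoc]

theorem conj_pre_iff (m : ℤ) (z c : G) : conj z c ≼ S.Δ ^ m ↔ z * c ≼ c * S.Δ ^ m := by
  rw [conj, ← S.mul_pre_mul_iff c]; simp [mul_assoc]

theorem boundedPrefix_mem {p q : ℤ} {z : G} (h1 : S.Δ ^ p ≼ z) (h2 : z ≼ S.Δ ^ q) :
    S.boundedPrefix p q z ∈ S.P := by
  refine S.gcd_mem (S.gcd_mem ?_ h2) S.delta_mem
  rw [← one_pre_iff, pre_mul_zpow_iff]; simpa using h1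

theorem boundedInitial_mem {p : ℤ} {z : G} (h1 : S.Δ ^ p ≼ z) : S.boundedInitial p z ∈ S.P := by
  refine S.gcd_mem ?_ S.delta_mem
  rw [← one_pre_iff, pre_mul_zpow_iff]; simpa using h1

theorem boundedPrefix_pre (p q : ℤ) (z : G) : S.boundedPrefix p q z ≼ z * S.Δ ^ (-p) ∧
    S.boundedPrefix p q z ≼ z⁻¹ * S.Δ ^ q ∧ S.boundedPrefix p q z ≼ S.Δ := by
  have := (S.pre_gcd_iff _ _ _).1 (S.pre_refl (S.boundedPrefix p q z))
  exact ⟨((S.pre_gcd_iff _ _ _).1 this.1).1, ((S.pre_gcd_iff _ _ _).1 this.1).2, this.2⟩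

/-- With `u` the conjugator, `uΔᵖ ≼ z ≼ zu` gives the lower bound and `zu ≼ Δ^q ≼ uΔ^q` the upper
one. -/
theorem boundedSlide_bounds {p q : ℤ} {z : G} (h1 : S.Δ ^ p ≼ z) (h2 : z ≼ S.Δ ^ q) :
    S.Δ ^ p ≼ S.boundedSlide p q z ∧ S.boundedSlide p q z ≼ S.Δ ^ q := by
  have hu := S.boundedPrefix_mem h1 h2
  obtain ⟨h3, h4, h5⟩ := S.boundedPrefix_pre p q z
  constructor
  · rw [boundedSlide, pre_conj_iff]
    refine S.pre_trans ?_ (S.pre_mul z hu)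
    rwa [mul_zpow_pre_iff]
  · rw [boundedSlide, conj_pre_iff]
    have h6 : z * S.boundedPrefix p q z ≼ S.Δ ^ q := by
      rw [pre_iff_inv_mul]; exact h4
    refine S.pre_trans h6 ?_
    have := (S.mul_zpow_pre_mul_zpow_iff q 1 _).2 ((S.one_pre_iff _).2 hu)
    simpa using this

theorem boundedCycle_bounds {p q : ℤ} {z : G} (h1 : S.Δ ^ p ≼ z) (h2 : z ≼ S.Δ ^ q) :
    S.Δ ^ p ≼ S.boundedCycle p z ∧ S.boundedCycle p z ≼ S.Δ ^ q := by
  have hu := S.boundedInitial_mem h1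
  have h3 : S.boundedInitial p z ≼ z * S.Δ ^ (-p) := S.gcd_pre_left _ _
  have h4 : S.boundedInitial p z ≼ S.Δ := S.gcd_pre_right _ _
  constructor
  · rw [boundedCycle, pre_conj_iff]
    refine S.pre_trans ?_ (S.pre_mul z hu)
    rwa [mul_zpow_pre_iff]
  · have h5 := S.pre_mul_boundedInitial_iff p q (z * S.boundedInitial p z) 1 z
    rw [one_mul, one_mul, one_mul] at h5
    rw [boundedCycle, conj_pre_iff, h5]
    constructor
    · refine S.mul_pre_mul z (S.pre_trans h3 ?_)
      have := (S.mul_zpow_pre_mul_zpow_iff (-p) _ _).2 h2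
      rwa [← zpow_add] at this
    · refine S.pre_trans (S.mul_pre_mul z h4) ?_
      have := (S.mul_zpow_pre_mul_zpow_iff 1 _ _).2 h2
      rwa [← zpow_add, zpow_one] at this

/-- Sliding preserves a better bound for the infimum. -/
theorem succ_le_boundedSlide {p q : ℤ} {z : G} (h1 : S.Δ ^ (p + 1) ≼ z) :
    S.Δ ^ (p + 1) ≼ S.boundedSlide p q z := by
  obtain ⟨h3, h4, -⟩ := S.boundedPrefix_pre p q z
  have e1 : S.boundedPrefix p q z * S.Δ ^ (p + 1) ≼ z * S.Δ ^ (1 : ℤ) := by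
    rw [mul_zpow_pre_iff, mul_assoc, ← zpow_add]
    convert h3 using 3; ring
  have h6 := S.pre_mul_boundedPrefix_iff p q 0 (S.boundedPrefix p q z * S.Δ ^ (p + 1)) z z
  rw [zpow_zero, mul_one, mul_inv_cancel, one_mul] at h6
  rw [boundedSlide, pre_conj_iff, h6]
  refine ⟨S.pre_trans e1 ?_, ?_, by simpa using e1⟩
  · rw [mul_assoc, mul_pre_mul_iff, pre_mul_zpow_iff, ← zpow_add]
    convert h1 using 2; ring
  · rw [mul_zpow_pre_iff]
    refine S.pre_trans h4 ?_
    rw [← S.mul_pre_mul_iff z, mul_inv_cancel_left, add_zero, ← zpow_add, pre_mul_zpow_iff,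
      ← zpow_add]
    convert h1 using 2; ring

/-- If cycling increases the infimum, so does sliding. -/
theorem succ_le_boundedSlide_of_boundedCycle {p q : ℤ} {z : G} (h2 : z ≼ S.Δ ^ q)
    (h3 : ¬ S.Δ ^ (p + 1) ≼ z) (h4 : S.Δ ^ (p + 1) ≼ S.boundedCycle p z) :
    S.Δ ^ (p + 1) ≼ S.boundedSlide p q z := by
  obtain ⟨h5, -, h7⟩ := S.boundedPrefix_pre p q z
  have hui : S.boundedPrefix p q z ≼ S.boundedInitial p z := (S.pre_gcd_iff _ _ _).2 ⟨h5, h7⟩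
  rw [boundedCycle, pre_conj_iff] at h4
  -- Otherwise `z ≼ Δ^(p+1)`, the initial factor is all of `zΔ⁻ᵖ`, and cycling is conjugation by a
  -- power of `Δ`, which cannot raise the infimum.
  have hq : p + 2 ≤ q := by
    by_contra! hq
    apply h3
    have h8 : z ≼ S.Δ ^ (p + 1) := S.pre_trans h2 (S.zpow_pre_zpow (by omega))
    have h9 : S.boundedInitial p z = z * S.Δ ^ (-p) := by
      refine S.gcd_eq_left ?_
      rw [mul_zpow_pre_iff, neg_neg, ← zpow_one_add, add_comm]
      exact h8
    rw [h9, mul_assoc, ← zpow_add, mul_pre_mul_iff, ← S.mul_zpow_pre_mul_zpow_iff p,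
      ← zpow_add, mul_assoc, ← zpow_add] at h4
    convert h4 using 2
    · ring
    · simp
  have e1 : S.boundedPrefix p q z * S.Δ ^ (p + 1) ≼ z * S.Δ ^ (1 : ℤ) := by
    rw [mul_zpow_pre_iff, mul_assoc, ← zpow_add]
    convert h5 using 3; ring
  have h6 := S.pre_mul_boundedPrefix_iff p q 0 (S.boundedPrefix p q z * S.Δ ^ (p + 1)) z z
  rw [zpow_zero, mul_one, mul_inv_cancel, one_mul] at h6
  rw [boundedSlide, pre_conj_iff, h6]
  refine ⟨?_, ?_, by simpa using e1⟩
  · refine S.pre_trans ((S.mul_zpow_pre_mul_zpow_iff _ _ _).2 hui) (S.pre_trans h4 ?_)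
    have h8 := (S.pre_mul_boundedInitial_iff p 0 _ z z).1 (S.pre_refl _)
    simpa using h8.1
  · rw [mul_zpow_pre_iff, add_zero, ← zpow_add]
    refine S.pre_trans h7 ?_
    simpa using S.zpow_pre_zpow (m := 1) (n := q + -(p + 1)) (by omega)

/-- If the infimum can be increased by a conjugation, then it is increased by iterated cycling. -/
theorem exists_succ_le_iterate_boundedCycle {p : ℤ} {z β : G} (h1 : S.Δ ^ p ≼ z) (hβ : β ∈ S.P)
    (h2 : S.Δ ^ (p + 1) ≼ β * z * β⁻¹) : ∃ k : ℕ, S.Δ ^ (p + 1) ≼ (S.boundedCycle p)^[k] z := by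
  induction hn : S.norm β using Nat.strong_induction_on generalizing z β with
  | _ n ih =>
    by_cases h3 : S.Δ ^ (p + 1) ≼ z
    · exact ⟨0, h3⟩
    set i := S.boundedInitial p z with hi
    have hiP : i ∈ S.P := S.boundedInitial_mem h1
    have hiΔ : i ≼ S.Δ := S.gcd_pre_right _ _
    -- `Δ` divides `β * (z * Δ ^ (-p))`
    have h4 : β⁻¹ * S.Δ ≼ z * S.Δ ^ (-p) := by
      have h5 : S.Δ ^ (p + 1) ≼ β * z := by
        have h6 : β * z * β⁻¹ ≼ β * z := by
          simpa [PrefixOf, mul_assoc] using hβ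
        exact S.pre_trans h2 h6
      rw [pre_mul_zpow_iff, neg_neg, mul_assoc, ← zpow_one_add, add_comm, pre_iff_inv_mul,
        inv_inv]
      exact h5
    have h5 : β⁻¹ * S.Δ ≼ i := by
      refine (S.pre_gcd_iff _ _ _).2 ⟨h4, ?_⟩
      simpa [PrefixOf, ← mul_assoc] using (S.conj_delta β).2 hβ
    -- This is the conjugator for the cycled element. Multiplied by `i⁻¹Δ` it gives `τ(β)`, and `i =
    -- Δ` would contradict `h3`; so its norm is smaller than that of `β`.
    have hβ' : S.Δ⁻¹ * β * i ∈ S.P := by simpa [PrefixOf] using h5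
    have hne : i⁻¹ * S.Δ ≠ 1 := by
      intro h6
      rw [inv_mul_eq_one] at h6
      apply h3
      have h7 : i ≼ z * S.Δ ^ (-p) := S.gcd_pre_left _ _
      rwa [h6, pre_mul_zpow_iff, neg_neg, ← zpow_one_add, add_comm] at h7
    have h6 := S.norm_add_le hβ' hiΔ
    have h7 : S.Δ⁻¹ * β * i * (i⁻¹ * S.Δ) = S.tau β := by simp [tau, mul_assoc]
    rw [h7] at h6
    have h8 := S.norm_pos hiΔ hne
    have h9 := (S.norm_tau hβ).1
    have h10 : S.Δ ^ p ≼ S.boundedCycle p z := by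
      rw [boundedCycle, pre_conj_iff]
      refine S.pre_trans ?_ (S.pre_mul z hiP)
      rw [mul_zpow_pre_iff]
      exact S.gcd_pre_left _ _
    have h11 : S.Δ ^ (p + 1) ≼ S.Δ⁻¹ * β * i * S.boundedCycle p z * (S.Δ⁻¹ * β * i)⁻¹ := by
      have e1 : S.Δ⁻¹ * β * i * S.boundedCycle p z * (S.Δ⁻¹ * β * i)⁻¹ =
          S.Δ⁻¹ * (β * z * β⁻¹ * S.Δ) := by
        simp [boundedCycle, conj, ← hi, mul_assoc]
      rw [e1, ← S.mul_pre_mul_iff S.Δ, mul_inv_cancel_left, ← zpow_one_add, add_comm, zpow_add_one,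
        mul_delta_pre_mul_delta_iff]
      exact h2
    obtain ⟨k, hk⟩ := ih _ (by omega) h10 hβ' h11 rfl
    exact ⟨k + 1, by simpa using hk⟩

/-! ### Sliding circuits are contained in the super summit set -/

variable [Nontrivial G]

omit [Nontrivial G] in
theorem slide_eq (z : G) : S.slide z = S.boundedSlide (S.inf z) (S.sup z) z := rfl

theorem inf_le_inf_slide (z : G) : S.inf z ≤ S.inf (S.slide z) := by
  rw [← zpow_pre_iff_le_inf]
  exact (S.boundedSlide_bounds (S.zpow_inf_pre z) (S.pre_zpow_sup z)).1

theorem sup_slide_le_sup (z : G) : S.sup (S.slide z) ≤ S.sup z := by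
  rw [← pre_zpow_iff_sup_le]
  exact (S.boundedSlide_bounds (S.zpow_inf_pre z) (S.pre_zpow_sup z)).2

theorem inf_iterate_slide_mono (z : G) : Monotone fun n => S.inf (S.slide^[n] z) :=
  monotone_nat_of_le_succ fun n => by
    rw [Function.iterate_succ_apply']; exact S.inf_le_inf_slide _

theorem sup_iterate_slide_anti (z : G) : Antitone fun n => S.sup (S.slide^[n] z) :=
  antitone_nat_of_succ_le fun n => by
    rw [Function.iterate_succ_apply']; exact S.sup_slide_le_sup _

/-- The infimum is maximal on a sliding circuit. -/
theorem inf_le_of_periodic {z w : G} {m : ℕ} (hm : 1 ≤ m) (hz : S.slide^[m] z = z)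
    (hw : IsConj z w) : S.inf w ≤ S.inf z := by
  by_contra! hlt
  set p := S.inf z with hp
  set q := S.sup z with hq
  -- Along a periodic orbit the monotone quantities `inf` and `sup` are constant, so sliding is
  -- bounded sliding with the same `p` and `q` throughout.
  have hit : ∀ n ≤ m, S.slide^[n] z = (S.boundedSlide p q)^[n] z := by
    intro n hn
    induction n with
    | zero => rfl
    | succ n ih =>
      have h1 := S.inf_iterate_slide_mono z (Nat.zero_le n)
      have h2 := S.inf_iterate_slide_mono z (show n ≤ m by omega)
      have h3 := S.sup_iterate_slide_anti z (Nat.zero_le n)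
      have h4 := S.sup_iterate_slide_anti z (show n ≤ m by omega)
      simp only [hz, Function.iterate_zero, id_eq] at h1 h2 h3 h4
      rw [Function.iterate_succ_apply', Function.iterate_succ_apply', ← ih (by omega), slide_eq,
        le_antisymm h2 h1, le_antisymm h3 h4]
  have hper : (S.boundedSlide p q)^[m] z = z := by rw [← hit m le_rfl, hz]
  -- iterated cycling stays in the bounds and commutes with sliding
  have hcyc : ∀ k, S.Δ ^ p ≼ (S.boundedCycle p)^[k] z ∧ (S.boundedCycle p)^[k] z ≼ S.Δ ^ q ∧
      (S.boundedSlide p q)^[m] ((S.boundedCycle p)^[k] z) = (S.boundedCycle p)^[k] z := by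
    intro k
    induction k with
    | zero => exact ⟨S.zpow_inf_pre z, S.pre_zpow_sup z, hper⟩
    | succ k ih =>
      rw [Function.iterate_succ_apply']
      have h1 := S.boundedCycle_bounds ih.1 ih.2.1
      refine ⟨h1.1, h1.2, ?_⟩
      have hcomm : Function.Commute (S.boundedSlide p q) (S.boundedCycle p) :=
        fun y => S.boundedCycle_boundedSlide p q y
      rw [(hcomm.iterate_left m).eq, ih.2.2]
  -- some iterated cycling increases the infimum
  have hex : ∃ k : ℕ, S.Δ ^ (p + 1) ≼ (S.boundedCycle p)^[k] z := by
    obtain ⟨g, hg⟩ := isConj_iff.1 hw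
    -- The conjugator has to be positive. The extra power of `Δ` conjugates `w` without changing its
    -- infimum.
    have hg0 : S.Δ ^ (-S.inf g) * g ∈ S.P := by
      have := S.zpow_inf_pre g
      rwa [PrefixOf, ← zpow_neg] at this
    refine S.exists_succ_le_iterate_boundedCycle (S.zpow_inf_pre z) hg0 ?_
    have e1 : S.Δ ^ (-S.inf g) * g * z * (S.Δ ^ (-S.inf g) * g)⁻¹ =
        S.Δ ^ (-S.inf g) * (w * S.Δ ^ S.inf g) := by
      rw [← hg]; simp [mul_assoc]
    rw [e1, ← S.mul_pre_mul_iff (S.Δ ^ S.inf g), ← mul_assoc (S.Δ ^ S.inf g) (S.Δ ^ (-S.inf g)),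
      ← zpow_add, ← zpow_add, add_neg_cancel, zpow_zero, one_mul, add_comm, zpow_add,
      mul_zpow_pre_mul_zpow_iff, zpow_pre_iff_le_inf]
    omega
  classical
  have hk := Nat.find_spec hex
  have hmin := fun j => Nat.find_min hex (m := j)
  generalize Nat.find hex = k at hk hmin
  cases k with
  | zero =>
    rw [Function.iterate_zero, id_eq, zpow_pre_iff_le_inf] at hk
    omega
  -- By minimality `y` is the last iterate with infimum below `p + 1`. One more cycling raises the
  -- infimum, hence so does sliding, and further slidings keep it; but `y` returns to itself after
  -- `m` slidings.
  | succ k =>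
    rw [Function.iterate_succ_apply'] at hk
    have h1 := hmin k (by omega)
    obtain ⟨h2, h3, h4⟩ := hcyc k
    set y := (S.boundedCycle p)^[k] z with hy
    have h5 := S.succ_le_boundedSlide_of_boundedCycle h3 h1 hk
    have h6 : ∀ n, S.Δ ^ (p + 1) ≼ (S.boundedSlide p q)^[n + 1] y ∧
        (S.boundedSlide p q)^[n + 1] y ≼ S.Δ ^ q := by
      intro n
      induction n with
      | zero => exact ⟨h5, (S.boundedSlide_bounds h2 h3).2⟩
      | succ n ih =>
        rw [Function.iterate_succ_apply']
        exact ⟨S.succ_le_boundedSlide ih.1,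
          (S.boundedSlide_bounds (S.pre_trans (S.zpow_pre_zpow (by omega)) ih.1) ih.2).2⟩
    have h7 := (h6 (m - 1)).1
    rw [Nat.sub_add_cancel hm, h4] at h7
    exact h1 h7

/-- Inversion exchanges the two outer elements in the definition, since it exchanges `inf` and `sup`
up to sign. So sliding commutes with inversion, and results on `inf` yield results on `sup`. -/
theorem prefPrefix_inv (x : G) : S.prefPrefix x⁻¹ = S.prefPrefix x := by
  rw [prefPrefix, prefPrefix, inf_inv, sup_inv, inv_inv, neg_neg,
    S.gcd_comm (x⁻¹ * S.Δ ^ S.sup x)]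

theorem slide_inv (x : G) : S.slide x⁻¹ = (S.slide x)⁻¹ := by
  simp [slide, prefPrefix_inv, conj, mul_assoc]

theorem iterate_slide_inv (n : ℕ) (x : G) : S.slide^[n] x⁻¹ = (S.slide^[n] x)⁻¹ := by
  induction n generalizing x with
  | zero => rfl
  | succ n ih => rw [Function.iterate_succ_apply, Function.iterate_succ_apply, slide_inv, ih]

/-- The supremum is minimal on a sliding circuit. -/
theorem le_sup_of_periodic {z w : G} {m : ℕ} (hm : 1 ≤ m) (hz : S.slide^[m] z = z)
    (hw : IsConj z w) : S.sup z ≤ S.sup w := by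
  have h := S.inf_le_of_periodic (z := z⁻¹) (w := w⁻¹) hm (by rw [iterate_slide_inv, hz])
    (by
      obtain ⟨g, hg⟩ := isConj_iff.1 hw
      exact isConj_iff.2 ⟨g, by rw [← hg]; simp [mul_assoc]⟩)
  rw [inf_inv, inf_inv] at h
  omega

/-- Needed for the pullback: the element `z` there is only given on a sliding circuit, but the
formula and the length bound for `z` use that it lies in the super summit set. -/
theorem mem_SSS_of_mem_SC {x z : G} (hz : z ∈ S.SC x) : z ∈ S.SSS x := by
  obtain ⟨h1, m, hm, h2⟩ := hz
  refine ⟨h1, ⟨⟨z, h1, rfl⟩, ?_⟩, ⟨⟨z, h1, rfl⟩, ?_⟩⟩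
  · rintro _ ⟨w, hw, rfl⟩
    exact S.inf_le_of_periodic hm h2 (h1.symm.trans hw)
  · rintro _ ⟨w, hw, rfl⟩
    exact S.le_sup_of_periodic hm h2 (h1.symm.trans hw)

end Sliding

end GarsideStructure

namespace GarsideStructure

section Opposite

variable {G : Type u} [Group G] (S : GarsideStructure G)

open MulOpposite

/-! ### The opposite Garside structure -/

theorem delta_pre_iff_suffix (s : G) : PrefixOf S.P s S.Δ ↔ HasSuffix S.P S.Δ s :=
  S.pre_delta_iff s

theorem prod_map_op_reverse (l : List G) : (l.map op).reverse.prod = op l.prod := by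
  rw [← MulOpposite.op_list_prod]

theorem decompositionLengths_op (P : Submonoid G) (x : G) :
    decompositionLengths P.op (op x) = decompositionLengths P x := by
  ext n
  constructor
  · rintro ⟨l, h1, h2, h3⟩
    refine ⟨(l.map unop).reverse, by simpa using h1, ?_, ?_⟩
    · intro a ha
      simp only [List.mem_reverse, List.mem_map] at ha
      obtain ⟨b, hb, rfl⟩ := ha
      obtain ⟨h4, h5⟩ := h2 b hb
      exact ⟨h4, by simpa using h5⟩
    · rw [← MulOpposite.unop_list_prod, h3, unop_op]
  · rintro ⟨l, h1, h2, h3⟩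
    refine ⟨(l.map op).reverse, by simpa using h1, ?_, ?_⟩
    · intro a ha
      simp only [List.mem_reverse, List.mem_map] at ha
      obtain ⟨b, hb, rfl⟩ := ha
      obtain ⟨h4, h5⟩ := h2 b hb
      exact ⟨h4, by simpa using h5⟩
    · rw [prod_map_op_reverse, h3]

theorem prefixOf_op_iff (P : Submonoid G) (a b : G) :
    PrefixOf P.op (op a) (op b) ↔ HasSuffix P b a := Iff.rfl

theorem isSimple_iff_suffix (s : G) : S.IsSimple s ↔ HasSuffix S.P s 1 ∧ HasSuffix S.P S.Δ s := by
  rw [IsSimple, delta_pre_iff_suffix]; simp [PrefixOf, HasSuffix]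

/-- The opposite Garside structure, for which the prefix order is the suffix order. -/
def op : GarsideStructure Gᵐᵒᵖ where
  P := S.P.op
  Δ := MulOpposite.op S.Δ
  delta_mem := S.delta_mem
  eq_one_of_mem_of_inv_mem x h1 h2 := by
    have := S.eq_one_of_mem_of_inv_mem x.unop h1 h2
    exact unop_injective this
  exists_gcd a b := by
    obtain ⟨d, h1, h2, h3⟩ := S.exists_rightGcd a.unop b.unop
    exact ⟨MulOpposite.op d, h1, h2, fun c => h3 c.unop⟩
  exists_lcm a b := by
    obtain ⟨d, h1, h2, h3⟩ := S.exists_rightLcm a.unop b.unop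
    exact ⟨MulOpposite.op d, h1, h2, fun c => h3 c.unop⟩
  closure_simple := by
    have h : {s : Gᵐᵒᵖ | PrefixOf S.P.op 1 s ∧ PrefixOf S.P.op s (MulOpposite.op S.Δ)} =
        MulOpposite.unop ⁻¹' {s : G | PrefixOf S.P 1 s ∧ PrefixOf S.P s S.Δ} := by
      ext s
      exact (S.isSimple_iff_suffix s.unop).symm
    rw [h, ← Subgroup.op_closure, S.closure_simple]
    simp
  conj_delta x := by
    have h := S.conj_delta (S.Δ * x.unop * S.Δ⁻¹)
    have e : S.Δ⁻¹ * (S.Δ * x.unop * S.Δ⁻¹) * S.Δ = x.unop := by group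
    rw [e] at h
    rw [Submonoid.mem_op, Submonoid.mem_op, h]
    simp [mul_assoc]
  norm_finite x h1 h2 := by
    have h3 := S.norm_finite x.unop h1 (by simpa using h2)
    rwa [← decompositionLengths_op] at h3

@[simp] theorem op_P : S.op.P = S.P.op := rfl

@[simp] theorem op_delta : S.op.Δ = MulOpposite.op S.Δ := rfl

theorem norm_op (x : G) : S.op.norm (MulOpposite.op x) = S.norm x := by
  rw [norm, norm, op_P, decompositionLengths_op]

theorem isSimple_op_iff (s : G) : S.op.IsSimple (MulOpposite.op s) ↔ S.IsSimple s :=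
  (S.isSimple_iff_suffix s).symm

theorem finiteType_op (h : S.FiniteType) : S.op.FiniteType := by
  refine (h.preimage (f := MulOpposite.unop) unop_injective.injOn).subset ?_
  intro s hs
  exact (S.isSimple_op_iff s.unop).1 hs

theorem isAtom_op_iff (a : G) : S.op.IsAtom (MulOpposite.op a) ↔ S.IsAtom a := by
  constructor
  · rintro ⟨h1, h2, h3⟩
    refine ⟨h1, by simpa using h2, fun b hb c hc h => ?_⟩
    have := h3 (MulOpposite.op c) hc (MulOpposite.op b) hb (by rw [h, op_mul])
    simpa [or_comm] using this
  · rintro ⟨h1, h2, h3⟩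
    refine ⟨h1, by simpa using h2, fun b hb c hc h => ?_⟩
    have := h3 c.unop hc b.unop hb (by rw [← unop_mul, ← h, unop_op])
    simpa [or_comm] using this

theorem rightGcd_eq_of_isRightGcd {a b d : G} (h : IsRightGcd S.P a b d) :
    S.rightGcd a b = d := by
  have h' := (S.exists_rightGcd a b).choose_spec
  exact op_injective (S.op.pre_antisymm (h.2.2 _ h'.1 h'.2.1) (h'.2.2 _ h.1 h.2.1))

theorem leftGcd_op (a b : G) :
    S.op.leftGcd (MulOpposite.op a) (MulOpposite.op b) = MulOpposite.op (S.rightGcd a b) := by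
  obtain ⟨h1, h2, h3⟩ := (S.exists_rightGcd a b).choose_spec
  exact S.op.gcd_eq_of_isLeftGcd ⟨h1, h2, fun c => h3 c.unop⟩

theorem leftLcm_op (a b : G) :
    S.op.leftLcm (MulOpposite.op a) (MulOpposite.op b) = MulOpposite.op (S.rightLcm a b) := by
  obtain ⟨h1, h2, h3⟩ := (S.exists_rightLcm a b).choose_spec
  exact S.op.lcm_eq_of_isLeftLcm ⟨h1, h2, fun c => h3 c.unop⟩

theorem rightGcd_op (a b : G) :
    S.op.rightGcd (MulOpposite.op a) (MulOpposite.op b) = MulOpposite.op (S.leftGcd a b) := by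
  obtain ⟨h1, h2, h3⟩ := S.isLeftGcd_leftGcd a b
  exact S.op.rightGcd_eq_of_isRightGcd ⟨h1, h2, fun c => h3 c.unop⟩

theorem rightCompl_op (s : G) :
    S.op.rightCompl (MulOpposite.op s) = MulOpposite.op (S.leftCompl s) := rfl

theorem leftCompl_op (s : G) :
    S.op.leftCompl (MulOpposite.op s) = MulOpposite.op (S.rightCompl s) := rfl

theorem tau_op (s : G) : S.op.tau (MulOpposite.op s) = MulOpposite.op (S.tauInv s) := by
  simp [tau, tauInv, mul_assoc]

theorem leftWeighted_op_iff (a b : G) :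
    S.op.LeftWeighted (MulOpposite.op b) (MulOpposite.op a) ↔ S.RightWeighted a b := by
  have h : S.rightGcd (S.leftCompl b) a = S.rightGcd a (S.leftCompl b) := by
    apply op_injective
    rw [← leftGcd_op, ← leftGcd_op, gcd_comm]
  rw [LeftWeighted, RightWeighted, rightCompl_op, leftGcd_op, h, op_eq_one_iff]

theorem rightWeighted_op_iff (a b : G) :
    S.op.RightWeighted (MulOpposite.op b) (MulOpposite.op a) ↔ S.LeftWeighted a b := by
  rw [LeftWeighted, RightWeighted, leftCompl_op, rightGcd_op, gcd_comm, op_eq_one_iff]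

/-- Passing to the opposite group reverses the factors, and `∂` becomes `∂⁻¹`, so the two
weightedness conditions are exchanged. -/
theorem isLeftNormalForm_op_iff (p : ℤ) (l : List G) (x : G) :
    S.op.IsLeftNormalForm p (l.map MulOpposite.op).reverse (MulOpposite.op x) ↔
      S.IsRightNormalForm p l x := by
  rw [IsLeftNormalForm, IsRightNormalForm, prod_map_op_reverse, op_delta, ← op_zpow, ← op_mul,
    op_inj, List.isChain_reverse, List.isChain_map]
  refine and_congr Iff.rfl (and_congr ?_ ?_)
  · simp only [List.mem_reverse, List.mem_map, forall_exists_index, and_imp,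
      forall_apply_eq_imp_iff₂, isSimple_op_iff, ne_eq, op_eq_one_iff, op_inj]
  · simp only [leftWeighted_op_iff]

theorem isRightNormalForm_op_iff (p : ℤ) (l : List G) (x : G) :
    S.op.IsRightNormalForm p (l.map MulOpposite.op).reverse (MulOpposite.op x) ↔
      S.IsLeftNormalForm p l x := by
  rw [IsLeftNormalForm, IsRightNormalForm, prod_map_op_reverse, op_delta, ← op_zpow, ← op_mul,
    op_inj, List.isChain_reverse, List.isChain_map]
  refine and_congr Iff.rfl (and_congr ?_ ?_)
  · simp only [List.mem_reverse, List.mem_map, forall_exists_index, and_imp,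
      forall_apply_eq_imp_iff₂, isSimple_op_iff, ne_eq, op_eq_one_iff, op_inj]
  · simp only [rightWeighted_op_iff]

variable [Nontrivial G]

theorem inf_op (x : G) : S.op.inf (MulOpposite.op x) = S.inf x := by
  refine S.op.inf_eq_iff fun m => ?_
  rw [op_P, op_delta, ← op_zpow, prefixOf_op_iff, HasSuffix, ← delta_zpow_pre_iff,
    zpow_pre_iff_le_inf]

theorem sup_op (x : G) : S.op.sup (MulOpposite.op x) = S.sup x := by
  refine S.op.sup_eq_iff fun m => ?_
  rw [op_P, op_delta, ← op_zpow, prefixOf_op_iff, HasSuffix, ← pre_delta_zpow_iff,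
    pre_zpow_iff_sup_le]

theorem prefPrefix_op (x : G) :
    S.op.prefPrefix (MulOpposite.op x) = MulOpposite.op (S.prefSuffix x) := by
  rw [prefPrefix, prefSuffix, inf_op, sup_op, op_delta, ← op_zpow, ← op_zpow, ← op_inv, ← op_mul,
    ← op_mul, leftGcd_op, leftGcd_op]

omit [Nontrivial G] in
-- The inverse on the right is the reason why the right-hand operations conjugate by `s⁻¹` where the
-- left-hand ones conjugate by `s`.
theorem conj_op (x c : G) :
    conj (MulOpposite.op x) (MulOpposite.op c) = MulOpposite.op (conj x c⁻¹) := by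
  simp [conj, mul_assoc]

theorem slide_op (x : G) : S.op.slide (MulOpposite.op x) = MulOpposite.op (S.rightSlide x) := by
  rw [slide, rightSlide, prefPrefix_op, conj_op]

theorem iterate_slide_op (n : ℕ) (x : G) :
    S.op.slide^[n] (MulOpposite.op x) = MulOpposite.op (S.rightSlide^[n] x) := by
  induction n generalizing x with
  | zero => rfl
  | succ n ih => rw [Function.iterate_succ_apply, Function.iterate_succ_apply, slide_op, ih]

omit [Nontrivial G] in
theorem isConj_op_iff (x y : G) : IsConj (MulOpposite.op x) (MulOpposite.op y) ↔ IsConj x y := by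
  simp only [isConj_iff]
  constructor
  · rintro ⟨c, hc⟩
    refine ⟨c.unop⁻¹, op_injective ?_⟩
    rw [← hc]; simp [mul_assoc]
  · rintro ⟨c, rfl⟩
    exact ⟨MulOpposite.op c⁻¹, by simp [mul_assoc]⟩

theorem mem_SC_op_iff (x y : G) :
    MulOpposite.op y ∈ S.op.SC (MulOpposite.op x) ↔ y ∈ S.rightSC x := by
  simp only [SC, rightSC, Set.mem_ofPred_eq, isConj_op_iff, iterate_slide_op, op_inj]

/-- Conjugacy, `inf` and `sup` are insensitive to the exchange of left and right, so there is only
one super summit set. -/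
theorem mem_SSS_op_iff (x y : G) :
    MulOpposite.op y ∈ S.op.SSS (MulOpposite.op x) ↔ y ∈ S.SSS x := by
  have h1 : S.op.inf '' {w | IsConj (MulOpposite.op x) w} = S.inf '' {w | IsConj x w} := by
    ext n
    constructor
    · rintro ⟨w, hw, rfl⟩
      exact ⟨w.unop, (isConj_op_iff x w.unop).1 hw, (S.inf_op w.unop).symm⟩
    · rintro ⟨w, hw, rfl⟩
      exact ⟨MulOpposite.op w, (isConj_op_iff x w).2 hw, S.inf_op w⟩
  have h2 : S.op.sup '' {w | IsConj (MulOpposite.op x) w} = S.sup '' {w | IsConj x w} := by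
    ext n
    constructor
    · rintro ⟨w, hw, rfl⟩
      exact ⟨w.unop, (isConj_op_iff x w.unop).1 hw, (S.sup_op w.unop).symm⟩
    · rintro ⟨w, hw, rfl⟩
      exact ⟨MulOpposite.op w, (isConj_op_iff x w).2 hw, S.sup_op w⟩
  simp only [SSS, Set.mem_ofPred_eq, isConj_op_iff, h1, h2, inf_op, sup_op]

theorem transport_op (x α : G) : S.op.transport (MulOpposite.op x) (MulOpposite.op α) =
    MulOpposite.op (S.rightTransport x α) := by
  rw [transport, rightTransport, conj_op, prefPrefix_op, prefPrefix_op]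
  simp [mul_assoc]

theorem pullbackCandidate_op_iff (x z s v : G) :
    S.op.PullbackCandidate (MulOpposite.op x) (MulOpposite.op z) (MulOpposite.op s)
      (MulOpposite.op v) ↔ S.RightPullbackCandidate x z s v := by
  rw [PullbackCandidate, RightPullbackCandidate, conj_op, mem_SSS_op_iff, transport_op]
  exact Iff.rfl

theorem isPullback_op_iff (x z s v : G) :
    S.op.IsPullback (MulOpposite.op x) (MulOpposite.op z) (MulOpposite.op s)
      (MulOpposite.op v) ↔ S.IsRightPullback x z s v := by
  rw [IsPullback, IsRightPullback, pullbackCandidate_op_iff]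
  refine and_congr Iff.rfl ⟨fun h v hv => ?_, fun h v hv => ?_⟩
  · exact h (MulOpposite.op v) ((S.pullbackCandidate_op_iff x z s v).2 hv)
  · exact h v.unop ((S.pullbackCandidate_op_iff x z s v.unop).1 hv)

/-! ### The pullback -/

local infix:50 "≼" => PrefixOf (GarsideStructure.P S)

omit [Nontrivial G] in
theorem inf_eq_of_mem_SSS {x y z : G} (hy : y ∈ S.SSS x) (hz : z ∈ S.SSS x) :
    S.inf y = S.inf z := hy.2.1.unique hz.2.1

omit [Nontrivial G] in
theorem sup_eq_of_mem_SSS {x y z : G} (hy : y ∈ S.SSS x) (hz : z ∈ S.SSS x) :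
    S.sup y = S.sup z := hy.2.2.unique hz.2.2

omit [Nontrivial G] in
theorem mem_SSS_iff {x y z : G} (hz : z ∈ S.SSS x) (hy : IsConj x y) :
    y ∈ S.SSS x ↔ S.inf z ≤ S.inf y ∧ S.sup y ≤ S.sup z := by
  refine ⟨fun h => ⟨(S.inf_eq_of_mem_SSS hz h).le, (S.sup_eq_of_mem_SSS h hz).le⟩, fun h => ?_⟩
  have h1 : S.inf y = S.inf z := le_antisymm (hz.2.1.2 ⟨y, hy, rfl⟩) h.1
  have h2 : S.sup y = S.sup z := le_antisymm h.2 (hz.2.2.2 ⟨y, hy, rfl⟩)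
  exact ⟨hy, h1 ▸ hz.2.1, h2 ▸ hz.2.2⟩

omit [Nontrivial G] in
theorem isConj_conj {x z : G} (h : IsConj x z) (c : G) : IsConj x (conj z c) :=
  h.trans (isConj_iff.2 ⟨c⁻¹, by simp [conj]⟩)

/-- The elements that conjugate a given element into its super summit set are closed under
least common multiples. -/
theorem conj_lcm_mem_SSS {x z a b : G} (hz : z ∈ S.SSS x) (ha : conj z a ∈ S.SSS x)
    (hb : conj z b ∈ S.SSS x) : conj z (S.leftLcm a b) ∈ S.SSS x := by
  rw [S.mem_SSS_iff hz (isConj_conj hz.1 _)] at ha hb ⊢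
  -- The bounds for `zᶜ` become `cΔᵖ ≼ zc` and `zc ≼ cΔ^q`. Both pass to lcms, because
  -- multiplication by `z` on the left and by powers of `Δ` on the right distributes over lcms.
  rw [← zpow_pre_iff_le_inf, ← pre_zpow_iff_sup_le, pre_conj_iff, conj_pre_iff] at ha hb ⊢
  constructor
  · rw [lcm_mul_zpow, mul_lcm]
    refine (S.lcm_pre_iff _ _ _).2 ⟨S.pre_trans ha.1 (S.pre_lcm_left _ _),
      S.pre_trans hb.1 (S.pre_lcm_right _ _)⟩
  · rw [lcm_mul_zpow, mul_lcm]
    refine (S.lcm_pre_iff _ _ _).2 ⟨S.pre_trans ha.2 (S.pre_lcm_left _ _),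
      S.pre_trans hb.2 (S.pre_lcm_right _ _)⟩

/-- Each of the three inequalities that define `β ≼ 𝔭(y)` turns into the corresponding suffix
condition for `y^β`; for instance, `β ≼ yΔ⁻ᵖ` says that `Δ⁻ᵖ y^β` ends in `β`. The exponents match
because conjugation by `β` preserves `inf` and `sup`. -/
theorem pre_prefPrefix_iff {y β : G} (h1 : S.inf (conj y β) = S.inf y)
    (h2 : S.sup (conj y β) = S.sup y) :
    β ≼ S.prefPrefix y ↔ S.prefSuffix (conj y β) * β⁻¹ ∈ S.P := by
  have h3 : S.prefSuffix (conj y β) * β⁻¹ ∈ S.P ↔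
      PrefixOf S.op.P (MulOpposite.op β) (S.op.prefPrefix (MulOpposite.op (conj y β))) := by
    rw [prefPrefix_op]; exact Iff.rfl
  rw [h3, prefPrefix, prefPrefix]
  simp only [pre_gcd_iff]
  rw [inf_op, sup_op, h1, h2]
  have e1 : β ≼ y * S.Δ ^ (-S.inf y) ↔
      S.Δ ^ (-S.inf y) * conj y β * β⁻¹ ∈ S.P := by
    rw [PrefixOf, ← S.conj_delta_zpow (-S.inf y) (S.Δ ^ (-S.inf y) * conj y β * β⁻¹)]
    simp [conj, mul_assoc]
  have e2 : β ≼ y⁻¹ * S.Δ ^ S.sup y ↔ S.Δ ^ S.sup y * (conj y β)⁻¹ * β⁻¹ ∈ S.P := by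
    rw [PrefixOf, ← S.conj_delta_zpow (S.sup y) (S.Δ ^ S.sup y * (conj y β)⁻¹ * β⁻¹)]
    simp [conj, mul_assoc]
  rw [e1, e2, pre_delta_iff]
  simp only [op_delta, ← op_zpow, ← op_inv, ← op_mul, op_P, prefixOf_op_iff, HasSuffix]

/-- For `v` conjugating `z` into the super summit set, the transport condition is equivalent to `a ≼
v`. The least positive such `v` is then `a ∨ 1`, which is admissible because `a` and `1` both
conjugate `z` into the super summit set. This replaces any search for the minimum. -/
theorem isPullback_lcm {x z s : G} (hz : z ∈ S.SC x) (hx : S.slide z = x)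
    (hs : conj x s ∈ S.SSS x) :
    S.IsPullback x z s (S.leftLcm (S.prefPrefix z * s * (S.prefSuffix (conj x s))⁻¹) 1) := by
  have hzS := S.mem_SSS_of_mem_SC hz
  set w := conj x s with hw
  set a := S.prefPrefix z * s * (S.prefSuffix w)⁻¹ with ha
  have key : ∀ v, conj z v ∈ S.SSS x → (s ≼ S.transport z v ↔ a ≼ v) := by
    intro v hv
    -- This element conjugates `zᵛ` to `w = xˢ`, and `s ≼ 𝔭(z)⁻¹ v 𝔭(zᵛ)` says just that `β ≼
    -- 𝔭(zᵛ)`.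
    set β := v⁻¹ * S.prefPrefix z * s with hβ
    have h1 : conj (conj z v) β = w := by
      rw [hw, ← hx]; simp [conj, slide, hβ, mul_assoc]
    have h2 := S.pre_prefPrefix_iff (y := conj z v) (β := β)
      (by rw [h1]; exact S.inf_eq_of_mem_SSS hs hv) (by rw [h1]; exact S.sup_eq_of_mem_SSS hs hv)
    have h3 : s ≼ S.transport z v ↔ β ≼ S.prefPrefix (conj z v) := by
      simp [PrefixOf, transport, hβ, mul_assoc]
    have h4 : a ≼ v ↔ S.prefSuffix w * β⁻¹ ∈ S.P := by
      simp [PrefixOf, ha, hβ, mul_assoc]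
    rw [h3, h2, h1, h4]
  -- Conjugating by `a` leads from `z` via `x` and `w` to the right sliding of `w`, and right
  -- sliding neither lowers `inf` nor raises `sup`.
  have haS : conj z a ∈ S.SSS x := by
    have h1 : conj z a = S.rightSlide w := by
      rw [rightSlide, hw, ← hx]
      simp [conj, slide, ha, mul_assoc, hw, ← hx]
    have h2 : IsConj x (conj z a) := isConj_conj hz.1 a
    rw [h1] at h2 ⊢
    rw [S.mem_SSS_iff hs h2]
    have h3 := S.op.inf_le_inf_slide (MulOpposite.op w)
    have h4 := S.op.sup_slide_le_sup (MulOpposite.op w)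
    rw [slide_op, inf_op, inf_op] at h3
    rw [slide_op, sup_op, sup_op] at h4
    exact ⟨h3, h4⟩
  have h1S : conj z 1 ∈ S.SSS x := by simpa [conj] using hzS
  have hl := S.conj_lcm_mem_SSS hzS haS h1S
  refine ⟨⟨(S.one_pre_iff _).1 (S.pre_lcm_right _ _), hl, (key _ hl).2 (S.pre_lcm_left _ _)⟩, ?_⟩
  rintro v ⟨hv1, hv2, hv3⟩
  exact (S.lcm_pre_iff _ _ _).2 ⟨(key v hv2).1 hv3, (S.one_pre_iff v).2 hv1⟩

end Opposite

end GarsideStructure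

/-! ### Registers written by a program, and the mirror image of a program -/

/-- The instruction writes into registers with index less than `N` only. -/
def Instr.writesBelow (N : ℕ) : Instr → Bool
  | .setInt d _ => d < N
  | .add d _ _ => d < N
  | .sub d _ _ => d < N
  | .numAtoms d => d < N
  | .delta d => d < N
  | .copySimple d _ => d < N
  | .pushFront q _ _ => q < N
  | .pushBack q _ _ => q < N
  | .popFront q d f => q < N && d < N && f < N
  | .popBack q d f => q < N && d < N && f < N
  | .clear q => q < N
  | .copyWord d _ => d < N
  | .hash d _ => d < N
  | .divLeft d _ _ f => d < N && f < N
  | .divRight d _ _ f => d < N && f < N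

/-- The program writes into registers with index less than `N` only. -/
def Prog.writesBelow (N : ℕ) : Prog → Bool
  | .skip => true
  | .instr a => a.writesBelow N
  | .comp p q => p.writesBelow N && q.writesBelow N
  | .branch _ p q => p.writesBelow N && q.writesBelow N
  | .loop _ p => p.writesBelow N

/-- Exchange left and right. -/
def Instr.mirror : Instr → Instr
  | .pushFront q s b => .pushBack q s b
  | .pushBack q s b => .pushFront q s b
  | .popFront q d f => .popBack q d f
  | .popBack q d f => .popFront q d f
  | .divLeft d s i f => .divRight d s i f
  | .divRight d s i f => .divLeft d s i f
  | a => a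

/-- Exchange left and right. -/
def Prog.mirror : Prog → Prog
  | .skip => .skip
  | .instr a => .instr a.mirror
  | .comp p q => .comp p.mirror q.mirror
  | .branch c p q => .branch c p.mirror q.mirror
  | .loop c p => .loop c p.mirror

namespace GarsideStructure

variable {G : Type u} [Group G] {S : GarsideStructure G}

/-! ### States -/

namespace State

@[simp] theorem int_setInt (σ : S.State) (d : ℕ) (c : ℤ) (i : ℕ) :
    (σ.setInt d c).int i = if i = d then c else σ.int i := Function.update_apply ..

@[simp] theorem simp_setInt (σ : S.State) (d : ℕ) (c : ℤ) : (σ.setInt d c).simp = σ.simp := rfl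

@[simp] theorem word_setInt (σ : S.State) (d : ℕ) (c : ℤ) : (σ.setInt d c).word = σ.word := rfl

@[simp] theorem simp_setSimp (σ : S.State) (d : ℕ) (c : S.Simple) (i : ℕ) :
    (σ.setSimp d c).simp i = if i = d then c else σ.simp i := Function.update_apply ..

@[simp] theorem int_setSimp (σ : S.State) (d : ℕ) (c : S.Simple) :
    (σ.setSimp d c).int = σ.int := rfl

@[simp] theorem word_setSimp (σ : S.State) (d : ℕ) (c : S.Simple) :
    (σ.setSimp d c).word = σ.word := rfl

@[simp] theorem word_setWord (σ : S.State) (d : ℕ) (c : S.Word) (i : ℕ) :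
    (σ.setWord d c).word i = if i = d then c else σ.word i := Function.update_apply ..

@[simp] theorem int_setWord (σ : S.State) (d : ℕ) (c : S.Word) :
    (σ.setWord d c).int = σ.int := rfl

@[simp] theorem simp_setWord (σ : S.State) (d : ℕ) (c : S.Word) :
    (σ.setWord d c).simp = σ.simp := rfl

theorem ext' {σ τ : S.State} (h1 : σ.int = τ.int) (h2 : σ.simp = τ.simp) (h3 : σ.word = τ.word) :
    σ = τ := by
  cases σ; cases τ; simp_all

/-- `σ` and `σ'` agree on the registers with index at least `N`. -/
structure Agree (N : ℕ) (σ σ' : S.State) : Prop where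
  int : ∀ i, N ≤ i → σ'.int i = σ.int i
  simp : ∀ i, N ≤ i → σ'.simp i = σ.simp i
  word : ∀ i, N ≤ i → σ'.word i = σ.word i

theorem Agree.refl (N : ℕ) (σ : S.State) : Agree N σ σ :=
  ⟨fun _ _ => rfl, fun _ _ => rfl, fun _ _ => rfl⟩

theorem Agree.trans {N : ℕ} {σ σ' σ'' : S.State} (h : Agree N σ σ') (h' : Agree N σ' σ'') :
    Agree N σ σ'' :=
  ⟨fun i hi => (h'.int i hi).trans (h.int i hi), fun i hi => (h'.simp i hi).trans (h.simp i hi),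
    fun i hi => (h'.word i hi).trans (h.word i hi)⟩

theorem Agree.setInt {N d : ℕ} (σ : S.State) (c : ℤ) (h : d < N) : Agree N σ (σ.setInt d c) :=
  ⟨fun i hi => by simp [show i ≠ d by omega], fun _ _ => rfl, fun _ _ => rfl⟩

theorem Agree.setSimp {N d : ℕ} (σ : S.State) (c : S.Simple) (h : d < N) :
    Agree N σ (σ.setSimp d c) :=
  ⟨fun _ _ => rfl, fun i hi => by simp [show i ≠ d by omega], fun _ _ => rfl⟩

theorem Agree.setWord {N d : ℕ} (σ : S.State) (c : S.Word) (h : d < N) :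
    Agree N σ (σ.setWord d c) :=
  ⟨fun _ _ => rfl, fun _ _ => rfl, fun i hi => by simp [show i ≠ d by omega]⟩

end State

open State

theorem Step.agree {O : S.Oracle} {C : ℕ} {a : Instr} {σ σ' : S.State} {n N : ℕ}
    (h : Step O C a σ σ' n) (ha : a.writesBelow N = true) : Agree N σ σ' := by
  cases h <;>
    simp only [Instr.writesBelow, Bool.and_eq_true, decide_eq_true_eq] at ha
  case setInt => exact .setInt _ _ ha
  case add => exact .setInt _ _ ha
  case sub => exact .setInt _ _ ha
  case numAtoms => exact .setInt _ _ ha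
  case delta => exact .setSimp _ _ ha
  case copySimple => exact .setSimp _ _ ha
  case pushFront => exact .setWord _ _ ha
  case pushBack => exact .setWord _ _ ha
  case popFront =>
    exact ((Agree.setWord _ _ ha.1.1).trans (.setSimp _ _ ha.1.2)).trans (.setInt _ _ ha.2)
  case popBack =>
    exact ((Agree.setWord _ _ ha.1.1).trans (.setSimp _ _ ha.1.2)).trans (.setInt _ _ ha.2)
  case clear => exact .setWord _ _ ha
  case copyWord => exact .setWord _ _ ha
  case hash => exact .setInt _ _ ha
  case divLeft_true => exact (Agree.setSimp _ _ ha.1).trans (.setInt _ _ ha.2)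
  case divLeft_false => exact .setInt _ _ ha.2
  case divRight_true => exact (Agree.setSimp _ _ ha.1).trans (.setInt _ _ ha.2)
  case divRight_false => exact .setInt _ _ ha.2

/-- The frame rule. Since `writesBelow` is computed from the text of the program, the registers that
survive a subroutine call are found by evaluation. -/
theorem Exec.agree {O : S.Oracle} {C : ℕ} {p : Prog} {σ σ' : S.State} {n N : ℕ}
    (h : Exec O C p σ σ' n) (hp : p.writesBelow N = true) : Agree N σ σ' := by
  induction h with
  | skip => exact .refl _ _
  | instr h => exact h.agree hp
  | comp _ _ h1 h2 =>
    simp only [Prog.writesBelow, Bool.and_eq_true] at hp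
    exact (h1 hp.1).trans (h2 hp.2)
  | branch_true _ _ h =>
    simp only [Prog.writesBelow, Bool.and_eq_true] at hp
    exact h hp.1
  | branch_false _ _ h =>
    simp only [Prog.writesBelow, Bool.and_eq_true] at hp
    exact h hp.2
  | loop_true _ _ _ h1 h2 => exact (h1 hp).trans (h2 hp)
  | loop_false => exact .refl _ _

/-! ### Total correctness with a bound for the cost -/

/-- The program `p`, started in `σ`, terminates at cost less than `c` in a state that satisfies
`Q`. -/
def Runs (O : S.Oracle) (C : ℕ) (p : Prog) (σ : S.State) (c : ℕ) (Q : S.State → Prop) : Prop :=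
  ∃ (σ' : S.State) (n : ℕ), Exec O C p σ σ' n ∧ n < c ∧ Q σ'

namespace Runs

variable {O : S.Oracle} {C : ℕ} {p q r : Prog} {σ : S.State} {c m : ℕ} {Q R : S.State → Prop}

theorem mono (h : Runs O C p σ m R) (hm : m ≤ c) (hQ : ∀ σ', R σ' → Q σ') :
    Runs O C p σ c Q := by
  obtain ⟨σ', k, h1, h2, h3⟩ := h
  exact ⟨σ', k, h1, h2.trans_le hm, hQ σ' h3⟩

theorem skip (hc : 1 < c) (h : Q σ) : Runs O C .skip σ c Q := ⟨σ, 1, .skip σ, hc, h⟩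

theorem agree {N : ℕ} (h : Runs O C p σ m R) (hp : p.writesBelow N = true) :
    Runs O C p σ m fun σ' => R σ' ∧ Agree N σ σ' := by
  obtain ⟨σ', k, h1, h2, h3⟩ := h
  exact ⟨σ', k, h1, h2, h3, h1.agree hp⟩

/-- The strict inequality in `Runs` makes the truncated subtraction harmless: a cost below `c - m`
exists only if `m < c`. -/
theorem comp (h : Runs O C p σ m R) (h' : ∀ σ', R σ' → Runs O C q σ' (c - m) Q) :
    Runs O C (.comp p q) σ c Q := by
  obtain ⟨σ', k, h1, h2, h3⟩ := h
  obtain ⟨σ'', k', h1', h2', h3'⟩ := h' σ' h3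
  exact ⟨σ'', k + k', .comp h1 h1', by omega, h3'⟩

theorem step {a : Instr} {σ' : S.State} (h : Step O C a σ σ' m)
    (h' : Runs O C q σ' (c - m) Q) : Runs O C (.comp (.instr a) q) σ c Q := by
  obtain ⟨σ'', k, h1, h2, h3⟩ := h'
  exact ⟨σ'', m + k, .comp (.instr h) h1, by omega, h3⟩

theorem call {N : ℕ} (h : Runs O C p σ m R) (hp : p.writesBelow N = true)
    (h' : ∀ σ', R σ' → Agree N σ σ' → Runs O C q σ' (c - m) Q) :
    Runs O C (.comp p q) σ c Q :=
  (h.agree hp).comp fun σ' h1 => h' σ' h1.1 h1.2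

theorem skip_comp (h : Runs O C q σ (c - 1) Q) : Runs O C (.comp .skip q) σ c Q := by
  obtain ⟨σ', k, h1, h2, h3⟩ := h
  exact ⟨σ', 1 + k, .comp (.skip σ) h1, by omega, h3⟩

/-- Symbolic execution consumes the first instruction of a right-nested sequence; a sequence inside
a branch has to be re-bracketed first. Composition itself is free, so the cost does not change. -/
theorem assoc (h : Runs O C (.comp p (.comp q r)) σ c Q) :
    Runs O C (.comp (.comp p q) r) σ c Q := by
  obtain ⟨σ', k, h1, h2, h3⟩ := h
  cases h1 with
  | comp h4 h5 =>
    cases h5 with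
    | comp h5 h6 => exact ⟨σ', _, .comp (.comp h4 h5) h6, by omega, h3⟩

theorem branch {d : Condition} (h : Holds d σ → Runs O C (.comp p r) σ (c - 1) Q)
    (h' : ¬ Holds d σ → Runs O C (.comp q r) σ (c - 1) Q) :
    Runs O C (.comp (.branch d p q) r) σ c Q := by
  by_cases hd : Holds d σ
  · obtain ⟨σ', k, h1, h2, h3⟩ := h hd
    cases h1 with
    | comp h4 h5 => exact ⟨σ', _, .comp (.branch_true hd h4) h5, by omega, h3⟩
  · obtain ⟨σ', k, h1, h2, h3⟩ := h' hd
    cases h1 with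
    | comp h4 h5 => exact ⟨σ', _, .comp (.branch_false hd h4) h5, by omega, h3⟩

/-- Loops, with an invariant `I` that depends on a bound for the number of iterations. -/
theorem loop {d : Condition} (I : ℕ → S.State → Prop) (m k : ℕ)
    (h : ∀ k σ, I k σ → Holds d σ → Runs O C p σ m fun σ' => ∃ j < k, I j σ') (hI : I k σ) :
    Runs O C (.loop d p) σ (k * m + 2) fun σ' => (∃ j, I j σ') ∧ ¬ Holds d σ' := by
  induction k using Nat.strong_induction_on generalizing σ with
  | _ k ih =>
    by_cases hd : Holds d σ
    · obtain ⟨σ', i, h1, h2, j, hj, h3⟩ := h k σ hI hd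
      obtain ⟨σ'', i', h1', h2', h3'⟩ := ih j hj h3
      refine ⟨σ'', _, .loop_true hd h1 h1', ?_, h3'⟩
      -- An iteration costs less than `m`, so `m` also covers its test; the `2` pays for the last
      -- test and the strict inequality.
      have : (j + 1) * m ≤ k * m := Nat.mul_le_mul_right _ hj
      linarith [add_mul j 1 m]
    · exact ⟨σ, 1, .loop_false hd, by omega, ⟨k, hI⟩, hd⟩

end Runs

/-! ### The mirror image of an execution -/

section Mirror

open MulOpposite

def Simple.op (s : S.Simple) : S.op.Simple :=
  ⟨MulOpposite.op s.1, (S.isSimple_op_iff s.1).2 s.2⟩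

def Simple.unop (s : S.op.Simple) : S.Simple :=
  ⟨MulOpposite.unop s.1, (S.isSimple_op_iff s.1.unop).1 s.2⟩

/-- The order of the letters is reversed because products are; exponents stay as they are. -/
def Word.op (w : S.Word) : S.op.Word := (w.map fun l => (Simple.op l.1, l.2)).reverse

def Word.unop (w : S.op.Word) : S.Word := (w.map fun l => (Simple.unop l.1, l.2)).reverse

theorem Word.unop_op (w : S.Word) : Word.unop (Word.op w) = w := by
  have : (fun l : S.op.Simple × Bool => (Simple.unop l.1, l.2)) ∘
    (fun l : S.Simple × Bool => (Simple.op l.1, l.2)) = id := rfl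
  simp [Word.op, Word.unop, this]

theorem Word.op_unop (w : S.op.Word) : Word.op (Word.unop w) = w := by
  have : (fun l : S.Simple × Bool => (Simple.op l.1, l.2)) ∘
    (fun l : S.op.Simple × Bool => (Simple.unop l.1, l.2)) = id := rfl
  simp [Word.op, Word.unop, this]

theorem wordVal_op (w : S.Word) : S.op.wordVal (Word.op w) = MulOpposite.op (S.wordVal w) := by
  rw [wordVal, wordVal, ← prod_map_op_reverse, Word.op, List.map_reverse, List.map_map,
    List.map_map]
  congr 3
  funext l
  rcases l with ⟨s, b⟩
  cases b <;> rfl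

def State.op (σ : S.State) : S.op.State where
  int := σ.int
  simp i := Simple.op (σ.simp i)
  word i := Word.op (σ.word i)

def State.unop (σ : S.op.State) : S.State where
  int := σ.int
  simp i := Simple.unop (σ.simp i)
  word i := Word.unop (σ.word i)

theorem State.unop_op (σ : S.State) : σ.op.unop = σ :=
  State.ext' rfl rfl (funext fun _ => Word.unop_op _)

theorem State.op_unop (σ : S.op.State) : σ.unop.op = σ :=
  State.ext' rfl rfl (funext fun _ => Word.op_unop _)

@[simp] theorem State.op_int (σ : S.State) : σ.op.int = σ.int := rfl

@[simp] theorem State.op_simp (σ : S.State) (i : ℕ) :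
    (σ.op.simp i).1 = MulOpposite.op (σ.simp i).1 := rfl

@[simp] theorem State.op_word (σ : S.State) (i : ℕ) : σ.op.word i = Word.op (σ.word i) := rfl

theorem State.unop_setInt (σ : S.op.State) (d : ℕ) (c : ℤ) :
    (σ.setInt d c).unop = σ.unop.setInt d c := rfl

theorem State.unop_setSimp (σ : S.op.State) (d : ℕ) (c : S.op.Simple) :
    (σ.setSimp d c).unop = σ.unop.setSimp d (Simple.unop c) := by
  refine State.ext' rfl (funext fun i => ?_) rfl
  change Simple.unop ((σ.setSimp d c).simp i) = (σ.unop.setSimp d (Simple.unop c)).simp i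
  rw [simp_setSimp, simp_setSimp]
  split_ifs <;> rfl

theorem State.unop_setWord (σ : S.op.State) (d : ℕ) (c : S.op.Word) :
    (σ.setWord d c).unop = σ.unop.setWord d (Word.unop c) := by
  refine State.ext' rfl rfl (funext fun i => ?_)
  change Word.unop ((σ.setWord d c).word i) = (σ.unop.setWord d (Word.unop c)).word i
  rw [word_setWord, word_setWord]
  split_ifs <;> rfl

def Oracle.op (O : S.Oracle) : S.op.Oracle where
  numAtoms := O.numAtoms
  atom j := MulOpposite.op (O.atom j)
  atom_injective := MulOpposite.op_injective.comp O.atom_injective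
  range_atom := by
    ext a
    have h := Set.ext_iff.1 O.range_atom a.unop
    simp only [Set.mem_range, Set.mem_ofPred_eq] at h ⊢
    rw [← isAtom_op_iff, MulOpposite.op_unop] at h
    rw [← h]
    exact exists_congr fun _ => ⟨fun h => by rw [← h]; rfl, fun h => by rw [h, MulOpposite.op_unop]⟩
  hash s := O.hash (Simple.unop s)

@[simp] theorem Oracle.op_numAtoms (O : S.Oracle) : O.op.numAtoms = O.numAtoms := rfl

theorem Holds.unop_iff {c : Condition} {σ : S.op.State} : Holds c σ.unop ↔ Holds c σ := by
  cases c with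
  | le i j => exact Iff.rfl
  | isEmpty q => simp [Holds, State.unop, Word.unop]

/-- The two ends of a word and the two oracle divisions change places, everything else is symmetric,
and costs agree instruction by instruction. -/
theorem Step.unop {O : S.Oracle} {C : ℕ} {a : Instr} {σ σ' : S.op.State} {n : ℕ}
    (h : Step O.op C a σ σ' n) : Step O C a.mirror σ.unop σ'.unop n := by
  cases h <;> simp only [State.unop_setInt, State.unop_setSimp, State.unop_setWord, Instr.mirror]
  case setInt => exact .setInt ..
  case add => exact .add ..
  case sub => exact .sub ..
  case numAtoms => exact .numAtoms ..
  case delta s hs => exact .delta _ _ _ (MulOpposite.op_injective hs)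
  case copySimple => exact .copySimple ..
  case pushFront q s b =>
    have : Word.unop ((σ.simp s, b) :: σ.word q) =
      σ.unop.word q ++ [(σ.unop.simp s, b)] := by simp [Word.unop, State.unop]
    rw [this]
    exact .pushBack ..
  case pushBack q s b =>
    have : Word.unop (σ.word q ++ [(σ.simp s, b)]) =
      (σ.unop.simp s, b) :: σ.unop.word q := by simp [Word.unop, State.unop]
    rw [this]
    exact .pushFront ..
  case popFront q d f s b w h =>
    exact .popBack _ _ _ _ _ _ _ (by simp [State.unop, h, Word.unop])
  case popBack q d f s b w h =>
    exact .popFront _ _ _ _ _ _ _ (by simp [State.unop, h, Word.unop])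
  case clear => exact .clear ..
  case copyWord d q =>
    have : (σ.word q).length = (σ.unop.word q).length := by simp [State.unop, Word.unop]
    rw [this]
    exact .copyWord ..
  case hash => exact .hash ..
  case divLeft_true d s i f j t hj h ht =>
    exact .divRight_true σ.unop _ _ _ _ j hj h _ (congrArg MulOpposite.unop ht)
  case divLeft_false d s i f j hj h => exact .divRight_false σ.unop _ _ _ _ j hj h
  case divRight_true d s i f j t hj h ht =>
    exact .divLeft_true σ.unop _ _ _ _ j hj h _ (congrArg MulOpposite.unop ht)
  case divRight_false d s i f j hj h => exact .divLeft_false σ.unop _ _ _ _ j hj h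

theorem Exec.unop {O : S.Oracle} {C : ℕ} {p : Prog} {σ σ' : S.op.State} {n : ℕ}
    (h : Exec O.op C p σ σ' n) : Exec O C p.mirror σ.unop σ'.unop n := by
  induction h with
  | skip => exact .skip _
  | instr h => exact .instr h.unop
  | comp _ _ h1 h2 => exact .comp h1 h2
  | branch_true hc _ h => exact .branch_true (Holds.unop_iff.2 hc) h
  | branch_false hc _ h => exact .branch_false (fun h' => hc (Holds.unop_iff.1 h')) h
  | loop_true hc _ _ h1 h2 => exact .loop_true (Holds.unop_iff.2 hc) h1 h2
  | loop_false hc => exact .loop_false (fun h' => hc (Holds.unop_iff.1 h'))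

theorem Runs.mirror {O : S.Oracle} {C : ℕ} {p : Prog} {σ : S.State} {c : ℕ}
    {Q : S.op.State → Prop} (h : Runs O.op C p σ.op c Q) :
    Runs O C p.mirror σ c fun σ' => Q σ'.op := by
  obtain ⟨σ', n, h1, h2, h3⟩ := h
  refine ⟨σ'.unop, n, ?_, h2, by simpa only [State.op_unop] using h3⟩
  have := h1.unop
  rwa [State.unop_op] at this

/-- The mirror image of a task. -/
theorem PerformedIn.mirror {bound : ℕ → ℕ → ℕ → ℕ → ℕ}
    {input input' : ∀ (G : Type u) [Group G] (S : GarsideStructure G),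
      S.Oracle → ℕ → S.State → G → G → G → Prop}
    {output output' : ∀ (G : Type u) [Group G] (S : GarsideStructure G),
      S.State → G → G → G → Prop}
    (h : PerformedIn.{u} bound input output)
    (hi : ∀ (G : Type u) [Group G] [Nontrivial G] (S : GarsideStructure G) (O : S.Oracle) (k : ℕ)
      (σ : S.State) (x y z : G), input' G S O k σ x y z →
        input Gᵐᵒᵖ S.op O.op k σ.op (MulOpposite.op x) (MulOpposite.op y) (MulOpposite.op z))
    (ho : ∀ (G : Type u) [Group G] [Nontrivial G] (S : GarsideStructure G) (σ : S.State)
      (x y z : G), output Gᵐᵒᵖ S.op σ.op (MulOpposite.op x) (MulOpposite.op y)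
        (MulOpposite.op z) → output' G S σ x y z) :
    PerformedIn.{u} bound input' output' := by
  obtain ⟨p, K, hp⟩ := h
  refine ⟨p.mirror, K, fun G _ _ S hS O C k hC hk x y z σ hin => ?_⟩
  obtain ⟨σ', n, h1, h2, h3⟩ := hp Gᵐᵒᵖ S.op (S.finiteType_op hS) O.op C k hC hk _ _ _ _
    (hi G S O k σ x y z hin)
  have h4 := h1.unop
  rw [State.unop_op] at h4
  refine ⟨σ'.unop, n, h4, ?_, ho G S _ x y z (by rwa [State.op_unop])⟩
  -- The parameters `λ` and `‖Δ‖` of the opposite structure are the same, so the bound carries over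
  -- literally.
  rwa [Oracle.op_numAtoms, op_delta, norm_op] at h2

theorem State.hasLNF_op_iff (σ : S.State) (i : ℕ) (x : G) :
    σ.op.HasLNF i (MulOpposite.op x) ↔ σ.HasRNF i x := by
  rw [HasLNF, HasRNF, ← isLeftNormalForm_op_iff, State.op_word]
  refine and_congr ?_ ?_
  · simp [Word.op]
  · rw [Word.op, List.map_reverse, List.map_map, List.map_map]; exact Iff.rfl

theorem State.hasRNF_op_iff (σ : S.State) (i : ℕ) (x : G) :
    σ.op.HasRNF i (MulOpposite.op x) ↔ σ.HasLNF i x := by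
  rw [HasLNF, HasRNF, ← isRightNormalForm_op_iff, State.op_word]
  refine and_congr ?_ ?_
  · simp [Word.op]
  · rw [Word.op, List.map_reverse, List.map_map, List.map_map]; exact Iff.rfl

theorem State.hasElt_op_iff (σ : S.State) (i : ℕ) (x : G) :
    σ.op.HasElt i (MulOpposite.op x) ↔ σ.HasElt i x := by
  rw [HasElt, HasElt, State.op_word, wordVal_op, op_inj]

theorem State.hasEltLE_op_iff (σ : S.State) (i k : ℕ) (x : G) :
    σ.op.HasEltLE i k (MulOpposite.op x) ↔ σ.HasEltLE i k x := by
  rw [HasEltLE, HasEltLE, State.op_word, wordVal_op, op_inj]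
  simp [Word.op]

theorem State.hasSimple_op_iff (σ : S.State) (i : ℕ) (x : G) :
    σ.op.HasSimple i (MulOpposite.op x) ↔ σ.HasSimple i x := by
  rw [HasSimple, HasSimple, State.op_simp, op_inj]

theorem State.hasAtom_op_iff (σ : S.State) (O : S.Oracle) (i : ℕ) (x : G) :
    σ.op.HasAtom O.op i (MulOpposite.op x) ↔ σ.HasAtom O i x :=
  exists_congr fun _ => and_congr Iff.rfl op_inj

theorem State.answers_op_iff (σ : S.State) (A : Prop) : σ.op.Answers A ↔ σ.Answers A := Iff.rfl

theorem hasLengthAtMost_op {k : ℕ} {x : G} (h : S.HasLengthAtMost k x) :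
    S.op.HasLengthAtMost k (MulOpposite.op x) := by
  obtain ⟨w, h1, rfl⟩ := h
  exact ⟨Word.op w, by simpa [Word.op] using h1, wordVal_op w⟩

end Mirror

end GarsideStructure

-- Scanning the atoms: triviality and common prefixes of simple elements

local infixr:60 "⨟" => Prog.comp

/-- Test whether the simple element in register `0` is trivial. -/
def Prog.isOne : Prog :=
  .instr (.setInt 0 1) ⨟ .instr (.setInt 1 0) ⨟ .instr (.setInt 3 1) ⨟ .instr (.numAtoms 2) ⨟
  .instr (.sub 2 2 3) ⨟
  .loop (.le 1 2)
    (.instr (.divLeft 1 0 1 4) ⨟ .branch (.le 3 4) (.instr (.setInt 0 0)) .skip ⨟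
      .instr (.add 1 1 3) ⨟ .skip) ⨟
  .skip

/-- Divide the simple elements in the registers `0` and `1` by their left gcd. -/
def Prog.cancelLeft : Prog :=
  .instr (.setInt 0 0) ⨟ .instr (.numAtoms 1) ⨟ .instr (.setInt 3 1) ⨟ .instr (.sub 1 1 3) ⨟
  .loop (.le 0 1)
    (.instr (.divLeft 2 0 0 2) ⨟
      .branch (.le 3 2)
        (.instr (.divLeft 3 1 0 2) ⨟
          .branch (.le 3 2)
            (.instr (.copySimple 0 2) ⨟ .instr (.copySimple 1 3) ⨟ .instr (.setInt 0 0) ⨟ .skip)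
            (.instr (.add 0 0 3) ⨟ .skip) ⨟ .skip)
        (.instr (.add 0 0 3) ⨟ .skip) ⨟ .skip) ⨟
  .skip

namespace GarsideStructure

variable {G : Type u} [Group G] {S : GarsideStructure G}

theorem isAtom_atom (O : S.Oracle) (j : Fin O.numAtoms) : S.IsAtom (O.atom j) := by
  have := Set.ext_iff.1 O.range_atom (O.atom j)
  exact this.1 ⟨j, rfl⟩

theorem exists_atom_eq (O : S.Oracle) {a : G} (h : S.IsAtom a) : ∃ j, O.atom j = a :=
  (Set.ext_iff.1 O.range_atom a).2 h

theorem numAtoms_pos [Nontrivial G] (O : S.Oracle) : 0 < O.numAtoms := by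
  obtain ⟨a, ha, -⟩ := S.exists_atom_pre S.delta_mem S.delta_ne_one
  obtain ⟨j, -⟩ := exists_atom_eq O ha
  exact j.pos

theorem eq_one_iff_forall_atom (O : S.Oracle) {s : G} (hs : s ∈ S.P) :
    s = 1 ↔ ∀ j, ¬ PrefixOf S.P (O.atom j) s := by
  constructor
  · rintro rfl j hj
    exact (isAtom_atom O j).2.1 (S.eq_one_of_pre_one (isAtom_atom O j).1 hj)
  · intro h
    by_contra h1
    obtain ⟨a, ha, h2⟩ := S.exists_atom_pre hs h1
    obtain ⟨j, rfl⟩ := exists_atom_eq O ha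
    exact h j h2

/-- The cost of the basic operations on simple elements, up to a constant. -/
noncomputable def opCost (O : S.Oracle) (C : ℕ) : ℕ := C * O.numAtoms * S.norm S.Δ

theorem mul_numAtoms_le_opCost [Nontrivial G] (O : S.Oracle) (C : ℕ) :
    C * O.numAtoms ≤ opCost O C :=
  Nat.le_mul_of_pos_right _ (S.norm_pos S.delta_mem S.delta_ne_one)

theorem opCost_pos [Nontrivial G] (O : S.Oracle) {C : ℕ} (hC : 1 ≤ C) : 1 ≤ opCost O C :=
  le_trans (Nat.mul_pos hC (numAtoms_pos O)) (mul_numAtoms_le_opCost O C)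

theorem opCost_op (O : S.Oracle) (C : ℕ) : opCost O.op C = opCost O C := by
  rw [opCost, opCost, op_delta, norm_op, Oracle.op_numAtoms]

variable [Nontrivial G] {O : S.Oracle} {C : ℕ}

open State

omit [Nontrivial G] in
theorem Runs.divLeft {q : Prog} {σ : S.State} {c d s i f : ℕ} {Q : S.State → Prop}
    (j : Fin O.numAtoms) (hj : σ.int i = (j : ℕ))
    (h : PrefixOf S.P (O.atom j) (σ.simp s).1 → ∀ t : S.Simple,
      t.1 = (O.atom j)⁻¹ * (σ.simp s).1 → Runs O C q ((σ.setSimp d t).setInt f 1) (c - C) Q)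
    (h' : ¬ PrefixOf S.P (O.atom j) (σ.simp s).1 → Runs O C q (σ.setInt f 0) (c - C) Q) :
    Runs O C (.comp (.instr (.divLeft d s i f)) q) σ c Q := by
  by_cases hd : PrefixOf S.P (O.atom j) (σ.simp s).1
  · exact .step (.divLeft_true _ _ _ _ _ j hj hd
      ⟨_, (σ.simp s).2.inv_mul (isAtom_atom O j).1 hd⟩ rfl) (h hd _ rfl)
  · exact .step (.divLeft_false _ _ _ _ _ j hj hd) (h' hd)

/-- A positive element is trivial exactly if no atom divides it, and each atom is tried once. The
quotient returned by the oracle goes to another register, so all atoms are tested against the same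
element. -/
theorem runs_isOne (hC : 1 ≤ C) (σ : S.State) :
    Runs O C .isOne σ (20 * (C * O.numAtoms)) fun σ' => σ'.Answers ((σ.simp 0).1 = 1) := by
  set s := (σ.simp 0).1 with hs
  have hl := numAtoms_pos O
  have hU : O.numAtoms ≤ C * O.numAtoms := Nat.le_mul_of_pos_left _ hC
  have hlt : O.numAtoms * (C + 5) + 2 = C * O.numAtoms + 5 * O.numAtoms + 2 := by ring
  let I : ℕ → S.State → Prop := fun k τ => ∃ i : ℕ, τ.int 1 = i ∧ i + k = O.numAtoms ∧
    τ.int 2 = O.numAtoms - 1 ∧ τ.int 3 = 1 ∧ (τ.simp 0).1 = s ∧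
    τ.Answers (∀ j : Fin O.numAtoms, j.1 < i → ¬ PrefixOf S.P (O.atom j) s)
  refine .step (.setInt ..) <| .step (.setInt ..) <| .step (.setInt ..) <|
      .step (.numAtoms ..) <| .step (.sub ..) <|
      .comp (.loop I (C + 5) O.numAtoms ?_ ?_) fun τ h => .skip (by omega) ?_
  · rintro k τ ⟨i, h1, h2, h3, h4, h5, h6⟩ hc
    have hi : i < O.numAtoms := by
      simp only [Holds, h1, h3] at hc
      omega
    have hj : ∀ j : Fin O.numAtoms, j.1 < i + 1 ↔ j = ⟨i, hi⟩ ∨ j.1 < i := fun j => by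
      rw [Fin.ext_iff]; simp only; omega
    refine .divLeft ⟨i, hi⟩ (by simp [h1]) (fun hd t ht => ?_) (fun hd => ?_) <;>
      rw [h5] at hd
    · refine .branch (fun _ => .step (.setInt ..) <| .step (.add ..) <| .skip (by omega)
          ⟨k - 1, by omega, i + 1, ?_⟩) (fun h => absurd h (by simp [Holds, h4]))
      refine ⟨by simp [h1, h4], by omega, by simp [h3], by simp [h4], by simpa using h5, ?_⟩
      simp [Answers, hj, hd]
    · refine .branch (fun h => absurd h (by simp [Holds, h4])) (fun _ => .skip_comp <|
          .step (.add ..) <| .skip (by omega) ⟨k - 1, by omega, i + 1, ?_⟩)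
      refine ⟨by simp [h1, h4], by omega, by simp [h3], by simp [h4], by simpa using h5, ?_⟩
      simpa [Answers, hj, hd] using h6
  · exact ⟨0, by simp [Answers, hs]⟩
  · obtain ⟨⟨k, i, h1, h2, h3, h4, h5, h6⟩, h7⟩ := h
    have h8 : O.numAtoms ≤ i := by
      simp only [Holds, h1, h3, not_le] at h7
      omega
    rw [eq_one_iff_forall_atom O (σ.simp 0).2.mem]
    simpa [fun j : Fin O.numAtoms => j.2.trans_le h8] using h6

omit [Nontrivial G] in
theorem norm_lt_of_atom {a s : G} (ha : S.IsAtom a) (h : PrefixOf S.P a s) :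
    S.norm (a⁻¹ * s) < S.norm s := by
  have h1 := S.norm_add_le ha.1 h
  have h2 := S.norm_pos ha.1 ha.2.1
  rw [mul_inv_cancel_left] at h1
  omega

/-- The product `g` of the atoms removed so far is a common prefix. When a full scan finds no
further common atom, the quotients are coprime and `g` is the gcd. Termination and cost come from
the measure `‖g⁻¹s‖ λ + (λ - i)`, where `i` is the atom to be tried next. -/
theorem runs_cancelLeft (hC : 1 ≤ C) (σ : S.State) :
    Runs O C .cancelLeft σ (30 * opCost O C) fun σ' =>
      (σ'.simp 0).1 = (S.leftGcd (σ.simp 0).1 (σ.simp 1).1)⁻¹ * (σ.simp 0).1 ∧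
      (σ'.simp 1).1 = (S.leftGcd (σ.simp 0).1 (σ.simp 1).1)⁻¹ * (σ.simp 1).1 := by
  set s := (σ.simp 0).1 with hs
  set t := (σ.simp 1).1 with ht
  set l := O.numAtoms with hl'
  have hl : 0 < l := numAtoms_pos O
  have hD : 1 ≤ S.norm S.Δ := S.norm_pos S.delta_mem S.delta_ne_one
  let I : ℕ → S.State → Prop := fun k τ => ∃ (i : ℕ) (g : G), τ.int 0 = i ∧
    k = S.norm (τ.simp 0).1 * l + (l - i) ∧ i ≤ l ∧
    τ.int 1 = l - 1 ∧ τ.int 3 = 1 ∧ (τ.simp 0).1 = g⁻¹ * s ∧ (τ.simp 1).1 = g⁻¹ * t ∧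
    ∀ j : Fin O.numAtoms, j.1 < i →
      ¬ (PrefixOf S.P (O.atom j) (τ.simp 0).1 ∧ PrefixOf S.P (O.atom j) (τ.simp 1).1)
  refine .step (.setInt ..) <| .step (.numAtoms ..) <| .step (.setInt ..) <| .step (.sub ..) <|
      .comp (.loop I (2 * C + 9) (S.norm s * l + l) ?_ ?_) fun τ h => .skip ?_ ?_
  · rintro k τ ⟨i, g, h1, h2, h3, h4, h5, h6, h7, h8⟩ hc
    have hi : i < l := by
      simp only [Holds, h1, h4] at hc
      omega
    have hj : ∀ j : Fin O.numAtoms, j.1 < i + 1 ↔ j = ⟨i, hi⟩ ∨ j.1 < i := fun j => by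
      rw [Fin.ext_iff]; simp only; omega
    set a := O.atom ⟨i, hi⟩ with ha
    have haA : S.IsAtom a := isAtom_atom O _
    have next : ¬ (PrefixOf S.P a (τ.simp 0).1 ∧ PrefixOf S.P a (τ.simp 1).1) →
        ∀ j : Fin O.numAtoms, j.1 < i + 1 →
      ¬ (PrefixOf S.P (O.atom j) (τ.simp 0).1 ∧ PrefixOf S.P (O.atom j) (τ.simp 1).1) := by
      intro h j hj'
      rcases (hj j).1 hj' with rfl | hj'
      exacts [h, h8 j hj']
    refine .divLeft ⟨i, hi⟩ (by simp [h1]) (fun hd t ht => ?_) (fun hd => ?_)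
    · refine .branch (fun _ => .assoc ?_) (fun h => absurd h (by simp [Holds, h5]))
      refine .divLeft ⟨i, hi⟩ (by simp [h1]) (fun hd' t' ht' => .assoc ?_)
        (fun hd' => .assoc ?_)
      · refine .branch (fun _ => .assoc <|
            .step (.copySimple ..) <| .assoc <| .step (.copySimple ..) <| .assoc <|
            .step (.setInt ..) <| .skip_comp <| .skip_comp <| .skip (by omega) ?_)
            (fun h => absurd h (by simp [Holds, h5]))
        -- After a success the scan restarts, since an atom that failed before may divide both
        -- quotients; the loss of at least one in the norm pays for the `λ` atoms to be tried again.
        have h9 := norm_lt_of_atom haA hd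
        have h10 : (S.norm (a⁻¹ * (τ.simp 0).1) + 1) * l ≤ S.norm (τ.simp 0).1 * l :=
          Nat.mul_le_mul_right _ h9
        rw [add_mul, one_mul] at h10
        refine ⟨S.norm (a⁻¹ * (τ.simp 0).1) * l + l, by omega, 0, g * a, ?_⟩
        simp at ht'
        simp [h4, h5, ht, ht', h6, h7, mul_assoc, ← ha]
      · refine .branch (fun h => absurd h (by simp [Holds, h5])) (fun _ => .assoc <|
            .step (.add ..) <| .skip_comp <| .skip_comp <| .skip (by omega)
            ⟨k - 1, by omega, i + 1, g, ?_⟩)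
        refine ⟨by simp [h1, h5], by simp; omega, by omega, by simp [h4], by simp [h5],
          by simpa using h6, by simpa using h7, ?_⟩
        simpa using next fun h => hd' (by simpa using h.2)
    · refine .branch (fun h => absurd h (by simp [Holds, h5])) (fun _ => .assoc <|
            .step (.add ..) <| .skip_comp <| .skip (by omega)
            ⟨k - 1, by omega, i + 1, g, ?_⟩)
      refine ⟨by simp [h1, h5], by simp; omega, by omega, by simp [h4], by simp [h5],
          by simpa using h6, by simpa using h7, ?_⟩
      simpa using next fun h => hd h.1
  · exact ⟨0, 1, by simp [hs, ht, hl']⟩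
  · have h1 : S.norm s * l ≤ S.norm S.Δ * l :=
      Nat.mul_le_mul_right _ (S.norm_le_norm_delta (σ.simp 0).2)
    -- There are at most `2λ‖Δ‖` iterations, each with at most two oracle calls and constant
    -- bookkeeping, where `C ≥ 1` absorbs the constant.
    have h2 : (S.norm s * l + l) * (2 * C + 9) ≤ (2 * (S.norm S.Δ * l)) * (11 * C) := by
      refine Nat.mul_le_mul ?_ (by omega)
      have : 1 * l ≤ S.norm S.Δ * l := Nat.mul_le_mul_right _ hD
      omega
    have h3 : (2 * (S.norm S.Δ * l)) * (11 * C) = 22 * opCost O C := by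
      rw [opCost]; ring
    have := opCost_pos O hC
    omega
  · obtain ⟨⟨k, i, g, h1, h2, h3, h4, h5, h6, h7, h8⟩, h9⟩ := h
    have h10 : l ≤ i := by
      simp only [Holds, h1, h4, not_le] at h9
      omega
    have h11 : S.leftGcd (τ.simp 0).1 (τ.simp 1).1 = 1 := by
      rw [eq_one_iff_forall_atom O (S.gcd_mem (τ.simp 0).2.mem (τ.simp 1).2.mem)]
      intro j
      rw [pre_gcd_iff]
      exact h8 j (j.2.trans_le h10)
    rw [h6, h7, ← mul_gcd, inv_mul_eq_one] at h11
    rw [← h11, h6, h7]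
    exact ⟨rfl, rfl⟩

end GarsideStructure

/-! ### Programs for simple elements -/

namespace Prog

/-- Divide the simple elements in the registers `0` and `1` by their right gcd. -/
def cancelRight : Prog := cancelLeft.mirror

/-- As `s ∧ Δ = s`, cancelling the gcd of `s` and `Δ` leaves `1` and `s⁻¹Δ`. -/
def rightCompl : Prog := .instr (.delta 1) ⨟ cancelLeft ⨟ .instr (.copySimple 0 1) ⨟ .skip

def leftCompl : Prog := rightCompl.mirror

def tau : Prog := rightCompl ⨟ rightCompl ⨟ .skip

def tauInv : Prog := tau.mirror

/-- Two elements are equal exactly if both quotients by their gcd are trivial. -/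
def equal : Prog :=
  cancelLeft ⨟ .instr (.copySimple 6 1) ⨟ isOne ⨟ .instr (.setInt 6 1) ⨟
  .branch (.le 6 0) (.instr (.copySimple 0 6) ⨟ isOne) .skip ⨟ .skip

/-- `as` is simple exactly if `∂⁻¹(s)` ends in `a`, and then `∂(∂⁻¹(s) a⁻¹) = as`. The atom index
and the flag are kept in registers that the complement programs do not touch. -/
def mulAtom : Prog :=
  .instr (.setInt 8 0) ⨟ .instr (.add 9 0 8) ⨟ leftCompl ⨟ .instr (.divRight 0 0 9 7) ⨟
  rightCompl ⨟ .instr (.add 0 7 8) ⨟ .skip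

/-- The left cancellation yields `u = (s ∧ t)⁻¹s`, a suffix of `s`; the right cancellation of `u`
against `s` then leaves `su⁻¹ = s ∧ t`. -/
def leftGcd : Prog :=
  .instr (.copySimple 5 0) ⨟ cancelLeft ⨟ .instr (.copySimple 1 5) ⨟ cancelRight ⨟
  .instr (.copySimple 0 1) ⨟ .skip

def rightGcd : Prog := leftGcd.mirror

def leftLcm : Prog :=
  .instr (.copySimple 6 0) ⨟ .instr (.copySimple 0 1) ⨟ rightCompl ⨟ .instr (.copySimple 7 0) ⨟
  .instr (.copySimple 0 6) ⨟ rightCompl ⨟ .instr (.copySimple 1 7) ⨟ rightGcd ⨟ leftCompl ⨟ .skip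

/-- Local left sliding. -/
def localSlide : Prog :=
  .instr (.copySimple 5 1) ⨟ rightCompl ⨟ .instr (.copySimple 1 5) ⨟ cancelLeft ⨟
  .instr (.copySimple 5 1) ⨟ leftCompl ⨟ .instr (.copySimple 1 5) ⨟ .skip

theorem writesBelow_isOne : isOne.writesBelow 5 = true := rfl
theorem writesBelow_cancelLeft : cancelLeft.writesBelow 4 = true := rfl
theorem writesBelow_rightCompl : rightCompl.writesBelow 4 = true := rfl
theorem writesBelow_leftCompl : leftCompl.writesBelow 4 = true := rfl
theorem writesBelow_tau : tau.writesBelow 4 = true := rfl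
theorem writesBelow_tauInv : tauInv.writesBelow 4 = true := rfl
theorem writesBelow_equal : equal.writesBelow 7 = true := rfl
theorem writesBelow_leftGcd : leftGcd.writesBelow 6 = true := rfl
theorem writesBelow_localSlide : localSlide.writesBelow 6 = true := rfl

end Prog

/-! ### Correctness and cost of the programs for simple elements -/

namespace GarsideStructure

variable {G : Type u} [Group G] {S : GarsideStructure G}

theorem rightGcd_eq_left {a b : G} (h : HasSuffix S.P b a) : S.rightGcd a b = a := by
  refine S.rightGcd_eq_of_isRightGcd ⟨?_, h, fun c hc _ => hc⟩
  simp [HasSuffix]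

/-- The map `∂` turns the prefix order into the reversed suffix order, so it exchanges left lcms
with right gcds. -/
theorem leftLcm_eq_leftCompl (s t : G) :
    S.leftLcm s t = S.leftCompl (S.rightGcd (S.rightCompl s) (S.rightCompl t)) := by
  have key : ∀ a b : G, HasSuffix S.P (S.rightCompl a) (S.rightCompl b) ↔ PrefixOf S.P a b := by
    intro a b
    simp [HasSuffix, PrefixOf, rightCompl, mul_assoc]
  have h : S.rightGcd (S.rightCompl s) (S.rightCompl t) = S.rightCompl (S.leftLcm s t) := by
    refine S.rightGcd_eq_of_isRightGcd ⟨(key _ _).2 (S.pre_lcm_left s t),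
      (key _ _).2 (S.pre_lcm_right s t), fun c hc hd => ?_⟩
    rw [← S.rightCompl_leftCompl c, key] at hc hd ⊢
    exact (S.lcm_pre_iff _ _ _).2 ⟨hc, hd⟩
  rw [h, leftCompl_rightCompl]

theorem isSimple_mul_iff {a s : G} (ha : a ∈ S.P) (hs : s ∈ S.P) :
    S.IsSimple (a * s) ↔ HasSuffix S.P (S.leftCompl s) a := by
  rw [isSimple_iff, pre_delta_iff, and_iff_right (S.P.mul_mem ha hs), HasSuffix, leftCompl,
    mul_inv_rev, mul_assoc]

variable (S) in
/-- `Δ` as a simple element. -/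
def deltaSimple : S.Simple := ⟨S.Δ, S.isSimple_delta⟩

@[simp] theorem deltaSimple_val : (S.deltaSimple).1 = S.Δ := rfl

variable [Nontrivial G] {O : S.Oracle} {C : ℕ}

open State

theorem runs_isOne' (hC : 1 ≤ C) (σ : S.State) :
    Runs O C .isOne σ (20 * opCost O C) fun σ' => σ'.Answers ((σ.simp 0).1 = 1) :=
  (runs_isOne hC σ).mono (Nat.mul_le_mul_left 20 (mul_numAtoms_le_opCost O C)) fun _ => id

theorem runs_cancelRight (hC : 1 ≤ C) (σ : S.State) :
    Runs O C .cancelRight σ (30 * opCost O C) fun σ' =>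
      (σ'.simp 0).1 = (σ.simp 0).1 * (S.rightGcd (σ.simp 0).1 (σ.simp 1).1)⁻¹ ∧
      (σ'.simp 1).1 = (σ.simp 1).1 * (S.rightGcd (σ.simp 0).1 (σ.simp 1).1)⁻¹ := by
  have h := (runs_cancelLeft (O := O.op) hC σ.op).mirror
  rw [opCost_op] at h
  refine h.mono le_rfl fun σ' h => ?_
  simpa [leftGcd_op, ← MulOpposite.op_mul, ← MulOpposite.op_inv] using h

theorem runs_rightCompl (hC : 1 ≤ C) (σ : S.State) :
    Runs O C .rightCompl σ (40 * opCost O C) fun σ' =>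
      (σ'.simp 0).1 = S.rightCompl (σ.simp 0).1 := by
  have hU := opCost_pos O hC
  refine .step (.delta _ _ S.deltaSimple rfl) <| .call (runs_cancelLeft hC _)
    Prog.writesBelow_cancelLeft fun σ₁ h₁ f₁ => .step (.copySimple ..) <| .skip (by omega) ?_
  have h := h₁.2
  simp [S.gcd_eq_left (σ.simp 0).2.2] at h
  simpa [GarsideStructure.rightCompl] using h

theorem runs_leftCompl (hC : 1 ≤ C) (σ : S.State) :
    Runs O C .leftCompl σ (40 * opCost O C) fun σ' =>
      (σ'.simp 0).1 = S.leftCompl (σ.simp 0).1 := by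
  have h := (runs_rightCompl (O := O.op) hC σ.op).mirror
  rw [opCost_op] at h
  refine h.mono le_rfl fun σ' h => ?_
  simpa [rightCompl_op] using h

theorem runs_tau (hC : 1 ≤ C) (σ : S.State) :
    Runs O C .tau σ (90 * opCost O C) fun σ' => (σ'.simp 0).1 = S.tau (σ.simp 0).1 := by
  have hU := opCost_pos O hC
  refine .comp (runs_rightCompl hC _) fun σ₁ h₁ => .comp (runs_rightCompl hC _) fun σ₂ h₂ =>
    .skip (by omega) ?_
  rw [h₂, h₁, rightCompl_rightCompl]

theorem runs_tauInv (hC : 1 ≤ C) (σ : S.State) :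
    Runs O C .tauInv σ (90 * opCost O C) fun σ' => (σ'.simp 0).1 = S.tauInv (σ.simp 0).1 := by
  have h := (runs_tau (O := O.op) hC σ.op).mirror
  rw [opCost_op] at h
  refine h.mono le_rfl fun σ' h => ?_
  simpa [tau_op] using h

theorem runs_equal (hC : 1 ≤ C) (σ : S.State) :
    Runs O C .equal σ (90 * opCost O C) fun σ' =>
      σ'.Answers ((σ.simp 0).1 = (σ.simp 1).1) := by
  have hU := opCost_pos O hC
  refine .comp (runs_cancelLeft hC _) fun σ₁ h₁ => .step (.copySimple ..) <|
    .call (runs_isOne' hC _) Prog.writesBelow_isOne fun σ₂ h₂ f₂ => .step (.setInt ..) <|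
    .branch (fun h => .assoc <| .step (.copySimple ..) <| .comp (runs_isOne' hC _)
      fun σ₃ h₃ => .skip (by omega) ?_) (fun h => .skip_comp <| .skip (by omega) ?_)
  · simp [f₂.simp, h₁.2] at h₃
    simp [Holds] at h
    simp [Answers, h₁.1] at h₂
    have h4 : (σ.simp 0).1 = S.leftGcd (σ.simp 0).1 (σ.simp 1).1 := by
      by_contra hne
      have := h₂.2 (fun h5 => hne (inv_mul_eq_one.1 h5).symm)
      omega
    rw [← h4, inv_mul_eq_one] at h₃
    exact h₃
  · simp [Holds] at h
    simp [Answers, h₁.1] at h₂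
    have h4 : ¬ S.leftGcd (σ.simp 0).1 (σ.simp 1).1 = (σ.simp 0).1 := by
      intro heq
      have := h₂.1 (by rw [heq]; simp)
      omega
    have h5 := h₂.2 (fun h5 => h4 (inv_mul_eq_one.1 h5))
    refine ⟨fun heq => absurd ?_ h4, fun _ => by simpa using h5⟩
    rw [← heq]
    exact S.gcd_eq_left (S.pre_refl _)

theorem runs_leftGcd (hC : 1 ≤ C) (σ : S.State) :
    Runs O C .leftGcd σ (80 * opCost O C) fun σ' =>
      (σ'.simp 0).1 = S.leftGcd (σ.simp 0).1 (σ.simp 1).1 := by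
  have hU := opCost_pos O hC
  refine .step (.copySimple ..) <| .call (runs_cancelLeft hC _)
    Prog.writesBelow_cancelLeft fun σ₁ h₁ f₁ => .step (.copySimple ..) <|
    .comp (runs_cancelRight hC _) fun σ₂ h₂ => .step (.copySimple ..) <| .skip (by omega) ?_
  have h := h₂.2
  have h' := h₁.1
  simp at h'
  simp [f₁.simp, h'] at h
  rw [rightGcd_eq_left] at h
  · simpa using h
  · have := S.gcd_mem (σ.simp 0).2.mem (σ.simp 1).2.mem
    simpa [HasSuffix] using this

theorem runs_rightGcd (hC : 1 ≤ C) (σ : S.State) :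
    Runs O C .rightGcd σ (80 * opCost O C) fun σ' =>
      (σ'.simp 0).1 = S.rightGcd (σ.simp 0).1 (σ.simp 1).1 := by
  have h := (runs_leftGcd (O := O.op) hC σ.op).mirror
  rw [opCost_op] at h
  refine h.mono le_rfl fun σ' h => ?_
  simpa [leftGcd_op] using h

theorem runs_leftLcm (hC : 1 ≤ C) (σ : S.State) :
    Runs O C .leftLcm σ (220 * opCost O C) fun σ' =>
      (σ'.simp 0).1 = S.leftLcm (σ.simp 0).1 (σ.simp 1).1 := by
  have hU := opCost_pos O hC
  refine .step (.copySimple ..) <| .step (.copySimple ..) <| .call (runs_rightCompl hC _)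
    Prog.writesBelow_rightCompl fun σ₁ h₁ f₁ => .step (.copySimple ..) <|
    .step (.copySimple ..) <| .call (runs_rightCompl hC _)
    Prog.writesBelow_rightCompl fun σ₂ h₂ f₂ => .step (.copySimple ..) <|
    .comp (runs_rightGcd hC _) fun σ₃ h₃ => .comp (runs_leftCompl hC _) fun σ₄ h₄ =>
    .skip (by omega) ?_
  simp at h₁
  simp [f₁.simp] at h₂
  simp [f₂.simp, h₂, h₁] at h₃
  rw [h₄, h₃, leftLcm_eq_leftCompl]

/-- Cancelling `u = ∂(s) ∧ t` from `∂(s)` and `t` gives the second factor directly; the first is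
recovered from `∂⁻¹(u⁻¹∂(s)) = su`. -/
theorem runs_localSlide (hC : 1 ≤ C) (σ : S.State) :
    Runs O C .localSlide σ (120 * opCost O C) fun σ' =>
      (σ'.simp 0).1 = S.slideFst (σ.simp 0).1 (σ.simp 1).1 ∧
      (σ'.simp 1).1 = S.slideSnd (σ.simp 0).1 (σ.simp 1).1 := by
  have hU := opCost_pos O hC
  refine .step (.copySimple ..) <| .call (runs_rightCompl hC _)
    Prog.writesBelow_rightCompl fun σ₁ h₁ f₁ => .step (.copySimple ..) <|
    .comp (runs_cancelLeft hC _) fun σ₂ h₂ => .step (.copySimple ..) <|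
    .call (runs_leftCompl hC _) Prog.writesBelow_leftCompl fun σ₃ h₃ f₃ =>
    .step (.copySimple ..) <| .skip (by omega) ?_
  simp at h₁
  simp [f₁.simp, h₁] at h₂
  simp [h₂.1] at h₃
  simp [f₃.simp, h₃, h₂.2, slideFst, slideSnd]
  simp [leftCompl, rightCompl, mul_assoc]

omit [Nontrivial G] in
theorem Runs.divRight {q : Prog} {σ : S.State} {c d s i f : ℕ} {Q : S.State → Prop}
    (j : Fin O.numAtoms) (hj : σ.int i = (j : ℕ))
    (h : HasSuffix S.P (σ.simp s).1 (O.atom j) → ∀ t : S.Simple,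
      t.1 = (σ.simp s).1 * (O.atom j)⁻¹ → Runs O C q ((σ.setSimp d t).setInt f 1) (c - C) Q)
    (h' : ¬ HasSuffix S.P (σ.simp s).1 (O.atom j) → Runs O C q (σ.setInt f 0) (c - C) Q) :
    Runs O C (.comp (.instr (.divRight d s i f)) q) σ c Q := by
  by_cases hd : HasSuffix S.P (σ.simp s).1 (O.atom j)
  · exact .step (.divRight_true _ _ _ _ _ j hj hd
      ⟨_, (σ.simp s).2.mul_inv (isAtom_atom O j).1 hd⟩ rfl) (h hd _ rfl)
  · exact .step (.divRight_false _ _ _ _ _ j hj hd) (h' hd)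

theorem runs_mulAtom (hC : 1 ≤ C) (σ : S.State) (a : G) (ha : σ.HasAtom O 0 a) :
    Runs O C .mulAtom σ (100 * opCost O C) fun σ' =>
      σ'.Answers (S.IsSimple (a * (σ.simp 0).1)) ∧
      (S.IsSimple (a * (σ.simp 0).1) → (σ'.simp 0).1 = a * (σ.simp 0).1) := by
  have hU := opCost_pos O hC
  have hU' : C ≤ opCost O C :=
    (Nat.le_mul_of_pos_right _ (numAtoms_pos O)).trans (mul_numAtoms_le_opCost O C)
  obtain ⟨j, hj, rfl⟩ := ha
  refine .step (.setInt ..) <| .step (.add ..) <| .call (runs_leftCompl hC _)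
    Prog.writesBelow_leftCompl fun σ₁ h₁ f₁ => .divRight j (by simp [f₁.int, hj]) ?_ ?_ <;>
  simp at h₁ <;> rw [h₁, ← isSimple_mul_iff (isAtom_atom O j).1 (σ.simp 0).2.mem]
  · intro h t ht
    refine .call (runs_rightCompl hC _) Prog.writesBelow_rightCompl fun σ₂ h₂ f₂ =>
      .step (.add ..) <| .skip (by omega) ?_
    simp at h₂
    simp [Answers, h, f₂.int, f₁.int, h₂, ht]
    simp [leftCompl, rightCompl, mul_assoc]
  · intro h
    refine .call (runs_rightCompl hC _) Prog.writesBelow_rightCompl fun σ₂ h₂ f₂ =>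
      .step (.add ..) <| .skip (by omega) ?_
    simp [Answers, h, f₂.int, f₁.int]

end GarsideStructure

/-! ### Loops over words and loops with a counter -/

namespace Prog

/-- Repeat `p` until the word `q` is empty. The registers `f` and `z` are used for control. -/
def whileNonempty (q f z : ℕ) (p : Prog) : Prog :=
  .instr (.setInt f 0) ⨟ .instr (.setInt z 0) ⨟
  .loop (.le f z) (.branch (.isEmpty q) (.instr (.setInt f 1)) p ⨟ .skip) ⨟ .skip

/-- Repeat `p` as often as the integer in the register `i` says. The register `o` is used for
control. -/
def iterate (i o : ℕ) (p : Prog) : Prog :=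
  .instr (.setInt o 1) ⨟ .loop (.le o i) (p ⨟ .instr (.sub i i o) ⨟ .skip) ⨟ .skip

/-- Run through the word `10` from the front, passing on a carry in the simple register `0`. -/
def mapFront (body : Prog) : Prog :=
  .instr (.clear 11) ⨟
  whileNonempty 10 11 12 (.instr (.popFront 10 1 0) ⨟ body ⨟ .instr (.pushBack 11 1 true) ⨟ .skip) ⨟
  .instr (.copyWord 10 11) ⨟ .skip

/-- Run through the word `10` from the back, passing on a carry in the simple register `0`. -/
def mapBack (body : Prog) : Prog :=
  .instr (.clear 11) ⨟
  whileNonempty 10 11 12 (.instr (.popBack 10 1 0) ⨟ body ⨟ .instr (.pushFront 11 1 true) ⨟ .skip) ⨟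
  .instr (.copyWord 10 11) ⨟ .skip

def swap : Prog :=
  .instr (.copySimple 6 0) ⨟ .instr (.copySimple 0 1) ⨟ .instr (.copySimple 1 6) ⨟ .skip

/-- From the front, the second factor of the sliding is the new carry and the first is written out;
hence the exchange afterwards. From the back the roles are reversed, and the exchange comes before.
-/
def slideFront : Prog := mapFront (localSlide ⨟ swap)

def slideBack : Prog := mapBack (swap ⨟ localSlide)

def mapTauInv : Prog :=
  mapFront (.instr (.copySimple 0 1) ⨟ tauInv ⨟ .instr (.copySimple 1 0) ⨟ .skip)

/-- Conjugate the simple element in the register `0` by the power of `Δ` whose exponent is in the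
register `13`. -/
def tauPow : Prog :=
  iterate 13 12 tau ⨟ .instr (.setInt 11 0) ⨟ .instr (.sub 13 11 13) ⨟ iterate 13 12 tauInv ⨟ .skip

theorem writesBelow_slideFront : slideFront.writesBelow 13 = true := rfl
theorem writesBelow_slideBack : slideBack.writesBelow 13 = true := rfl
theorem writesBelow_mapTauInv : mapTauInv.writesBelow 13 = true := rfl
theorem writesBelow_tauPow : tauPow.writesBelow 14 = true := rfl

end Prog

/-! ### Words as lists of simple elements, and the cost of loops -/

namespace GarsideStructure

/-- The recursion of `accBack` peels the list from the front, whereas the machine pops letters from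
the back; this identity matches the two. -/
theorem accBack_concat {G : Type u} (f g : G → G → G) (c x : G) (l : List G) :
    accBack f g c (l ++ [x]) =
      ((accBack f g (f c x) l).1, (accBack f g (f c x) l).2 ++ [g c x]) := by
  induction l with
  | nil => rfl
  | cons y l ih => simp [accBack, ih]

theorem length_accFront {G : Type u} (f g : G → G → G) (c : G) (l : List G) :
    (accFront f g c l).2.length = l.length := by
  induction l generalizing c with
  | nil => rfl
  | cons y l ih => simp [accFront, ih]

theorem length_accBack {G : Type u} (f g : G → G → G) (c : G) (l : List G) :
    (accBack f g c l).2.length = l.length := by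
  induction l with
  | nil => rfl
  | cons y l ih => simp [accBack, ih]

theorem accFront_map {G : Type u} (f : G → G → G) (g : G → G) (c : G) (l : List G) :
    (accFront f (fun _ x => g x) c l).2 = l.map g := by
  induction l generalizing c with
  | nil => rfl
  | cons y l ih => simp [accFront, ih]

variable {G : Type u} [Group G] {S : GarsideStructure G}

/-- The word `w` consists of the simple elements in the list `l`. -/
def Lists (w : S.Word) (l : List G) : Prop :=
  w.map (fun t => (t.1.1, t.2)) = l.map fun y => (y, true)

theorem lists_nil_iff {w : S.Word} : Lists w [] ↔ w = [] := by simp [Lists]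

theorem lists_nil : Lists ([] : S.Word) [] := rfl

theorem Lists.length_eq {w : S.Word} {l : List G} (h : Lists w l) : w.length = l.length := by
  simpa using congrArg List.length h

theorem Lists.nil_iff {w : S.Word} {l : List G} (h : Lists w l) : w = [] ↔ l = [] := by
  rw [← List.length_eq_zero_iff, h.length_eq, List.length_eq_zero_iff]

theorem lists_cons_iff {w : S.Word} {x : G} {l : List G} :
    Lists w (x :: l) ↔ ∃ (t : S.Simple) (w' : S.Word), w = (t, true) :: w' ∧ t.1 = x ∧ Lists w' l := by
  cases w with
  | nil => simp [Lists]
  | cons a w =>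
    rcases a with ⟨t, b⟩
    simp [Lists]
    aesop

theorem Lists.cons {w : S.Word} {l : List G} (h : Lists w l) (t : S.Simple) :
    Lists ((t, true) :: w) (t.1 :: l) := lists_cons_iff.2 ⟨t, w, rfl, rfl, h⟩

theorem Lists.concat {w : S.Word} {l : List G} (h : Lists w l) (t : S.Simple) :
    Lists (w ++ [(t, true)]) (l ++ [t.1]) := by
  simpa [Lists] using h

theorem lists_concat_iff {w : S.Word} {x : G} {l : List G} :
    Lists w (l ++ [x]) ↔
      ∃ (t : S.Simple) (w' : S.Word), w = w' ++ [(t, true)] ∧ t.1 = x ∧ Lists w' l := by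
  constructor
  · intro h
    rw [Lists, List.map_append, List.map_eq_append_iff] at h
    obtain ⟨w', w'', rfl, h1, h2⟩ := h
    obtain ⟨t, w₀, rfl, h3, h4⟩ := lists_cons_iff.1 (show Lists w'' [x] from h2)
    rw [lists_nil_iff] at h4
    subst h4
    exact ⟨t, w', rfl, h3, h1⟩
  · rintro ⟨t, w', rfl, rfl, h⟩
    exact h.concat t

theorem lists_of_forall {w : S.Word} (h : ∀ t ∈ w, t.2 = true) :
    Lists w (w.map fun t => t.1.1) := by
  simpa [Lists] using h

theorem Lists.forall_eq_true {w : S.Word} {l : List G} (h : Lists w l) : ∀ t ∈ w, t.2 = true := by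
  intro t ht
  have : (t.1.1, t.2) ∈ l.map fun y => (y, true) := by
    rw [← h]; exact List.mem_map_of_mem ht
  obtain ⟨y, -, hy⟩ := List.mem_map.1 this
  exact (congrArg Prod.snd hy).symm

theorem Lists.map_eq {w : S.Word} {l : List G} (h : Lists w l) : w.map (fun t => t.1.1) = l := by
  have := congrArg (List.map Prod.fst) h
  simpa [Function.comp_def] using this

open State

variable {O : S.Oracle} {C : ℕ}

namespace Runs

variable {p r : Prog} {σ : S.State} {c m n : ℕ} {Q : S.State → Prop}

theorem popFront {q d f : ℕ} {x : G} {l : List G} (h : Lists (σ.word q) (x :: l))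
    (hr : ∀ (s : S.Simple) (w : S.Word), s.1 = x → Lists w l →
      Runs O C r (((σ.setWord q w).setSimp d s).setInt f 1) (c - 1) Q) :
    Runs O C (.comp (.instr (.popFront q d f)) r) σ c Q := by
  obtain ⟨t, w, h1, h2, h3⟩ := lists_cons_iff.1 h
  exact .step (.popFront _ _ _ _ t true w h1) (hr t w h2 h3)

theorem popBack {q d f : ℕ} {x : G} {l : List G} (h : Lists (σ.word q) (l ++ [x]))
    (hr : ∀ (s : S.Simple) (w : S.Word), s.1 = x → Lists w l →
      Runs O C r (((σ.setWord q w).setSimp d s).setInt f 1) (c - 1) Q) :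
    Runs O C (.comp (.instr (.popBack q d f)) r) σ c Q := by
  obtain ⟨t, w, h1, h2, h3⟩ := lists_concat_iff.1 h
  exact .step (.popBack _ _ _ _ t true w h1) (hr t w h2 h3)

/-- Conditions cannot be negated, so the loop runs on the flag `f`; finding the word empty takes an
additional iteration, whence `n + 1`. The index of the invariant is the remaining length of the
word. -/
theorem whileNonempty {q f z : ℕ} (hfz : f ≠ z) (I : ℕ → S.State → Prop)
    (hI : ∀ k τ, I k τ → (τ.word q).length = k)
    (hf : ∀ k τ a, I k τ → I k (τ.setInt f a)) (hz : ∀ k τ a, I k τ → I k (τ.setInt z a))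
    (h : ∀ k τ, I (k + 1) τ → k < n → τ.int f = 0 → τ.int z = 0 →
      Runs O C p τ m fun τ' => I k τ' ∧ τ'.int f = 0 ∧ τ'.int z = 0)
    (hσ : I n σ) : Runs O C (.whileNonempty q f z p) σ ((n + 1) * (m + 10)) (I 0) := by
  let J : ℕ → S.State → Prop := fun k τ => τ.int z = 0 ∧
    ((τ.int f = 0 ∧ ∃ i, k = i + 1 ∧ i ≤ n ∧ I i τ) ∨ (τ.int f = 1 ∧ k = 0 ∧ I 0 τ))
  refine .step (.setInt ..) <| .step (.setInt ..) <|
    .comp (.loop J (m + 4) (n + 1) ?_ ?_) fun τ h => .skip ?_ ?_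
  · rintro k τ ⟨h1, h2⟩ hc
    rcases h2 with ⟨h2, i, rfl, hin, h3⟩ | ⟨h2, h3, h4⟩
    · have h5 := hI _ _ h3
      refine .branch (fun he => ?_) fun he => ?_
      · rw [Holds] at he
        rw [he] at h5
        cases h5
        exact .step (.setInt ..) <| .skip (by omega) ⟨0, by omega, by simp [h1, hfz.symm],
          .inr ⟨by simp, rfl, hf _ _ _ h3⟩⟩
      · rw [Holds, ← List.length_eq_zero_iff, h5] at he
        obtain ⟨j, rfl⟩ := Nat.exists_eq_succ_of_ne_zero he
        exact .comp (h j τ h3 (by omega) h2 h1) fun τ' h6 => .skip (by omega)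
          ⟨j + 1, by omega, h6.2.2, .inl ⟨h6.2.1, j, rfl, by omega, h6.1⟩⟩
    · simp [Holds, h1, h2] at hc
  · exact ⟨by simp, .inl ⟨by simp [hfz], n, rfl, le_rfl, hz _ _ _ (hf _ _ _ hσ)⟩⟩
  · have : (n + 1) * (m + 10) = (n + 1) * (m + 4) + 6 * n + 6 := by ring
    omega
  · obtain ⟨⟨k, h1, h2⟩, h3⟩ := h
    rcases h2 with ⟨h2, -⟩ | ⟨-, -, h4⟩
    · simp [Holds, h1, h2] at h3
    · exact h4

/-- The counter ends at `min i 0`: it is untouched if it was not positive. `tauPow` relies on this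
to treat both signs of the exponent without a case distinction. -/
theorem iterate {i o : ℕ} (hio : i ≠ o) (I : ℕ → S.State → Prop)
    (hi : ∀ k τ a, I k τ → I k (τ.setInt i a)) (ho : ∀ k τ a, I k τ → I k (τ.setInt o a))
    (h : ∀ k τ, I (k + 1) τ → Runs O C p τ m fun τ' => I k τ' ∧ τ'.int i = τ.int i ∧
      τ'.int o = τ.int o)
    (hn : (σ.int i).toNat = n) (hσ : I n σ) :
    Runs O C (.iterate i o p) σ ((n + 1) * (m + 10)) fun σ' => I 0 σ' ∧
      σ'.int i = min (σ.int i) 0 := by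
  let J : ℕ → S.State → Prop := fun k τ => τ.int o = 1 ∧ (τ.int i).toNat = k ∧ I k τ ∧
    min (τ.int i) 0 = min (σ.int i) 0
  refine .step (.setInt ..) <| .comp (.loop J (m + 4) n ?_ ?_) fun τ h => .skip ?_ ?_
  · rintro k τ ⟨h1, h2, h3, h4⟩ hc
    simp only [Holds, h1] at hc
    obtain ⟨j, rfl⟩ : ∃ j, k = j + 1 := ⟨k - 1, by omega⟩
    refine .comp (h j τ h3) fun τ' h5 => .step (.sub ..) <| .skip (by omega) ⟨j, by omega, ?_⟩
    refine ⟨by simp [hio.symm, h5.2.2, h1], by simp [h5.2, h1]; omega, hi _ _ _ h5.1, ?_⟩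
    simp only [int_setInt, if_pos, h5.2, h1]
    omega
  · exact ⟨by simp, by simpa [hio] using hn, ho _ _ _ hσ, by simp [hio]⟩
  · have : (n + 1) * (m + 10) = n * (m + 4) + 6 * n + m + 10 := by ring
    omega
  · obtain ⟨⟨k, h1, h2, h3, h4⟩, h5⟩ := h
    simp only [Holds, h1] at h5
    obtain rfl : k = 0 := by omega
    exact ⟨h3, by omega⟩

end Runs

/-- The invariant splits the result into the part already written to word `11` and the part that the
remaining letters will produce from the present carry. -/
theorem runs_mapFront {body : Prog} {σ : S.State} {m n : ℕ} {f g : G → G → G} {l : List G}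
    (hw : body.writesBelow 10 = true)
    (hb : ∀ τ : S.State, Runs O C body τ m fun τ' =>
      (τ'.simp 0).1 = f (τ.simp 0).1 (τ.simp 1).1 ∧ (τ'.simp 1).1 = g (τ.simp 0).1 (τ.simp 1).1)
    (hl : Lists (σ.word 10) l) (hn : l.length ≤ n) :
    Runs O C (.mapFront body) σ ((n + 1) * (m + 30)) fun σ' =>
      (σ'.simp 0).1 = (accFront f g (σ.simp 0).1 l).1 ∧
      Lists (σ'.word 10) (accFront f g (σ.simp 0).1 l).2 := by
  let I : ℕ → S.State → Prop := fun k τ => ∃ l₁ l₂, l₁.length = k ∧ Lists (τ.word 10) l₁ ∧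
    Lists (τ.word 11) l₂ ∧ accFront f g (σ.simp 0).1 l =
      ((accFront f g (τ.simp 0).1 l₁).1, l₂ ++ (accFront f g (τ.simp 0).1 l₁).2)
  refine .step (.clear ..) <| .comp (.whileNonempty (n := l.length) (by decide) I ?_
    (fun _ _ _ h => h) (fun _ _ _ h => h) (m := m + 6) ?_ ?_) fun τ h => .step (.copyWord ..) <| .skip ?_ ?_
  · rintro k τ ⟨l₁, l₂, h1, h2, -⟩
    rw [h2.length_eq, h1]
  · rintro k τ ⟨l₁, l₂, h1, h2, h3, h4⟩ - hf hz
    obtain ⟨x, l₁, rfl⟩ := List.exists_cons_of_length_eq_add_one h1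
    refine .popFront h2 fun s w hs hwl => .call (hb _) hw fun τ₁ h₁ f₁ => .step (.pushBack ..) <|
      .skip (by omega) ⟨⟨l₁, l₂ ++ [(τ₁.simp 1).1], by simpa using h1, ?_, ?_, ?_⟩, ?_⟩
    · simpa [f₁.word] using hwl
    · simpa [f₁.word] using h3.concat (τ₁.simp 1)
    · simp [hs] at h₁
      simp [h4, h₁, accFront]
    · simp [f₁.int, hf, hz]
  · exact ⟨l, [], rfl, by simpa using hl, by simp [Lists], by simp⟩
  · obtain ⟨l₁, l₂, h1, h2, h3, h4⟩ := h
    rw [List.length_eq_zero_iff] at h1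
    subst h1
    have h5 : l₂.length = l.length := by
      have := length_accFront f g (σ.simp 0).1 l
      rw [h4] at this
      simpa [accFront] using this
    have h6 := h3.length_eq
    have h7 : (n + 1) * (m + 30) = (n + 1) * (m + 16) + 14 * n + 14 := by ring
    have h8 := Nat.mul_le_mul_right (m + 16) (Nat.add_le_add_right hn 1)
    have h9 : m + 6 + 10 = m + 16 := rfl
    rw [h9]
    omega
  · obtain ⟨l₁, l₂, h1, h2, h3, h4⟩ := h
    rw [List.length_eq_zero_iff] at h1
    subst h1
    simp [h4, accFront, h3]

theorem runs_mapBack {body : Prog} {σ : S.State} {m n : ℕ} {f g : G → G → G} {l : List G}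
    (hw : body.writesBelow 10 = true)
    (hb : ∀ τ : S.State, Runs O C body τ m fun τ' =>
      (τ'.simp 0).1 = f (τ.simp 0).1 (τ.simp 1).1 ∧ (τ'.simp 1).1 = g (τ.simp 0).1 (τ.simp 1).1)
    (hl : Lists (σ.word 10) l) (hn : l.length ≤ n) :
    Runs O C (.mapBack body) σ ((n + 1) * (m + 30)) fun σ' =>
      (σ'.simp 0).1 = (accBack f g (σ.simp 0).1 l).1 ∧
      Lists (σ'.word 10) (accBack f g (σ.simp 0).1 l).2 := by
  let I : ℕ → S.State → Prop := fun k τ => ∃ l₁ l₂, l₁.length = k ∧ Lists (τ.word 10) l₁ ∧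
    Lists (τ.word 11) l₂ ∧ accBack f g (σ.simp 0).1 l =
      ((accBack f g (τ.simp 0).1 l₁).1, (accBack f g (τ.simp 0).1 l₁).2 ++ l₂)
  refine .step (.clear ..) <| .comp (.whileNonempty (n := l.length) (by decide) I ?_
    (fun _ _ _ h => h) (fun _ _ _ h => h) (m := m + 6) ?_ ?_) fun τ h => .step (.copyWord ..) <| .skip ?_ ?_
  · rintro k τ ⟨l₁, l₂, h1, h2, -⟩
    rw [h2.length_eq, h1]
  · rintro k τ ⟨l₁, l₂, h1, h2, h3, h4⟩ - hf hz
    obtain rfl | ⟨l₁, x, rfl⟩ := List.eq_nil_or_concat' l₁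
    · simp at h1
    refine .popBack h2 fun s w hs hwl => .call (hb _) hw fun τ₁ h₁ f₁ => .step (.pushFront ..) <|
      .skip (by omega) ⟨⟨l₁, (τ₁.simp 1).1 :: l₂, by simpa using h1, ?_, ?_, ?_⟩, ?_⟩
    · simpa [f₁.word] using hwl
    · simpa [f₁.word] using h3.cons (τ₁.simp 1)
    · simp [hs] at h₁
      simp [h4, h₁, accBack_concat]
    · simp [f₁.int, hf, hz]
  · exact ⟨l, [], rfl, by simpa using hl, by simp [Lists], by simp⟩
  · obtain ⟨l₁, l₂, h1, h2, h3, h4⟩ := h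
    rw [List.length_eq_zero_iff] at h1
    subst h1
    have h5 : l₂.length = l.length := by
      have := length_accBack f g (σ.simp 0).1 l
      rw [h4] at this
      simpa [accBack] using this
    have h6 := h3.length_eq
    have h7 : (n + 1) * (m + 30) = (n + 1) * (m + 16) + 14 * n + 14 := by ring
    have h8 := Nat.mul_le_mul_right (m + 16) (Nat.add_le_add_right hn 1)
    have h9 : m + 6 + 10 = m + 16 := rfl
    rw [h9]
    omega
  · obtain ⟨l₁, l₂, h1, h2, h3, h4⟩ := h
    rw [List.length_eq_zero_iff] at h1
    subst h1
    simp [h4, accBack, h3]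

/-- The cost of the basic operations on elements of length `n`, up to a constant. -/
noncomputable def linCost (O : S.Oracle) (C n : ℕ) : ℕ := (n + 1) * opCost O C

theorem linCost_succ (O : S.Oracle) (C n : ℕ) :
    linCost O C (n + 1) = linCost O C n + opCost O C := by
  rw [linCost, linCost]; ring

theorem opCost_le_linCost (O : S.Oracle) (C n : ℕ) : opCost O C ≤ linCost O C n :=
  Nat.le_mul_of_pos_left _ (by omega)

theorem linCost_mono (O : S.Oracle) (C : ℕ) {n m : ℕ} (h : n ≤ m) :
    linCost O C n ≤ linCost O C m := Nat.mul_le_mul_right _ (by omega)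

theorem linCost_two_mul_le (O : S.Oracle) (C n : ℕ) :
    linCost O C (2 * n) ≤ 2 * linCost O C n := by
  rw [linCost, linCost, ← mul_assoc]
  exact Nat.mul_le_mul_right _ (by omega)

variable [Nontrivial G]

theorem lt_linCost (O : S.Oracle) {C : ℕ} (hC : 1 ≤ C) (n : ℕ) : n < linCost O C n :=
  (Nat.lt_succ_self n).trans_le (Nat.le_mul_of_pos_right _ (opCost_pos O hC))

/-- Additive bookkeeping costs are absorbed into the multiplicative constant because the cost of a
basic operation is at least `1`. -/
theorem mul_add_le_linCost (O : S.Oracle) {C : ℕ} (hC : 1 ≤ C) (n a b : ℕ) :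
    (n + 1) * (a * opCost O C + b) ≤ (a + b) * linCost O C n := by
  have h1 : b ≤ b * opCost O C := Nat.le_mul_of_pos_right _ (opCost_pos O hC)
  calc (n + 1) * (a * opCost O C + b) ≤ (n + 1) * (a * opCost O C + b * opCost O C) :=
        Nat.mul_le_mul_left _ (by omega)
    _ = _ := by rw [linCost]; ring

theorem runs_slideFront (hC : 1 ≤ C) (σ : S.State) {l : List G} {n : ℕ}
    (hl : Lists (σ.word 10) l) (hn : l.length ≤ n) :
    Runs O C .slideFront σ (170 * linCost O C n) fun σ' =>
      (σ'.simp 0).1 = (accFront S.slideSnd S.slideFst (σ.simp 0).1 l).1 ∧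
      Lists (σ'.word 10) (accFront S.slideSnd S.slideFst (σ.simp 0).1 l).2 := by
  have hU := opCost_pos O hC
  refine (runs_mapFront (m := 120 * opCost O C + 20) rfl (fun τ => ?_) hl hn).mono
    (mul_add_le_linCost O hC n 120 50) fun _ => id
  refine .call (runs_localSlide hC _) Prog.writesBelow_localSlide fun σ₁ h₁ f₁ =>
    .step (.copySimple ..) <| .step (.copySimple ..) <| .step (.copySimple ..) <|
    .skip (by omega) ?_
  simp [h₁]

theorem runs_slideBack (hC : 1 ≤ C) (σ : S.State) {l : List G} {n : ℕ}
    (hl : Lists (σ.word 10) l) (hn : l.length ≤ n) :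
    Runs O C .slideBack σ (170 * linCost O C n) fun σ' =>
      (σ'.simp 0).1 = (accBack (fun c x => S.slideFst x c) (fun c x => S.slideSnd x c)
        (σ.simp 0).1 l).1 ∧
      Lists (σ'.word 10) (accBack (fun c x => S.slideFst x c) (fun c x => S.slideSnd x c)
        (σ.simp 0).1 l).2 := by
  have hU := opCost_pos O hC
  refine (runs_mapBack (m := 120 * opCost O C + 20) rfl (fun τ => ?_) hl hn).mono
    (mul_add_le_linCost O hC n 120 50) fun _ => id
  refine .assoc <| .step (.copySimple ..) <| .assoc <| .step (.copySimple ..) <| .assoc <|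
    .step (.copySimple ..) <| .skip_comp <|
    (runs_localSlide hC _).mono (by omega) fun σ₁ h₁ => ?_
  simpa using h₁

theorem runs_mapTauInv (hC : 1 ≤ C) (σ : S.State) {l : List G} {n : ℕ}
    (hl : Lists (σ.word 10) l) (hn : l.length ≤ n) :
    Runs O C .mapTauInv σ (170 * linCost O C n) fun σ' =>
      Lists (σ'.word 10) (l.map S.tauInv) := by
  have hU := opCost_pos O hC
  refine (runs_mapFront (m := 90 * opCost O C + 30) (f := fun _ x => S.tauInv x)
    (g := fun _ x => S.tauInv x) rfl (fun τ => ?_) hl hn).mono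
    ((mul_add_le_linCost O hC n 90 60).trans (Nat.mul_le_mul_right _ (by omega))) fun σ' h => ?_
  · refine .step (.copySimple ..) <| .comp (runs_tauInv hC _) fun σ₁ h₁ =>
      .step (.copySimple ..) <| .skip (by omega) ?_
    simpa using h₁
  · rw [accFront_map] at h
    exact h.2

/-- The first loop applies `τ` as long as the exponent is positive and leaves `min p 0`; the second
applies `τ⁻¹` as often as its negative says. At most one of them does any work, and the number of
iterations is at most `n`. -/
theorem runs_tauPow (hC : 1 ≤ C) (σ : S.State) {p : ℤ} {n : ℕ} (hp : σ.int 13 = p)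
    (h1 : p ≤ n) (h2 : -p ≤ n) :
    Runs O C .tauPow σ (300 * linCost O C n) fun σ' =>
      (σ'.simp 0).1 = S.tauPow p (σ.simp 0).1 ∧ σ'.word 10 = σ.word 10 := by
  have hU := opCost_pos O hC
  have hUL := opCost_le_linCost O C n
  refine .comp ((Runs.iterate (by decide) (m := 90 * opCost O C)
      (fun k τ => S.tauPow (k + min p 0) (τ.simp 0).1 = S.tauPow p (σ.simp 0).1 ∧
        τ.word 10 = σ.word 10)
      (fun _ _ _ h => h) (fun _ _ _ h => h) (fun k τ h => ?_) rfl ?_).mono (m := _)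
      (c := 100 * linCost O C n) ?_ fun _ => id) fun σ₁ h₁ => .step (.setInt ..) <|
      .step (.sub ..) <| .comp ((Runs.iterate (by decide) (m := 90 * opCost O C)
      (fun k τ => S.tauPow (-k) (τ.simp 0).1 = S.tauPow p (σ.simp 0).1 ∧
        τ.word 10 = σ.word 10)
      (fun _ _ _ h => h) (fun _ _ _ h => h) (fun k τ h => ?_) rfl ?_).mono (m := _)
      (c := 100 * linCost O C n) ?_ fun _ => id) fun σ₂ h₂ => .skip (by omega) ?_
  · refine ((runs_tau hC τ).agree Prog.writesBelow_tau).mono le_rfl fun τ' h' => ⟨⟨?_, ?_⟩, ?_, ?_⟩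
    · rw [h'.1, ← tauPow_add_one, ← h.1]
      congr 1; push_cast; ring
    · simp [h'.2.word, h.2]
    · simp [h'.2.int]
    · simp [h'.2.int]
  · refine ⟨?_, rfl⟩
    rw [hp]; congr 1; omega
  · refine (mul_add_le_linCost O hC _ 90 10).trans (Nat.mul_le_mul_left _ (linCost_mono O C ?_))
    omega
  · refine ((runs_tauInv hC τ).agree Prog.writesBelow_tauInv).mono le_rfl fun τ' h' => ⟨⟨?_, ?_⟩, ?_, ?_⟩
    · rw [h'.1, ← tauPow_sub_one, ← h.1]
      congr 1; push_cast; ring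
    · simp [h'.2.word, h.2]
    · simp [h'.2.int]
    · simp [h'.2.int]
  · refine ⟨?_, h₁.1.2⟩
    simp [h₁.2, hp]
    rw [← h₁.1.1]
    congr 1; simp
  · refine (mul_add_le_linCost O hC _ 90 10).trans (Nat.mul_le_mul_left _ (linCost_mono O C ?_))
    simp [h₁.2, hp]
    omega
  · simpa using h₂.1

end GarsideStructure

/-! ### Bounds for the infimum and the supremum -/

namespace GarsideStructure

section Bounded

variable {G : Type u} [Group G] (S : GarsideStructure G)

local infix:50 "≼" => PrefixOf (GarsideStructure.P S)

/-- `Δ ^ (-n) ≼ x ≼ Δ ^ n`. -/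
def Bounded (n : ℕ) (x : G) : Prop := -(n : ℤ) ≤ S.inf x ∧ S.sup x ≤ n

variable {S}

theorem Bounded.mono {n m : ℕ} {x : G} (h : S.Bounded n x) (hm : n ≤ m) : S.Bounded m x :=
  ⟨by have := h.1; omega, by have := h.2; omega⟩

variable [Nontrivial G]

theorem IsLeftNormalForm.le_of_bounded {p : ℤ} {l : List G} {x : G} {n : ℕ}
    (h : S.IsLeftNormalForm p l x) (hb : S.Bounded n x) :
    p ≤ n ∧ -p ≤ n ∧ l.length ≤ 2 * n := by
  obtain ⟨h1, h2⟩ := hb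
  rw [h.inf_eq] at h1
  rw [h.sup_eq] at h2
  omega

theorem bounded_one : S.Bounded 0 1 := by
  constructor
  · rw [← zpow_pre_iff_le_inf]; simpa using S.pre_refl 1
  · rw [← pre_zpow_iff_sup_le]; simpa using S.pre_refl 1

theorem Bounded.inv {n : ℕ} {x : G} (h : S.Bounded n x) : S.Bounded n x⁻¹ := by
  obtain ⟨h1, h2⟩ := h
  rw [Bounded, inf_inv, sup_inv]
  omega

theorem Bounded.mul_simple {n : ℕ} {x s : G} (h : S.Bounded n x) (hs : S.IsSimple s) :
    S.Bounded (n + 1) (x * s) := by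
  obtain ⟨h1, h2⟩ := h
  rw [← pre_zpow_iff_sup_le] at h2
  rw [← zpow_pre_iff_le_inf] at h1
  constructor
  · rw [← zpow_pre_iff_le_inf]
    exact S.pre_trans (S.zpow_pre_zpow (by push_cast; omega)) (S.pre_trans h1 (S.pre_mul _ hs.mem))
  · rw [← pre_zpow_iff_sup_le]
    have h3 := S.mul_pre_mul x hs.2
    rw [← S.mul_delta_pre_mul_delta_iff, ← zpow_add_one] at h2
    exact S.pre_trans h3 h2

theorem Bounded.simple_mul {n : ℕ} {x s : G} (h : S.Bounded n x) (hs : S.IsSimple s) :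
    S.Bounded (n + 1) (s * x) := by
  obtain ⟨h1, h2⟩ := h
  rw [← pre_zpow_iff_sup_le] at h2
  rw [← zpow_pre_iff_le_inf] at h1
  constructor
  · rw [← zpow_pre_iff_le_inf]
    have h3 := (S.mul_zpow_pre_mul_zpow_iff (-(n : ℤ)) _ _).2 hs.1
    rw [one_mul] at h3
    exact S.pre_trans (S.zpow_pre_zpow (by push_cast; omega))
      (S.pre_trans h3 (S.mul_pre_mul s h1))
  · rw [← pre_zpow_iff_sup_le]
    have h3 := (S.mul_zpow_pre_mul_zpow_iff (n : ℤ) _ _).2 hs.2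
    rw [← zpow_one_add, add_comm] at h3
    exact S.pre_trans (S.mul_pre_mul s h2) (by exact_mod_cast h3)

theorem Bounded.mul_simple_inv {n : ℕ} {x s : G} (h : S.Bounded n x) (hs : S.IsSimple s) :
    S.Bounded (n + 1) (x * s⁻¹) := by
  simpa using (h.inv.simple_mul hs).inv

theorem Bounded.simple_inv_mul {n : ℕ} {x s : G} (h : S.Bounded n x) (hs : S.IsSimple s) :
    S.Bounded (n + 1) (s⁻¹ * x) := by
  simpa using (h.inv.mul_simple hs).inv

/-- Each letter changes the infimum and the supremum by at most one. With `le_of_bounded` this turns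
the length of a word into a bound for its normal form: exponent at most `k` in absolute value and at
most `2k` factors. -/
theorem bounded_wordVal (w : S.Word) : S.Bounded w.length (S.wordVal w) := by
  induction w with
  | nil => exact bounded_one
  | cons t w ih =>
    rcases t with ⟨s, b⟩
    cases b
    · exact ih.simple_inv_mul s.2
    · exact ih.simple_mul s.2

theorem HasLengthAtMost.bounded {k : ℕ} {x : G} (h : S.HasLengthAtMost k x) : S.Bounded k x := by
  obtain ⟨w, h1, rfl⟩ := h
  exact (bounded_wordVal w).mono h1

end Bounded

end GarsideStructure

/-! ### Programs for normal forms -/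

namespace Prog

/-- Absorb the leading factors `Δ` of the word `10` into the exponent in the register `15`. -/
def absorbDelta : Prog :=
  .instr (.setInt 10 0) ⨟ .instr (.setInt 11 0) ⨟ .instr (.setInt 12 1) ⨟
  .loop (.le 10 11)
    (.branch (.isEmpty 10) (.instr (.setInt 10 1))
      (.instr (.popFront 10 11 0) ⨟ .instr (.copySimple 0 11) ⨟ .instr (.delta 1) ⨟ equal ⨟
        .branch (.le 12 0) (.instr (.add 15 15 12))
          (.instr (.pushFront 10 11 true) ⨟ .instr (.setInt 10 1)) ⨟ .skip) ⨟ .skip) ⨟ .skip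

/-- Remove the trailing factors `1` of the word `10`. -/
def removeOne : Prog :=
  .instr (.setInt 10 0) ⨟ .instr (.setInt 11 0) ⨟ .instr (.setInt 12 1) ⨟
  .loop (.le 10 11)
    (.branch (.isEmpty 10) (.instr (.setInt 10 1))
      (.instr (.popBack 10 11 0) ⨟ .instr (.copySimple 0 11) ⨟ isOne ⨟
        .branch (.le 12 0) .skip
          (.instr (.pushBack 10 11 true) ⨟ .instr (.setInt 10 1)) ⨟ .skip) ⨟ .skip) ⨟ .skip

/-- The simple factor is read from the simple register `15`, the normal form from the integer
register `15` and the word `10`. The carry that remains after the pass is the new first factor. -/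
def normMul : Prog :=
  .instr (.copySimple 0 15) ⨟ slideBack ⨟ .instr (.pushFront 10 0 true) ⨟ absorbDelta ⨟
  removeOne ⨟ .skip

def normLeftMul : Prog :=
  .instr (.copySimple 0 15) ⨟ .instr (.setInt 11 0) ⨟ .instr (.add 13 15 11) ⨟ tauPow ⨟
  slideFront ⨟ .instr (.pushBack 10 0 true) ⨟ absorbDelta ⨟ removeOne ⨟ .skip

/-- Uses `xs⁻¹ = x ∂(s) Δ⁻¹`; the power `Δ⁻¹` is moved to the front through all factors. -/
def normDiv : Prog :=
  .instr (.copySimple 0 15) ⨟ rightCompl ⨟ .instr (.copySimple 15 0) ⨟ normMul ⨟ mapTauInv ⨟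
  .instr (.setInt 11 1) ⨟ .instr (.sub 15 15 11) ⨟ .skip

/-- Uses `s⁻¹x = Δ⁻¹ ∂⁻¹(s) x`; here only the exponent has to be corrected. -/
def normLeftDiv : Prog :=
  .instr (.copySimple 0 15) ⨟ leftCompl ⨟ .instr (.copySimple 15 0) ⨟ normLeftMul ⨟
  .instr (.setInt 11 1) ⨟ .instr (.sub 15 15 11) ⨟ .skip

def normConj : Prog :=
  .instr (.copySimple 16 15) ⨟ normMul ⨟ .instr (.copySimple 15 16) ⨟ normLeftDiv ⨟ .skip

def normConjInv : Prog :=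
  .instr (.copySimple 16 15) ⨟ normLeftMul ⨟ .instr (.copySimple 15 16) ⨟ normDiv ⨟ .skip

/-- First and last factor are inspected by popping and pushing them back. For a power of `Δ` there
are none, and the value `1` is produced as `∂(Δ)`. -/
def prefPrefix : Prog :=
  .branch (.isEmpty 10) (.instr (.delta 0) ⨟ rightCompl)
    (.instr (.popFront 10 0 0) ⨟ .instr (.pushFront 10 0 true) ⨟ .instr (.setInt 11 0) ⨟
      .instr (.sub 13 11 15) ⨟ tauPow ⨟ .instr (.copySimple 13 0) ⨟ .instr (.popBack 10 0 0) ⨟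
      .instr (.pushBack 10 0 true) ⨟ rightCompl ⨟ .instr (.copySimple 1 0) ⨟
      .instr (.copySimple 0 13) ⨟ leftGcd) ⨟ .skip

def slide : Prog := prefPrefix ⨟ .instr (.copySimple 15 0) ⨟ normConj ⨟ .skip

theorem writesBelow_normMul : normMul.writesBelow 16 = true := rfl
theorem writesBelow_normLeftMul : normLeftMul.writesBelow 16 = true := rfl
theorem writesBelow_normDiv : normDiv.writesBelow 16 = true := rfl
theorem writesBelow_normConj : normConj.writesBelow 17 = true := rfl
theorem writesBelow_prefPrefix : prefPrefix.writesBelow 14 = true := rfl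

end Prog

/-! ### Correctness and cost of the programs for normal forms -/

namespace GarsideStructure

variable {G : Type u} [Group G] {S : GarsideStructure G}

/-- The integer register `15` and the word register `10` hold the left normal form of `x`. -/
def State.HasNF (σ : S.State) (x : G) : Prop :=
  ∃ l, Lists (σ.word 10) l ∧ S.IsLeftNormalForm (σ.int 15) l x

variable [Nontrivial G] {O : S.Oracle} {C : ℕ}

open State

/-- Every iteration either shortens the list and raises the exponent by one, or ends the loop after
restoring a first factor different from `Δ`. -/
theorem runs_absorbDelta (hC : 1 ≤ C) (σ : S.State) {l : List G} {x : G} {n : ℕ}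
    (hl : Lists (σ.word 10) l) (hx : S.IsWeightedForm (σ.int 15) l x) (hn : l.length ≤ n) :
    Runs O C .absorbDelta σ (130 * linCost O C n) fun σ' =>
      ∃ l', Lists (σ'.word 10) l' ∧ S.IsWeightedForm (σ'.int 15) l' x ∧ l'.length ≤ n ∧
        ∀ y ∈ l'.head?, y ≠ S.Δ := by
  have hU := opCost_pos O hC
  have hUL := opCost_le_linCost O C n
  let I : ℕ → S.State → Prop := fun k τ => τ.int 11 = 0 ∧ τ.int 12 = 1 ∧
    ∃ l', Lists (τ.word 10) l' ∧ S.IsWeightedForm (τ.int 15) l' x ∧ l'.length ≤ n ∧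
      ((τ.int 10 = 0 ∧ k = l'.length + 1) ∨
        (τ.int 10 = 1 ∧ k = 0 ∧ ∀ y ∈ l'.head?, y ≠ S.Δ))
  refine .step (.setInt ..) <| .step (.setInt ..) <| .step (.setInt ..) <|
    .comp ((Runs.loop I (90 * opCost O C + 20) (l.length + 1) ?_ ?_).mono
      (c := 120 * linCost O C n) ?_ fun _ => id) fun τ h => .skip (by omega) ?_
  · rintro k τ ⟨h1, h2, l', h3, h4, h5, h6⟩ hc
    rcases h6 with ⟨h6, h7⟩ | ⟨h6, -⟩
    swap
    · simp [Holds, h1, h6] at hc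
    refine .branch (fun he => .step (.setInt ..) <| .skip (by omega) ⟨0, by omega, ?_⟩) fun he => ?_
    · rw [Holds, h3.nil_iff] at he
      subst he
      exact ⟨by simpa using h1, by simpa using h2, [], by simpa using h3, by simpa using h4,
        by simp, .inr (by simp)⟩
    · rw [Holds, h3.nil_iff] at he
      obtain ⟨y, l', rfl⟩ := List.exists_cons_of_ne_nil he
      refine .assoc <| .popFront h3 fun s w hs hw => .assoc <| .step (.copySimple ..) <| .assoc <|
        .step (.delta _ _ S.deltaSimple rfl) <| .assoc <| .call (runs_equal hC _)
        Prog.writesBelow_equal fun σ₁ h₁ f₁ => .assoc <| .branch (fun hb => ?_) (fun hb => ?_) <;>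
      simp [hs] at h₁ <;> simp [Holds, f₁.int, h2] at hb
      · refine .step (.add ..) <| .skip_comp <| .skip (by omega) ⟨l'.length + 1, by simp [h7], ?_⟩
        have hy : y = S.Δ := by
          by_contra hne
          have := h₁.2 hne
          omega
        subst hy
        refine ⟨by simp [f₁.int, h1], by simp [f₁.int, h2], l', by simp [f₁.word, hw], ?_, ?_,
          .inl ⟨by simp [f₁.int, h6], rfl⟩⟩
        · simpa [f₁.int, h2] using h4.of_cons_delta
        · simp at h5; omega
      · have hy : y ≠ S.Δ := by
          intro heq
          have := h₁.1 heq
          omega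
        refine .assoc <| .step (.pushFront ..) <| .step (.setInt ..) <| .skip_comp <|
          .skip (by omega) ⟨0, by omega, by simp [f₁.int, h1], by simp [f₁.int, h2], y :: l', ?_⟩
        refine ⟨?_, by simpa [f₁.int] using h4, h5, .inr ⟨by simp, rfl, by simpa using hy⟩⟩
        have := hw.cons s
        rw [hs] at this
        simpa [f₁.word, f₁.simp] using this
  · exact ⟨by simp, by simp, l, by simpa using hl, by simpa using hx, hn, .inl ⟨by simp, rfl⟩⟩
  · have h1 := mul_add_le_linCost O hC l.length 90 20
    have h2 := linCost_mono O C hn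
    omega
  · obtain ⟨⟨k, h1, h2, l', h3, h4, h5, h6⟩, h7⟩ := h
    rcases h6 with ⟨h6, -⟩ | ⟨-, -, h6⟩
    · simp [Holds, h1, h6] at h7
    · exact ⟨l', h3, h4, h5, h6⟩

/-- Removing factors at the end preserves the head as long as the list is not empty, so no `Δ`
reappears in front and the result is a genuine normal form. -/
theorem runs_removeOne (hC : 1 ≤ C) (σ : S.State) {l : List G} {x : G} {n : ℕ}
    (hl : Lists (σ.word 10) l) (hx : S.IsWeightedForm (σ.int 15) l x) (hn : l.length ≤ n)
    (hd : ∀ y ∈ l.head?, y ≠ S.Δ) :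
    Runs O C .removeOne σ (60 * linCost O C n) fun σ' => σ'.HasNF x := by
  have hU := opCost_pos O hC
  have hUL := opCost_le_linCost O C n
  let I : ℕ → S.State → Prop := fun k τ => τ.int 11 = 0 ∧ τ.int 12 = 1 ∧
    ∃ l', Lists (τ.word 10) l' ∧ S.IsWeightedForm (τ.int 15) l' x ∧
      (∀ y ∈ l'.head?, y ≠ S.Δ) ∧ ((τ.int 10 = 0 ∧ k = l'.length + 1) ∨
        (τ.int 10 = 1 ∧ k = 0 ∧ ∀ y ∈ l'.getLast?, y ≠ 1))
  refine .step (.setInt ..) <| .step (.setInt ..) <| .step (.setInt ..) <|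
    .comp ((Runs.loop I (20 * opCost O C + 20) (l.length + 1) ?_ ?_).mono
      (c := 50 * linCost O C n) ?_ fun _ => id) fun τ h => .skip (by omega) ?_
  · rintro k τ ⟨h1, h2, l', h3, h4, h5, h6⟩ hc
    rcases h6 with ⟨h6, h7⟩ | ⟨h6, -⟩
    swap
    · simp [Holds, h1, h6] at hc
    refine .branch (fun he => .step (.setInt ..) <| .skip (by omega) ⟨0, by omega, ?_⟩) fun he => ?_
    · rw [Holds, h3.nil_iff] at he
      subst he
      exact ⟨by simpa using h1, by simpa using h2, [], by simpa using h3, by simpa using h4,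
        by simp, .inr (by simp)⟩
    · rw [Holds, h3.nil_iff] at he
      obtain rfl | ⟨l', y, rfl⟩ := List.eq_nil_or_concat' l'
      · exact absurd rfl he
      refine .assoc <| .popBack h3 fun s w hs hw => .assoc <| .step (.copySimple ..) <| .assoc <|
        .call (runs_isOne' hC _)
        Prog.writesBelow_isOne fun σ₁ h₁ f₁ => .assoc <| .branch (fun hb => ?_) (fun hb => ?_) <;>
      simp [hs] at h₁ <;> simp [Holds, f₁.int, h2] at hb
      · refine .skip_comp <| .skip_comp <| .skip (by omega) ⟨l'.length + 1, by simp [h7], ?_⟩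
        have hy : y = 1 := by
          by_contra hne
          have := h₁.2 hne
          omega
        subst hy
        refine ⟨by simp [f₁.int, h1], by simp [f₁.int, h2], l', by simp [f₁.word, hw], ?_, ?_,
          .inl ⟨by simp [f₁.int, h6], rfl⟩⟩
        · simpa [f₁.int, h2] using h4.of_append_one
        · intro z hz
          exact h5 z (by
            rw [Option.mem_def] at hz ⊢
            rw [List.head?_append, hz]; rfl)
      · have hy : y ≠ 1 := by
          intro heq
          have := h₁.1 heq
          omega
        refine .assoc <| .step (.pushBack ..) <| .step (.setInt ..) <| .skip_comp <|
          .skip (by omega) ⟨0, by omega, by simp [f₁.int, h1], by simp [f₁.int, h2],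
            l' ++ [y], ?_⟩
        refine ⟨?_, by simpa [f₁.int] using h4, h5, .inr ⟨by simp, rfl, by simpa using hy⟩⟩
        have := hw.concat s
        rw [hs] at this
        simpa [f₁.word, f₁.simp] using this
  · exact ⟨by simp, by simp, l, by simpa using hl, by simpa using hx, hd, .inl ⟨by simp, rfl⟩⟩
  · have h1 := mul_add_le_linCost O hC l.length 20 20
    have h2 := linCost_mono O C hn
    omega
  · obtain ⟨⟨k, h1, h2, l', h3, h4, h5, h6⟩, h7⟩ := h
    rcases h6 with ⟨h6, -⟩ | ⟨-, -, h6⟩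
    · simp [Holds, h1, h6] at h7
    · exact ⟨l', h3, h4.isLeftNormalForm h5 h6⟩

theorem runs_normMul (hC : 1 ≤ C) (σ : S.State) {x : G} {n : ℕ} (hx : σ.HasNF x)
    (hn : S.Bounded n x) :
    Runs O C .normMul σ (1000 * linCost O C n) fun σ' => σ'.HasNF (x * (σ.simp 15).1) := by
  have hU := opCost_pos O hC
  have hUL := opCost_le_linCost O C n
  have hL := linCost_two_mul_le O C n
  have hL' := linCost_succ O C (2 * n)
  obtain ⟨l, h1, h2⟩ := hx
  obtain ⟨-, -, h3⟩ := h2.le_of_bounded hn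
  refine .step (.copySimple ..) <| .call (runs_slideBack hC _ (by simpa using h1) h3)
    Prog.writesBelow_slideBack fun σ₁ h₁ f₁ => .step (.pushFront ..) <|
    .comp (runs_absorbDelta hC _ (l := S.mulBack l (σ.simp 15).1) (n := 2 * n + 1) ?_
      (x := x * (σ.simp 15).1) ?_ ?_)
    fun σ₂ ⟨l₂, h4, h5, h6, h7⟩ => .comp (runs_removeOne hC _ h4 h5 h6 h7) fun σ₃ h₃ =>
    .skip (by omega) h₃
  · simp at h₁
    have := h₁.2.cons (σ₁.simp 0)
    rw [h₁.1] at this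
    simpa [mulBack] using this
  · simpa [f₁.int] using isWeightedForm_mul h2.isWeightedForm (σ.simp 15).2
  · simpa [mulBack, length_accBack] using h3

theorem runs_normLeftMul (hC : 1 ≤ C) (σ : S.State) {x : G} {n : ℕ} (hx : σ.HasNF x)
    (hn : S.Bounded n x) :
    Runs O C .normLeftMul σ (1500 * linCost O C n) fun σ' => σ'.HasNF ((σ.simp 15).1 * x) := by
  have hU := opCost_pos O hC
  have hUL := opCost_le_linCost O C n
  have hL := linCost_two_mul_le O C n
  have hL' := linCost_succ O C (2 * n)
  obtain ⟨l, h1, h2⟩ := hx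
  obtain ⟨h3, h4, h5⟩ := h2.le_of_bounded hn
  refine .step (.copySimple ..) <| .step (.setInt ..) <| .step (.add ..) <|
    .call (runs_tauPow hC _ (p := σ.int 15) (n := n) (by simp) h3 h4)
    Prog.writesBelow_tauPow fun σ₀ h₀ f₀ =>
    .call (runs_slideFront hC _ (l := l) (n := 2 * n) ?_ h5)
    Prog.writesBelow_slideFront fun σ₁ h₁ f₁ => .step (.pushBack ..) <|
    .comp (runs_absorbDelta hC _ (l := S.mulFront (S.tauPow (σ.int 15) (σ.simp 15).1) l)
      (n := 2 * n + 1) ?_ (x := (σ.simp 15).1 * x) ?_ ?_)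
    fun σ₂ ⟨l₂, h4, h5, h6, h7⟩ => .comp (runs_removeOne hC _ h4 h5 h6 h7) fun σ₃ h₃ =>
    .skip (by omega) h₃
  · simpa [h₀.2] using h1
  · have h₀' := h₀.1
    simp at h₀'
    rw [h₀'] at h₁
    have := h₁.2.concat (σ₁.simp 0)
    rw [h₁.1] at this
    simpa [mulFront] using this
  · simpa [f₁.int, f₀.int] using isWeightedForm_simple_mul h2.isWeightedForm (σ.simp 15).2
  · simpa [mulFront, length_accFront] using h5

theorem runs_normDiv (hC : 1 ≤ C) (σ : S.State) {x : G} {n : ℕ} (hx : σ.HasNF x)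
    (hn : S.Bounded n x) :
    Runs O C .normDiv σ (2000 * linCost O C n) fun σ' => σ'.HasNF (x * (σ.simp 15).1⁻¹) := by
  have hU := opCost_pos O hC
  have hUL := opCost_le_linCost O C n
  have hL := linCost_two_mul_le O C (n + 1)
  have hL' := linCost_succ O C n
  refine .step (.copySimple ..) <| .call (runs_rightCompl hC _) Prog.writesBelow_rightCompl
    fun σ₁ h₁ f₁ => .step (.copySimple ..) <| .comp (runs_normMul hC _ (x := x) ?_ hn)
    fun σ₂ ⟨l, h2, h3⟩ => .call (runs_mapTauInv hC _ h2 (h3.le_of_bounded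
      (hn.mul_simple (Subtype.property _))).2.2) Prog.writesBelow_mapTauInv fun σ₃ h₃ f₃ =>
    .step (.setInt ..) <| .step (.sub ..) <| .skip (by omega) ⟨_, by simpa using h₃, ?_⟩
  · simpa [HasNF, f₁.int, f₁.word] using hx
  · have h4 := h3.mul_delta_inv
    simp at h₁
    simpa [f₃.int, h₁, GarsideStructure.rightCompl, mul_assoc] using h4

theorem runs_normLeftDiv (hC : 1 ≤ C) (σ : S.State) {x : G} {n : ℕ} (hx : σ.HasNF x)
    (hn : S.Bounded n x) :
    Runs O C .normLeftDiv σ (2000 * linCost O C n) fun σ' => σ'.HasNF ((σ.simp 15).1⁻¹ * x) := by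
  have hU := opCost_pos O hC
  have hUL := opCost_le_linCost O C n
  refine .step (.copySimple ..) <| .call (runs_leftCompl hC _) Prog.writesBelow_leftCompl
    fun σ₁ h₁ f₁ => .step (.copySimple ..) <| .comp (runs_normLeftMul hC _ (x := x) ?_ hn)
    fun σ₂ ⟨l, h2, h3⟩ => .step (.setInt ..) <| .step (.sub ..) <| .skip (by omega)
      ⟨l, by simpa using h2, ?_⟩
  · simpa [HasNF, f₁.int, f₁.word] using hx
  · have h4 := h3.delta_inv_mul
    simp at h₁
    simpa [h₁, GarsideStructure.leftCompl, mul_assoc] using h4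

theorem runs_normConj (hC : 1 ≤ C) (σ : S.State) {x : G} {n : ℕ} (hx : σ.HasNF x)
    (hn : S.Bounded n x) :
    Runs O C .normConj σ (6000 * linCost O C n) fun σ' => σ'.HasNF (conj x (σ.simp 15).1) := by
  have hU := opCost_pos O hC
  have hUL := opCost_le_linCost O C n
  have hL' := linCost_succ O C n
  refine .step (.copySimple ..) <| .call (runs_normMul hC _ (x := x) (by simpa [HasNF] using hx) hn)
    Prog.writesBelow_normMul fun σ₁ h₁ f₁ => .step (.copySimple ..) <|
    .comp (runs_normLeftDiv hC _ (x := x * (σ.simp 15).1) (n := n + 1)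
      (by simpa [HasNF] using h₁) (hn.mul_simple (σ.simp 15).2)) fun σ₂ h₂ => .skip (by omega) ?_
  simpa [f₁.simp, conj, mul_assoc] using h₂

theorem runs_normConjInv (hC : 1 ≤ C) (σ : S.State) {x : G} {n : ℕ} (hx : σ.HasNF x)
    (hn : S.Bounded n x) :
    Runs O C .normConjInv σ (6000 * linCost O C n) fun σ' =>
      σ'.HasNF (conj x (σ.simp 15).1⁻¹) := by
  have hU := opCost_pos O hC
  have hUL := opCost_le_linCost O C n
  have hL' := linCost_succ O C n
  refine .step (.copySimple ..) <| .call (runs_normLeftMul hC _ (x := x)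
    (by simpa [HasNF] using hx) hn)
    Prog.writesBelow_normLeftMul fun σ₁ h₁ f₁ => .step (.copySimple ..) <|
    .comp (runs_normDiv hC _ (x := (σ.simp 15).1 * x) (n := n + 1)
      (by simpa [HasNF] using h₁) (hn.simple_mul (σ.simp 15).2)) fun σ₂ h₂ => .skip (by omega) ?_
  simpa [f₁.simp, conj, mul_assoc] using h₂

theorem runs_prefPrefix (hC : 1 ≤ C) (σ : S.State) {x : G} {n : ℕ} (hx : σ.HasNF x)
    (hn : S.Bounded n x) :
    Runs O C .prefPrefix σ (1000 * linCost O C n) fun σ' =>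
      (σ'.simp 0).1 = S.prefPrefix x ∧ σ'.HasNF x := by
  have hU := opCost_pos O hC
  have hUL := opCost_le_linCost O C n
  obtain ⟨l, h1, h2⟩ := hx
  obtain ⟨h3, h4, -⟩ := h2.le_of_bounded hn
  refine .branch (fun he => ?_) (fun he => ?_) <;> rw [Holds, h1.nil_iff] at he
  · subst he
    refine .assoc <| .step (.delta _ _ S.deltaSimple rfl) <| .call (runs_rightCompl hC _)
      Prog.writesBelow_rightCompl fun σ₁ h₁ f₁ => .skip (by omega) ⟨?_, [], ?_, ?_⟩
    · rw [h₁, h2.prefPrefix_nil]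
      simp [GarsideStructure.rightCompl]
    · simpa [f₁.word] using h1
    · simpa [f₁.int] using h2
  · obtain ⟨y, l₁, hy⟩ := List.exists_cons_of_ne_nil he
    obtain rfl | ⟨l₂, z, hz⟩ := List.eq_nil_or_concat' l
    · exact absurd rfl he
    obtain ⟨s, w, hsw, hs, -⟩ := lists_cons_iff.1 (hy ▸ h1)
    obtain ⟨t, w', htw, ht, -⟩ := lists_concat_iff.1 (hz ▸ h1)
    refine .assoc <| .step (.popFront _ _ _ _ s true w hsw) <| .assoc <| .step (.pushFront ..) <|
      .assoc <| .step (.setInt ..) <| .assoc <| .step (.sub ..) <| .assoc <|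
      .call (runs_tauPow hC _ (p := - σ.int 15) (n := n) (by simp) h4 (by simpa using h3))
      Prog.writesBelow_tauPow fun σ₁ h₁ f₁ => .assoc <| .step (.copySimple ..) <| .assoc <|
      .step (.popBack _ _ _ _ t true w' ?_) <| .assoc <| .step (.pushBack ..) <| .assoc <|
      .call (runs_rightCompl hC _) Prog.writesBelow_rightCompl fun σ₂ h₂ f₂ => .assoc <|
      .step (.copySimple ..) <| .assoc <| .step (.copySimple ..) <|
      .call (runs_leftGcd hC _) Prog.writesBelow_leftGcd fun σ₃ h₃ f₃ => .skip (by omega)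
      ⟨?_, l, ?_, ?_⟩
    · simp [h₁.2, ← hsw, htw]
    · have h₁' := h₁.1
      simp at h₁' h₂
      simp [f₂.simp, h₁', h₂, hs, ht] at h₃
      rw [h₃, IsLeftNormalForm.prefPrefix_eq (hy ▸ h2) (hy ▸ hz)]
    · simpa [f₃.word, f₂.word, ← htw] using h1
    · simpa [f₃.int, f₂.int, f₁.int] using h2

theorem runs_slide (hC : 1 ≤ C) (σ : S.State) {x : G} {n : ℕ} (hx : σ.HasNF x)
    (hn : S.Bounded n x) :
    Runs O C .slide σ (8000 * linCost O C n) fun σ' => σ'.HasNF (S.slide x) := by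
  have hU := opCost_pos O hC
  have hUL := opCost_le_linCost O C n
  refine .comp (runs_prefPrefix hC _ hx hn) fun σ₁ h₁ => .step (.copySimple ..) <|
    .comp (runs_normConj hC _ (x := x) (by simpa [HasNF] using h₁.2) hn) fun σ₂ h₂ =>
    .skip (by omega) ?_
  simpa [h₁.1, GarsideStructure.slide] using h₂

end GarsideStructure

/-! ### Programs for words -/

namespace Prog

/-- Compare the first letters of the words `10` and `11`. -/
def compareStep : Prog :=
  .branch (.isEmpty 10)
    (.instr (.setInt 10 1) ⨟ .branch (.isEmpty 11) .skip (.instr (.setInt 15 0)) ⨟ .skip)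
    (.branch (.isEmpty 11) (.instr (.setInt 10 1) ⨟ .instr (.setInt 15 0))
      (.instr (.popFront 10 13 0) ⨟ .instr (.popFront 11 14 0) ⨟ .instr (.copySimple 0 13) ⨟
        .instr (.copySimple 1 14) ⨟ equal ⨟
        .branch (.le 12 0) .skip (.instr (.setInt 10 1) ⨟ .instr (.setInt 15 0)) ⨟ .skip) ⨟
      .skip) ⨟ .skip

/-- Compare the left normal forms in the registers `0` and `1`. -/
def sameNF : Prog :=
  .instr (.copyWord 10 0) ⨟ .instr (.copyWord 11 1) ⨟ .instr (.setInt 10 0) ⨟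
  .instr (.setInt 11 0) ⨟ .instr (.setInt 12 1) ⨟ .instr (.setInt 15 1) ⨟
  .branch (.le 0 1) (.branch (.le 1 0) .skip (.instr (.setInt 15 0) ⨟ .instr (.setInt 10 1)) ⨟ .skip)
    (.instr (.setInt 15 0) ⨟ .instr (.setInt 10 1)) ⨟
  .loop (.le 10 11) compareStep ⨟
  .instr (.add 0 15 11) ⨟ .skip

/-- Multiply the normal form in the registers `10` and `15` by the word `20`. -/
def absorbWord : Prog :=
  whileNonempty 20 21 22 (.instr (.popFront 20 15 20) ⨟ .branch (.le 20 22) normDiv normMul ⨟ .skip)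

/-- The normal form of the product of the words `24`, `25` and `26`. -/
def normalize : Prog :=
  .instr (.clear 10) ⨟ .instr (.setInt 15 0) ⨟ .instr (.copyWord 20 24) ⨟ absorbWord ⨟
  .instr (.copyWord 20 25) ⨟ absorbWord ⨟ .instr (.copyWord 20 26) ⨟ absorbWord ⨟ .skip

/-- The inverse of the word `20` is written into the register `23`. -/
def invertWord : Prog :=
  .instr (.clear 23) ⨟
  whileNonempty 20 21 22 (.instr (.popFront 20 20 20) ⨟
    .branch (.le 20 22) (.instr (.pushFront 23 20 true)) (.instr (.pushFront 23 20 false)) ⨟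
    .skip) ⨟ .skip

/-- The normal form of the word `30`. -/
def normWord : Prog :=
  .instr (.copyWord 24 30) ⨟ .instr (.clear 25) ⨟ .instr (.clear 26) ⨟ normalize ⨟ .skip

/-- The normal form of the conjugate of the word `30` by the word `31`. -/
def normConjWord : Prog :=
  .instr (.copyWord 20 31) ⨟ invertWord ⨟ .instr (.copyWord 24 23) ⨟ .instr (.copyWord 25 30) ⨟
  .instr (.copyWord 26 31) ⨟ normalize ⨟ .skip

/-- The normal form of the conjugate of the word `30` by the inverse of the word `31`. -/
def normConjInvWord : Prog :=
  .instr (.copyWord 20 31) ⨟ invertWord ⨟ .instr (.copyWord 26 23) ⨟ .instr (.copyWord 25 30) ⨟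
  .instr (.copyWord 24 31) ⨟ normalize ⨟ .skip

/-- The left gcd of the words `30` and `31` is written into the register `30`. -/
def gcdWord : Prog :=
  .instr (.copyWord 20 30) ⨟ invertWord ⨟ .instr (.copyWord 24 23) ⨟ .instr (.copyWord 25 31) ⨟
  .instr (.clear 26) ⨟ normalize ⨟ .instr (.setInt 11 0) ⨟ .instr (.sub 31 11 15) ⨟
  .instr (.add 32 31 11) ⨟ .instr (.delta 30) ⨟
  iterate 31 33 (.instr (.pushBack 30 30 false) ⨟ .skip) ⨟
  iterate 32 33 (.branch (.isEmpty 10) .skip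
    (.instr (.popFront 10 31 34) ⨟ .instr (.pushBack 30 31 true)) ⨟ .skip) ⨟ .skip

/-- The left lcm of the words `30` and `31` is written into the register `30`. -/
def lcmWord : Prog :=
  .instr (.copyWord 20 30) ⨟ invertWord ⨟ .instr (.copyWord 30 23) ⨟ .instr (.copyWord 20 31) ⨟
  invertWord ⨟ .instr (.copyWord 31 23) ⨟ gcdWord.mirror ⨟ .instr (.copyWord 20 30) ⨟
  invertWord ⨟ .instr (.copyWord 30 23) ⨟ .skip

theorem writesBelow_absorbWord : absorbWord.writesBelow 23 = true := rfl
theorem writesBelow_normalize : normalize.writesBelow 23 = true := rfl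
theorem writesBelow_invertWord : invertWord.writesBelow 24 = true := rfl
theorem writesBelow_normWord : normWord.writesBelow 27 = true := rfl
theorem writesBelow_normConjWord : normConjWord.writesBelow 27 = true := rfl

end Prog

/-! ### Gcds from normal forms, and the programs for words -/

namespace GarsideStructure

section

variable {G : Type u} [Group G] (S : GarsideStructure G)

local infix:50 "≼" => PrefixOf (GarsideStructure.P S)

/-- The gcd has the same maximal simple prefix `x` as the whole product; after removing `x`, the
rest divides one power of `Δ` less, and induction applies. -/
theorem gcd_delta_pow_prod {l : List G} (hl : ∀ y ∈ l, S.IsSimple y)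
    (h : l.IsChain S.LeftWeighted) (j : ℕ) :
    S.leftGcd (S.Δ ^ (j : ℤ)) l.prod = (l.take j).prod := by
  induction l generalizing j with
  | nil =>
    rw [gcd_comm, List.take_nil, List.prod_nil]
    exact S.gcd_eq_left ((S.one_pre_iff _).2 (S.delta_zpow_mem (by omega)))
  | cons x l ih =>
    cases j with
    | zero =>
      rw [List.take_zero, List.prod_nil, Nat.cast_zero, zpow_zero]
      exact S.gcd_eq_left ((S.one_pre_iff _).2 (S.prod_mem hl))
    | succ j =>
      have hx := S.gcd_delta_prod hl h
      have hl' : ∀ y ∈ l, S.IsSimple y := fun y hy => hl y (by simp [hy])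
      rw [List.take_succ_cons, List.prod_cons (a := x) (l := l.take j), ← ih hl' h.tail, mul_gcd,
        ← List.prod_cons]
      refine S.pre_antisymm ((S.pre_gcd_iff _ _ _).2 ⟨?_, S.gcd_pre_right _ _⟩)
        ((S.pre_gcd_iff _ _ _).2 ⟨S.pre_trans (S.gcd_pre_left _ _) ?_, S.gcd_pre_right _ _⟩)
      · set c := S.leftGcd (S.Δ ^ ((j + 1 : ℕ) : ℤ)) (x :: l).prod with hc
        have h1 := S.gcd_delta_inv_mul_pre (c := c) (m := j) (by omega)
          (by rw [hc]; exact_mod_cast S.gcd_pre_left (S.Δ ^ ((j + 1 : ℕ) : ℤ)) (x :: l).prod)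
        have h2 : S.leftGcd S.Δ c = x := by
          refine S.pre_antisymm ?_ ((S.pre_gcd_iff _ _ _).2 ⟨(hl x (by simp)).2,
            (S.pre_gcd_iff _ _ _).2 ⟨S.pre_trans (hl x (by simp)).2 ?_, ?_⟩⟩)
          · rw [← hx]
            exact (S.pre_gcd_iff _ _ _).2 ⟨S.gcd_pre_left _ _,
              S.pre_trans (S.gcd_pre_right _ _) (S.gcd_pre_right _ _)⟩
          · simpa using S.zpow_pre_zpow (m := 1) (n := ((j + 1 : ℕ) : ℤ)) (by push_cast; omega)
          · rw [List.prod_cons]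
            exact S.pre_mul _ (S.prod_mem hl')
        rwa [h2, pre_iff_inv_mul, inv_inv] at h1
      · have := (S.mul_zpow_pre_mul_zpow_iff (j : ℤ) _ _).2 (hl x (by simp)).2
        rw [← zpow_one_add, add_comm] at this
        exact_mod_cast this

variable {S} in
-- For `p ≤ 0`, pull out `Δᵖ` and use `gcd_delta_pow_prod` with `Δ⁻ᵖ`; for `p ≥ 0` the element is
-- positive and the gcd is `1`. After translation by `x` this computes all gcds `x ∧ y`.
theorem IsLeftNormalForm.one_gcd {p : ℤ} {l : List G} {z : G} (h : S.IsLeftNormalForm p l z) :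
    S.leftGcd 1 z = S.Δ ^ (min p 0) * (l.take (-p).toNat).prod := by
  have hl : ∀ y ∈ l, S.IsSimple y := fun y hy => (h.2.1 y hy).1
  rcases le_total p 0 with hp | hp
  · rw [min_eq_left hp, ← S.gcd_delta_pow_prod hl h.2.2, Int.toNat_of_nonneg (by omega), mul_gcd,
      ← zpow_add, ← h.1]
    simp
  · have h1 : (-p).toNat = 0 := by omega
    rw [min_eq_right hp, h1, zpow_zero, one_mul, List.take_zero, List.prod_nil]
    refine S.gcd_eq_left ((S.one_pre_iff _).2 ?_)
    rw [h.1]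
    exact S.P.mul_mem (S.delta_zpow_mem hp) (S.prod_mem hl)

theorem leftLcm_eq_inv (x y : G) : S.leftLcm x y = (S.rightGcd x⁻¹ y⁻¹)⁻¹ := by
  rw [← inv_eq_iff_eq_inv, eq_comm]
  refine S.rightGcd_eq_of_isRightGcd ⟨?_, ?_, fun c hc hd => ?_⟩ <;>
    simp only [hasSuffix_iff_prefixOf_inv, inv_inv] at *
  · exact S.pre_lcm_left x y
  · exact S.pre_lcm_right x y
  · exact (S.lcm_pre_iff _ _ _).2 ⟨hc, hd⟩

theorem wordVal_append (w w' : S.Word) : S.wordVal (w ++ w') = S.wordVal w * S.wordVal w' := by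
  simp [wordVal]

theorem wordVal_cons (s : S.Simple) (b : Bool) (w : S.Word) :
    S.wordVal ((s, b) :: w) = cond b s.1 s.1⁻¹ * S.wordVal w := rfl

@[simp] theorem wordVal_nil : S.wordVal [] = 1 := rfl

end

variable {G : Type u} [Group G] {S : GarsideStructure G} [Nontrivial G] {O : S.Oracle} {C : ℕ}

open State

/-- The square of the length times the cost of the basic operations, up to a constant. -/
noncomputable def quadCost (O : S.Oracle) (C n : ℕ) : ℕ := (n + 1) * linCost O C n

omit [Nontrivial G] in
theorem linCost_le_quadCost (O : S.Oracle) (C n : ℕ) : linCost O C n ≤ quadCost O C n :=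
  Nat.le_mul_of_pos_left _ (by omega)

omit [Nontrivial G] in
theorem quadCost_mul_le (O : S.Oracle) (C n : ℕ) {a : ℕ} (ha : 1 ≤ a) :
    quadCost O C (a * n) ≤ a ^ 2 * quadCost O C n := by
  have h : a * n + 1 ≤ a * (n + 1) := by rw [mul_add]; omega
  calc quadCost O C (a * n) = (a * n + 1) * (a * n + 1) * opCost O C := by
        rw [quadCost, linCost, mul_assoc]
    _ ≤ (a * (n + 1)) * (a * (n + 1)) * opCost O C :=
        Nat.mul_le_mul_right _ (Nat.mul_le_mul h h)
    _ = _ := by rw [quadCost, linCost]; ring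

/-- By uniqueness of the normal form it suffices to compare the exponents and then the factors one
by one; each list has at most `2n` of them. -/
theorem runs_sameNF (hC : 1 ≤ C) (σ : S.State) {x y : G} {n : ℕ} (hx : σ.HasLNF 0 x)
    (hy : σ.HasLNF 1 y) (hxn : S.Bounded n x) (hyn : S.Bounded n y) :
    Runs O C .sameNF σ (300 * linCost O C n) fun σ' => σ'.Answers (x = y) := by
  have hU := opCost_pos O hC
  have hUL := opCost_le_linCost O C n
  have hL := linCost_two_mul_le O C n
  have hnL := lt_linCost O hC n
  have hlx := lists_of_forall hx.1
  have hly := lists_of_forall hy.1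
  have hnx := (hx.2.le_of_bounded hxn).2.2
  have hny := (hy.2.le_of_bounded hyn).2.2
  have hiff : x = y ↔ σ.int 0 = σ.int 1 ∧
      (σ.word 0).map (fun t => t.1.1) = (σ.word 1).map (fun t => t.1.1) := by
    refine ⟨fun h => hx.2.unique (h ▸ hy.2), fun ⟨h1, h2⟩ => ?_⟩
    rw [hx.2.1, hy.2.1, h1, h2]
  rw [hiff]
  have hlenx := hlx.length_eq
  have hleny := hly.length_eq
  set l₁ := (σ.word 0).map (fun t => t.1.1) with hl₁
  set l₂ := (σ.word 1).map (fun t => t.1.1) with hl₂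
  set A : Prop := σ.int 0 = σ.int 1 ∧ l₁ = l₂ with hA
  let I : ℕ → S.State → Prop := fun k τ => τ.int 11 = 0 ∧ τ.int 12 = 1 ∧
    ((τ.int 10 = 0 ∧ τ.int 15 = 1 ∧ ∃ m₁ m₂, Lists (τ.word 10) m₁ ∧ Lists (τ.word 11) m₂ ∧
      (A ↔ m₁ = m₂) ∧ k = m₁.length + 1) ∨
    (τ.int 10 = 1 ∧ k = 0 ∧ (A → τ.int 15 = 1) ∧ (¬ A → τ.int 15 = 0)))
  -- The loop is entered either with equal exponents and both lists still to be compared, or with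
  -- the answer already known to be negative.
  suffices key : ∀ τ, I (l₁.length + 1) τ ∨ I 0 τ → Runs O C
      (.loop (.le 10 11) Prog.compareStep ⨟
      .instr (.add 0 15 11) ⨟ .skip) τ (270 * linCost O C n) fun σ' => σ'.Answers A by
    refine .step (.copyWord ..) <| .step (.copyWord ..) <| .step (.setInt ..) <|
      .step (.setInt ..) <| .step (.setInt ..) <| .step (.setInt ..) <|
      .branch (fun h => .assoc <| .branch (fun h' => .skip_comp <| .skip_comp <|
        (key _ (.inl ?_)).mono ?_ fun _ => id) fun h' => .assoc <| .step (.setInt ..) <|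
        .step (.setInt ..) <| .skip_comp <| (key _ (.inr ?_)).mono ?_ fun _ => id)
        fun h => .assoc <| .step (.setInt ..) <|
        .step (.setInt ..) <| (key _ (.inr ?_)).mono ?_ fun _ => id
    · simp [Holds] at h h'
      exact ⟨by simp, by simp, .inl ⟨by simp, by simp, l₁, l₂, by simpa using hlx,
        by simpa using hly, by simp [hA, le_antisymm h h'], rfl⟩⟩
    · simp; omega
    · simp [Holds] at h h'
      exact ⟨by simp, by simp, .inr ⟨by simp, rfl, fun h1 => by have := h1.1; omega, by simp⟩⟩
    · simp; omega
    · simp [Holds] at h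
      exact ⟨by simp, by simp, .inr ⟨by simp, rfl, fun h1 => by have := h1.1; omega, by simp⟩⟩
    · simp; omega
  have step : ∀ k τ, I k τ → Holds (.le 10 11) τ → Runs O C
        .compareStep τ (90 * opCost O C + 30) fun τ' => ∃ j < k, I j τ' := by
    rintro k τ ⟨h1, h2, h3⟩ hc
    rcases h3 with ⟨h3, h4, m₁, m₂, h5, h6, h7, h8⟩ | ⟨h3, -⟩
    swap
    · simp [Holds, h1, h3] at hc
    refine .branch (fun he => .assoc <| .step (.setInt ..) <| .assoc <| .branch (fun he' =>
        .skip_comp <| .skip_comp <| .skip (by omega) ?_) fun he' => .step (.setInt ..) <|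
        .skip_comp <| .skip (by omega) ?_) fun he => .assoc <| .branch (fun he' => .assoc <|
        .step (.setInt ..) <| .step (.setInt ..) <| .skip_comp <| .skip (by omega) ?_) fun he' => ?_
      <;> simp [Holds, h5.nil_iff] at he <;> simp [Holds, h6.nil_iff] at he'
    · exact ⟨0, by omega, by simp [h1], by simp [h2], .inr ⟨by simp, rfl, by simp [h4],
        fun hA => absurd (h7.2 (by rw [he, he'])) hA⟩⟩
    · exact ⟨0, by omega, by simp [h1], by simp [h2], .inr ⟨by simp, rfl,
        fun hA => absurd ((h7.1 hA).symm.trans he) he', by simp⟩⟩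
    · exact ⟨0, by omega, by simp [h1], by simp [h2], .inr ⟨by simp, rfl,
        fun hA => absurd ((h7.1 hA).trans he') he, by simp⟩⟩
    · obtain ⟨a, m₁, rfl⟩ := List.exists_cons_of_ne_nil he
      obtain ⟨b, m₂, rfl⟩ := List.exists_cons_of_ne_nil he'
      refine .assoc <| .popFront h5 fun s w hs hw => .assoc <| .popFront (by simpa using h6)
        fun s' w' hs' hw' => .assoc <| .step (.copySimple ..) <| .assoc <| .step (.copySimple ..) <|
        .assoc <| .call (runs_equal hC _) Prog.writesBelow_equal fun σ₁ h₁ f₁ => .assoc <|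
        .branch (fun hb => ?_) (fun hb => ?_) <;>
        simp [hs, hs'] at h₁ <;> simp [Holds, f₁.int, h2] at hb
      · refine .skip_comp <| .skip_comp <| .skip_comp <| .skip (by omega)
          ⟨m₁.length + 1, by simp [h8], by simp [f₁.int, h1], by simp [f₁.int, h2],
          .inl ⟨by simp [f₁.int, h3], by simp [f₁.int, h4], m₁, m₂, by simp [f₁.word, hw],
            by simp [f₁.word, hw'], ?_, rfl⟩⟩
        have hab : a = b := by
          by_contra hne
          have := h₁.2 hne
          omega
        rw [h7, hab]
        simp
      · refine .assoc <| .step (.setInt ..) <| .step (.setInt ..) <| .skip_comp <| .skip_comp <|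
          .skip (by omega) ⟨0, by omega, by simp [f₁.int, h1], by simp [f₁.int, h2],
          .inr ⟨by simp, rfl, fun hA => ?_, by simp⟩⟩
        have := h₁.1 (List.cons.inj (h7.1 hA)).1
        omega
  have hcost : (l₁.length + 1) * (90 * opCost O C + 30) ≤ 240 * linCost O C n := by
    have h1 := mul_add_le_linCost O hC l₁.length 90 30
    have h2 := linCost_mono O C hnx
    omega
  intro τ hτ
  have hloop : Runs O C (.loop (.le 10 11) .compareStep) τ (240 * linCost O C n + 2)
      fun τ' => (∃ j, I j τ') ∧ ¬ Holds (.le 10 11) τ' := by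
    rcases hτ with hτ | hτ
    · exact (Runs.loop I _ _ step hτ).mono (by omega) fun _ => id
    · exact (Runs.loop I _ _ step hτ).mono (by omega) fun _ => id
  refine .comp hloop fun τ' h => .step (.add ..) <| .skip (by omega) ?_
  obtain ⟨⟨k, h1, h2, h3⟩, h4⟩ := h
  rcases h3 with ⟨h3, -⟩ | ⟨-, -, h5, h6⟩
  · simp [Holds, h1, h3] at h4
  · exact ⟨fun h => by simp [h5 h, h1], fun h => by simp [h6 h, h1]⟩

/-- Each letter costs one multiplication or division of a normal form. The bound on the intermediate
product grows by one per letter and never exceeds `n`, so the total is `n` times a linear cost. -/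
theorem runs_absorbWord (hC : 1 ≤ C) (σ : S.State) {v : G} {m n : ℕ} (hv : σ.HasNF v)
    (hm : S.Bounded m v) (hn : m + (σ.word 20).length ≤ n) :
    Runs O C .absorbWord σ (2100 * quadCost O C n) fun σ' =>
      σ'.HasNF (v * S.wordVal (σ.word 20)) := by
  have hUL := opCost_le_linCost O C n
  have hU := opCost_pos O hC
  set N := (σ.word 20).length with hN
  let I : ℕ → S.State → Prop := fun k τ => (τ.word 20).length = k ∧ ∃ u, τ.HasNF u ∧
    S.Bounded (m + (N - k)) u ∧ u * S.wordVal (τ.word 20) = v * S.wordVal (σ.word 20)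
  refine (Runs.whileNonempty (n := N) (m := 2050 * linCost O C n) (by decide) I
    (fun _ _ h => h.1) (fun _ _ _ h => by simpa [I, HasNF] using h)
    (fun _ _ _ h => by simpa [I, HasNF] using h) ?_ ?_).mono ?_ fun τ h => ?_
  · rintro k τ ⟨h1, u, ⟨l, h2, h3⟩, h4, h5⟩ hk hf hz
    obtain ⟨⟨s, b⟩, w, hw⟩ := List.exists_cons_of_length_eq_add_one h1
    have hb : S.Bounded n u := h4.mono (by omega)
    have hk' : m + (N - (k + 1)) + 1 = m + (N - k) := by omega
    rw [hw, wordVal_cons, ← mul_assoc] at h5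
    refine .step (.popFront _ _ _ _ s b w hw) <| .branch (fun hc => .call (runs_normDiv hC _ (x := u)
      ⟨l, by simpa using h2, by simpa using h3⟩ hb) Prog.writesBelow_normDiv fun σ₁ h₁ f₁ =>
      .skip (by omega) ?_) (fun hc => .call (runs_normMul hC _ (x := u)
      ⟨l, by simpa using h2, by simpa using h3⟩ hb) Prog.writesBelow_normMul fun σ₁ h₁ f₁ =>
      .skip (by omega) ?_)
    · have hb : b = false := by
        cases b
        · rfl
        · simp [Holds, hz] at hc
      subst hb
      simp at h₁
      refine ⟨⟨?_, _, h₁, ?_, ?_⟩, by simp [f₁.int, hf], by simp [f₁.int, hz]⟩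
      · rw [hw] at h1
        simpa [f₁.word] using h1
      · exact hk' ▸ h4.mul_simple_inv s.2
      · simpa [f₁.word] using h5
    · have hb : b = true := by
        cases b
        · simp [Holds, hz] at hc
        · rfl
      subst hb
      simp at h₁
      refine ⟨⟨?_, _, h₁, ?_, ?_⟩, by simp [f₁.int, hf], by simp [f₁.int, hz]⟩
      · rw [hw] at h1
        simpa [f₁.word] using h1
      · exact hk' ▸ h4.mul_simple s.2
      · simpa [f₁.word] using h5
  · exact ⟨rfl, v, hv, by simpa using hm, rfl⟩
  · have h1 : (N + 1) * (2050 * linCost O C n + 10) ≤ (n + 1) * (2100 * linCost O C n) :=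
      Nat.mul_le_mul (by omega) (by omega)
    refine h1.trans (le_of_eq ?_)
    rw [quadCost]; ring
  · obtain ⟨h1, u, h2, -, h3⟩ := h
    rw [List.length_eq_zero_iff] at h1
    rw [h1, wordVal_nil, mul_one] at h3
    rwa [← h3]

theorem runs_invertWord (hC : 1 ≤ C) (σ : S.State) {n : ℕ} (hn : (σ.word 20).length ≤ n) :
    Runs O C .invertWord σ (30 * linCost O C n) fun σ' =>
      S.wordVal (σ'.word 23) = (S.wordVal (σ.word 20))⁻¹ ∧
      (σ'.word 23).length = (σ.word 20).length := by
  have hU := opCost_pos O hC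
  have hUL := opCost_le_linCost O C n
  let I : ℕ → S.State → Prop := fun k τ => (τ.word 20).length = k ∧
    (S.wordVal (τ.word 20))⁻¹ * S.wordVal (τ.word 23) = (S.wordVal (σ.word 20))⁻¹ ∧
    (τ.word 23).length + k = (σ.word 20).length
  refine .step (.clear ..) <| .comp ((Runs.whileNonempty (n := (σ.word 20).length) (m := 10)
    (by decide) I (fun _ _ h => h.1) (fun _ _ _ h => h) (fun _ _ _ h => h) ?_ ?_).mono
    (c := 20 * linCost O C n) ?_ fun _ => id) fun τ h => .skip (by omega) ?_
  · rintro k τ ⟨h1, h2, h3⟩ hk hf hz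
    obtain ⟨⟨s, b⟩, w, hw⟩ := List.exists_cons_of_length_eq_add_one h1
    rw [hw, wordVal_cons] at h2
    rw [hw] at h1
    simp at h1
    refine .step (.popFront _ _ _ _ s b w hw) <| .branch (fun hc => .step (.pushFront ..) <|
      .skip (by omega) ?_) (fun hc => .step (.pushFront ..) <| .skip (by omega) ?_)
    · have hb : b = false := by
        cases b
        · rfl
        · simp [Holds, hz] at hc
      subst hb
      refine ⟨⟨by simpa using h1, ?_, by simp; omega⟩, by simp [hf], by simp [hz]⟩
      rw [← h2]
      simp [wordVal_cons, mul_assoc]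
    · have hb : b = true := by
        cases b
        · simp [Holds, hz] at hc
        · rfl
      subst hb
      refine ⟨⟨by simpa using h1, ?_, by simp; omega⟩, by simp [hf], by simp [hz]⟩
      rw [← h2]
      simp [wordVal_cons, mul_assoc]
  · exact ⟨by simp, by simp, by simp⟩
  · have h1 : ((σ.word 20).length + 1) * (10 + 10) ≤ (n + 1) * (20 * opCost O C) :=
      Nat.mul_le_mul (by omega) (by omega)
    refine h1.trans (le_of_eq ?_)
    rw [linCost]; ring
  · obtain ⟨h1, h2, h3⟩ := h
    rw [List.length_eq_zero_iff] at h1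
    rw [h1] at h2
    exact ⟨by simpa using h2, h3⟩

theorem runs_normalize (hC : 1 ≤ C) (σ : S.State) {n : ℕ}
    (hn : (σ.word 24).length + (σ.word 25).length + (σ.word 26).length ≤ n) :
    Runs O C .normalize σ (7000 * quadCost O C n) fun σ' =>
      σ'.HasNF (S.wordVal (σ.word 24) * S.wordVal (σ.word 25) * S.wordVal (σ.word 26)) := by
  have hU := opCost_pos O hC
  have hUL := opCost_le_linCost O C n
  have hLQ := linCost_le_quadCost O C n
  have hnL := lt_linCost O hC n
  refine .step (.clear ..) <| .step (.setInt ..) <| .step (.copyWord ..) <|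
    .call (runs_absorbWord hC _ (v := 1) (m := 0) (n := n) ?_ bounded_one ?_)
    Prog.writesBelow_absorbWord fun σ₁ h₁ f₁ => .step (.copyWord ..) <|
    .call (runs_absorbWord hC _ (v := S.wordVal (σ.word 24)) (m := (σ.word 24).length) (n := n)
    ?_ (bounded_wordVal _) ?_)
    Prog.writesBelow_absorbWord fun σ₂ h₂ f₂ => .step (.copyWord ..) <|
    .call (runs_absorbWord hC _ (v := S.wordVal (σ.word 24) * S.wordVal (σ.word 25))
    (m := (σ.word 24).length + (σ.word 25).length) (n := n)
    ?_ ?_ ?_)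
    Prog.writesBelow_absorbWord fun σ₃ h₃ f₃ => .skip ?_ ?_
  · exact ⟨[], by simp [lists_nil], by simp [IsLeftNormalForm]⟩
  · simp; omega
  · simpa [HasNF] using h₁
  · simp [f₁.word]; omega
  · simpa [HasNF, f₁.word] using h₂
  · rw [← wordVal_append, ← List.length_append]
    exact bounded_wordVal _
  · simpa [f₁.word, f₂.word] using hn
  · simp [f₁.word, f₂.word]; omega
  · simpa [f₁.word, f₂.word] using h₃

theorem runs_normWord (hC : 1 ≤ C) (σ : S.State) {n : ℕ} (hn : (σ.word 30).length ≤ n) :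
    Runs O C .normWord σ (7100 * quadCost O C n) fun σ' =>
      σ'.HasNF (S.wordVal (σ.word 30)) := by
  have hU := opCost_pos O hC
  have hUL := opCost_le_linCost O C n
  have hLQ := linCost_le_quadCost O C n
  have hnL := lt_linCost O hC n
  refine .step (.copyWord ..) <| .step (.clear ..) <| .step (.clear ..) <|
    .comp (runs_normalize hC _ (n := n) (by simpa using hn)) fun σ₁ h₁ => .skip (by omega) ?_
  simpa using h₁

theorem runs_normConjWord (hC : 1 ≤ C) (σ : S.State) {n : ℕ} (h0 : (σ.word 30).length ≤ n)
    (h1 : (σ.word 31).length ≤ n) :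
    Runs O C .normConjWord σ (70000 * quadCost O C n) fun σ' =>
      σ'.HasNF (conj (S.wordVal (σ.word 30)) (S.wordVal (σ.word 31))) := by
  have hU := opCost_pos O hC
  have hUL := opCost_le_linCost O C n
  have hLQ := linCost_le_quadCost O C n
  have hQ := quadCost_mul_le O C n (a := 3) (by omega)
  have hnL := lt_linCost O hC n
  refine .step (.copyWord ..) <| .call (runs_invertWord hC _ (n := n) (by simpa using h1))
    Prog.writesBelow_invertWord fun σ₁ h₁ f₁ => .step (.copyWord ..) <| .step (.copyWord ..) <|
    .step (.copyWord ..) <|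
    .comp (runs_normalize hC _ (n := 3 * n) ?_) fun σ₂ h₂ => .skip ?_ ?_
  all_goals simp at h₁
  · simp [f₁.word, h₁]; omega
  · simp [f₁.word, h₁]; omega
  · simpa [f₁.word, h₁, conj] using h₂

theorem runs_normConjInvWord (hC : 1 ≤ C) (σ : S.State) {n : ℕ} (h0 : (σ.word 30).length ≤ n)
    (h1 : (σ.word 31).length ≤ n) :
    Runs O C .normConjInvWord σ (70000 * quadCost O C n) fun σ' =>
      σ'.HasNF (conj (S.wordVal (σ.word 30)) (S.wordVal (σ.word 31))⁻¹) := by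
  have hU := opCost_pos O hC
  have hUL := opCost_le_linCost O C n
  have hLQ := linCost_le_quadCost O C n
  have hQ := quadCost_mul_le O C n (a := 3) (by omega)
  have hnL := lt_linCost O hC n
  refine .step (.copyWord ..) <| .call (runs_invertWord hC _ (n := n) (by simpa using h1))
    Prog.writesBelow_invertWord fun σ₁ h₁ f₁ => .step (.copyWord ..) <| .step (.copyWord ..) <|
    .step (.copyWord ..) <|
    .comp (runs_normalize hC _ (n := 3 * n) ?_) fun σ₂ h₂ => .skip ?_ ?_
  all_goals simp at h₁
  · simp [f₁.word, h₁]; omega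
  · simp [f₁.word, h₁]; omega
  · simpa [f₁.word, h₁, conj] using h₂

/-- With `Δᵖ x₁⋯xᵣ` the normal form of `x⁻¹y` and `N = max(-p, 0)`, the gcd is `x Δ⁻ᴺ` times the
first `N` factors. It is output in this form, as a word and not as a normal form. -/
theorem runs_gcdWord (hC : 1 ≤ C) (σ : S.State) {n : ℕ} (h0 : (σ.word 30).length ≤ n)
    (h1 : (σ.word 31).length ≤ n) :
    Runs O C .gcdWord σ (40000 * quadCost O C n) fun σ' =>
      S.wordVal (σ'.word 30) =
        S.leftGcd (S.wordVal (σ.word 30)) (S.wordVal (σ.word 31)) ∧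
      (σ'.word 30).length ≤ 5 * n := by
  have hU := opCost_pos O hC
  have hUL := opCost_le_linCost O C n
  have hLQ := linCost_le_quadCost O C n
  have hQ := quadCost_mul_le O C n (a := 2) (by omega)
  have hL := linCost_two_mul_le O C n
  have hnL := lt_linCost O hC n
  set x := S.wordVal (σ.word 30) with hx
  set y := S.wordVal (σ.word 31) with hy
  refine .step (.copyWord ..) <| .call (runs_invertWord hC _ (n := n) (by simpa using h0))
    Prog.writesBelow_invertWord fun σ₁ h₁ f₁ => .step (.copyWord ..) <| .step (.copyWord ..) <|
    .step (.clear ..) <|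
    .call (runs_normalize hC _ (n := 2 * n) ?_) Prog.writesBelow_normalize fun σ₂ h₂ f₂ => ?_ <;>
    simp at h₁
  · simp [f₁.word, h₁]; omega
  simp [f₁.word, h₁, ← hx, ← hy] at h₂
  obtain ⟨l, h3, h4⟩ := h₂
  have hb : S.Bounded (2 * n) (x⁻¹ * y) := by
    have h5 := bounded_wordVal ((σ₁.word 23) ++ σ.word 31)
    rw [wordVal_append, h₁.1, ← hx, ← hy] at h5
    exact h5.mono (by simp [h₁]; omega)
  obtain ⟨h5, h6, -⟩ := h4.le_of_bounded hb
  have hgcd : S.leftGcd x y =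
      x * (S.Δ ^ (min (σ₂.int 15) 0) * (l.take (-σ₂.int 15).toNat).prod) := by
    rw [← h4.one_gcd, mul_gcd]; simp
  set p := σ₂.int 15 with hp
  set N := (-p).toNat with hN
  -- The output consists of the word for `x`, `N` letters `Δ⁻¹` and at most `N` factors, hence of at
  -- most `5n` letters.
  have hNn : N ≤ 2 * n := by omega
  have hpN : S.Δ ^ (min p 0) = (S.Δ ^ N)⁻¹ := by
    rw [← zpow_natCast, ← zpow_neg]; congr 1; omega
  refine .step (.setInt ..) <| .step (.sub ..) <| .step (.add ..) <|
    .step (.delta _ _ S.deltaSimple rfl) <|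
    .comp ((Runs.iterate (n := N) (by decide) (m := 5)
      (fun k τ => S.wordVal (τ.word 30) * (S.Δ ^ k)⁻¹ = x * (S.Δ ^ N)⁻¹ ∧
        (τ.word 30).length + k ≤ n + N ∧ (τ.simp 30).1 = S.Δ ∧ τ.word 10 = σ₂.word 10 ∧
        τ.int 32 = -p)
      (fun _ _ _ h => by simpa using h) (fun _ _ _ h => by simpa using h) (fun k τ h => ?_) ?_ ?_).mono (m := _)
      (c := 40 * linCost O C n) ?_ fun _ => id) fun σ₃ h7 =>
    .comp ((Runs.iterate (n := N) (by decide) (m := 10)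
      (fun k τ => ∃ m, Lists (τ.word 10) m ∧ S.wordVal (τ.word 30) * (m.take k).prod =
          x * (S.Δ ^ N)⁻¹ * (l.take N).prod ∧ (τ.word 30).length + k ≤ n + N + N)
      (fun _ _ _ h => h) (fun _ _ _ h => h) (fun k τ h => ?_) ?_ ?_).mono (m := _)
      (c := 60 * linCost O C n) ?_ fun _ => id) fun σ₄ h8 => .skip ?_ ?_
  · obtain ⟨h7, h8, h9, h10, h11⟩ := h
    refine .step (.pushBack ..) <| .skip (by omega) ⟨⟨?_, ?_, ?_, ?_, ?_⟩, ?_, ?_⟩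
    · rw [← h7, pow_succ]
      simp [wordVal_append, wordVal_cons, h9, mul_assoc]
    · simp; omega
    · simpa using h9
    · simpa using h10
    · simpa using h11
    · simp
    · simp
  · simp [hN, ← hp]
  · refine ⟨?_, ?_, by simp, by simp, by simp [← hp]⟩
    · simp [f₂.word, f₁.word, hx]
    · simp [f₂.word, f₁.word]; omega
  · have h9 : (N + 1) * (5 + 10) ≤ (2 * n + 1) * (15 * opCost O C) :=
      Nat.mul_le_mul (by omega) (by omega)
    have h10 : (2 * n + 1) * (15 * opCost O C) = 15 * linCost O C (2 * n) := by
      rw [linCost]; ring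
    omega
  -- There may be fewer than `N` factors; the remaining iterations then find the list empty and do
  -- nothing, in accordance with `List.take`.
  · obtain ⟨m, h9, h10, h11⟩ := h
    refine .branch (fun he => .skip_comp <| .skip (by omega) ⟨⟨m, h9, ?_, by omega⟩, rfl, rfl⟩)
      fun he => ?_ <;> rw [Holds, h9.nil_iff] at he
    · subst he
      simpa using h10
    · obtain ⟨a, m, rfl⟩ := List.exists_cons_of_ne_nil he
      refine .assoc <| .popFront h9 fun s w hs hw => .step (.pushBack ..) <| .skip (by omega)
        ⟨⟨m, by simpa using hw, ?_, by simp; omega⟩, by simp, by simp⟩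
      rw [← h10]
      simp [wordVal_append, wordVal_cons, hs, mul_assoc]
  · simp [h7.1.2.2.2.2, hN]
  · obtain ⟨⟨h9, h10, -, h11, -⟩, -⟩ := h7
    refine ⟨l, by rwa [h11], ?_, by omega⟩
    rw [← h9]; simp
  · have h9 : (N + 1) * (10 + 10) ≤ (2 * n + 1) * (20 * opCost O C) :=
      Nat.mul_le_mul (by omega) (by omega)
    have h10 : (2 * n + 1) * (20 * opCost O C) = 20 * linCost O C (2 * n) := by
      rw [linCost]; ring
    omega
  · simp [f₁.word, h₁]; omega
  · obtain ⟨⟨m, -, h9, h10⟩, -⟩ := h8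
    refine ⟨?_, by omega⟩
    rw [hgcd, hpN, ← mul_assoc, ← h9]; simp

theorem runs_rightGcdWord (hC : 1 ≤ C) (σ : S.State) {n : ℕ} (h0 : (σ.word 30).length ≤ n)
    (h1 : (σ.word 31).length ≤ n) :
    Runs O C Prog.gcdWord.mirror σ (40000 * quadCost O C n) fun σ' =>
      S.wordVal (σ'.word 30) =
        S.rightGcd (S.wordVal (σ.word 30)) (S.wordVal (σ.word 31)) ∧
      (σ'.word 30).length ≤ 5 * n := by
  have h := (runs_gcdWord (O := O.op) hC σ.op (n := n) (by simpa [Word.op] using h0)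
    (by simpa [Word.op] using h1)).mirror
  rw [quadCost, linCost, opCost_op] at h
  refine h.mono le_rfl fun σ' h => ?_
  simp only [State.op_word, wordVal_op, leftGcd_op, MulOpposite.op_inj] at h
  simpa [Word.op] using h

/-- Inversion turns prefixes into suffixes and reverses the order, so the left lcm is the inverse of
the right gcd of the inverses. -/
theorem runs_lcmWord (hC : 1 ≤ C) (σ : S.State) {n : ℕ} (h0 : (σ.word 30).length ≤ n)
    (h1 : (σ.word 31).length ≤ n) :
    Runs O C .lcmWord σ (50000 * quadCost O C n) fun σ' =>
      S.wordVal (σ'.word 30) =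
        S.leftLcm (S.wordVal (σ.word 30)) (S.wordVal (σ.word 31)) ∧
      (σ'.word 30).length ≤ 5 * n := by
  have hU := opCost_pos O hC
  have hUL := opCost_le_linCost O C n
  have hLQ := linCost_le_quadCost O C n
  have hL : linCost O C (5 * n) ≤ 5 * linCost O C n := by
    rw [linCost, linCost, ← mul_assoc]
    exact Nat.mul_le_mul_right _ (by omega)
  have hnL := lt_linCost O hC n
  refine .step (.copyWord ..) <| .call (runs_invertWord hC _ (n := n) (by simpa using h0))
    Prog.writesBelow_invertWord fun σ₁ h₁ f₁ => .step (.copyWord ..) <| .step (.copyWord ..) <|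
    .call (runs_invertWord hC _ (n := n) (by simpa [f₁.word] using h1))
    Prog.writesBelow_invertWord fun σ₂ h₂ f₂ => .step (.copyWord ..) <|
    .comp (runs_rightGcdWord hC _ (n := n) ?_ ?_) fun σ₃ h₃ => .step (.copyWord ..) <|
    .comp (runs_invertWord hC _ (n := 5 * n) (by simpa using h₃.2)) fun σ₄ h₄ =>
    .step (.copyWord ..) <| .skip ?_ ?_
  all_goals simp at h₁
  all_goals simp [f₁.word] at h₂
  · simpa [f₂.word, h₁] using h0
  · simpa [h₂] using h1
  · simp [f₁.word, f₂.word, h₁, h₂] at h₃ h₄ ⊢; omega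
  · simp [f₁.word, f₂.word, h₁, h₂] at h₃ h₄ ⊢
    rw [h₄.1, h₃.1, leftLcm_eq_inv, h₄.2]
    exact ⟨rfl, h₃.2⟩

end GarsideStructure

/-! ### Transport and pullback -/

namespace Prog

/-- Apply a program for normal forms to the left normal form and to the simple element in the
registers `0`. -/
def onNF (p : Prog) : Prog :=
  .instr (.copySimple 15 0) ⨟ .instr (.copyWord 10 0) ⨟ .instr (.setInt 11 0) ⨟
  .instr (.add 15 0 11) ⨟ p

/-- Copy the left normal form from the registers `10` and `15` to the registers `0`. -/
def storeNF : Prog :=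
  .instr (.copyWord 0 10) ⨟ .instr (.setInt 11 0) ⨟ .instr (.add 0 15 11) ⨟ .skip

def transport : Prog :=
  .instr (.copySimple 20 0) ⨟ onNF (prefPrefix ⨟ .instr (.copySimple 21 0) ⨟
    .instr (.copySimple 15 20) ⨟ normConj ⨟ prefPrefix ⨟ .instr (.clear 0) ⨟
    .instr (.pushBack 0 21 false) ⨟ .instr (.pushBack 0 20 true) ⨟ .instr (.pushBack 0 0 true) ⨟
    .skip)

def prefConjInv : Prog := onNF (normConjInv ⨟ prefPrefix ⨟ .skip)

/-- Builds the word `𝔭(z) s 𝔭ᴿ(xˢ)⁻¹` and takes its lcm with the empty word. The right normal form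
of `x` serves for `𝔭ᴿ(xˢ)` and the left normal form of `z` for `𝔭(z)`. -/
def pullback : Prog :=
  .instr (.copyWord 31 1) ⨟ .instr (.setInt 10 0) ⨟ .instr (.add 31 1 10) ⨟
  .instr (.copySimple 36 0) ⨟ prefConjInv.mirror ⨟ .instr (.copySimple 35 0) ⨟
  .instr (.copyWord 10 31) ⨟ .instr (.setInt 11 0) ⨟ .instr (.add 15 31 11) ⨟ prefPrefix ⨟
  .instr (.clear 30) ⨟ .instr (.pushBack 30 0 true) ⨟ .instr (.pushBack 30 36 true) ⨟
  .instr (.pushBack 30 35 false) ⨟ .instr (.clear 31) ⨟ lcmWord ⨟ .instr (.copyWord 0 30) ⨟ .skip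

def transportWord : Prog :=
  .instr (.copyWord 30 0) ⨟ .instr (.copyWord 31 1) ⨟ normWord ⨟ prefPrefix ⨟
  .instr (.copySimple 32 0) ⨟ normConjWord ⨟ prefPrefix ⨟ .instr (.copyWord 0 31) ⨟
  .instr (.pushFront 0 32 false) ⨟ .instr (.pushBack 0 0 true) ⨟ .skip

def prefConjInvWord : Prog := normConjInvWord ⨟ prefPrefix ⨟ .skip

def pullbackWord : Prog :=
  .instr (.copyWord 33 0) ⨟ .instr (.copyWord 34 1) ⨟ .instr (.copyWord 30 2) ⨟ normWord ⨟
  prefPrefix ⨟ .instr (.copySimple 36 0) ⨟ .instr (.copyWord 30 33) ⨟ .instr (.copyWord 31 34) ⨟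
  prefConjInvWord.mirror ⨟ .instr (.copyWord 30 34) ⨟ .instr (.pushFront 30 36 true) ⨟
  .instr (.pushBack 30 0 false) ⨟ .instr (.clear 31) ⨟ lcmWord ⨟ .instr (.copyWord 0 30) ⨟ .skip

theorem writesBelow_prefConjInv : prefConjInv.mirror.writesBelow 17 = true := rfl
theorem writesBelow_prefConjInvWord : prefConjInvWord.mirror.writesBelow 27 = true := rfl

end Prog

/-! ### Correctness and cost of transport and pullback -/

namespace GarsideStructure

variable {G : Type u} [Group G] {S : GarsideStructure G} {O : S.Oracle} {C : ℕ}

open State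

/-- Both elements lie on the same sliding circuit, hence in the super summit set, and have equal
`inf` and `sup`. So the length of `z` need not be assumed when its normal form is given. -/
theorem Bounded.of_mem_SC {x z : G} {n : ℕ} [Nontrivial G] (hx : S.Bounded n x) (hz : z ∈ S.SC x)
    (h : S.slide z = x) : S.Bounded n z := by
  have h1 := S.mem_SSS_of_mem_SC hz
  have h2 : x ∈ S.SSS x := by
    refine S.mem_SSS_of_mem_SC ⟨IsConj.refl x, ?_⟩
    obtain ⟨-, m, hm, h3⟩ := hz
    refine ⟨m, hm, ?_⟩
    rw [← h, ← Function.iterate_succ_apply, Function.iterate_succ_apply', h3]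
  rw [Bounded, S.inf_eq_of_mem_SSS h1 h2, S.sup_eq_of_mem_SSS h1 h2]
  exact hx

theorem State.HasLNF.lists {σ : S.State} {i : ℕ} {x : G} (h : σ.HasLNF i x) :
    ∃ l, Lists (σ.word i) l ∧ S.IsLeftNormalForm (σ.int i) l x :=
  ⟨_, lists_of_forall h.1, h.2⟩

theorem exists_wordVal_inv (w : S.Word) :
    ∃ w' : S.Word, w'.length = w.length ∧ S.wordVal w' = (S.wordVal w)⁻¹ := by
  induction w with
  | nil => exact ⟨[], rfl, by simp⟩
  | cons t w ih =>
    rcases t with ⟨s, b⟩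
    obtain ⟨w', h1, h2⟩ := ih
    refine ⟨w' ++ [(s, !b)], by simp [h1], ?_⟩
    cases b <;> simp [wordVal_append, wordVal_cons, h2]

variable [Nontrivial G]

theorem Bounded.conj {n : ℕ} {x s : G} (h : S.Bounded n x) (hs : S.IsSimple s) :
    S.Bounded (n + 2) (conj x s) := by
  have := (h.simple_inv_mul hs).mul_simple hs
  exact this

theorem Bounded.conj_inv {n : ℕ} {x s : G} (h : S.Bounded n x) (hs : S.IsSimple s) :
    S.Bounded (n + 2) (GarsideStructure.conj x s⁻¹) := by
  have := (h.simple_mul hs).mul_simple_inv hs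
  simpa [GarsideStructure.conj] using this

theorem bounded_conj_wordVal {w v : S.Word} {n : ℕ} (hw : w.length ≤ n) (hv : v.length ≤ n) :
    S.Bounded (3 * n) (GarsideStructure.conj (S.wordVal w) (S.wordVal v)) := by
  obtain ⟨v', h1, h2⟩ := exists_wordVal_inv v
  have h3 := bounded_wordVal (v' ++ w ++ v)
  rw [wordVal_append, wordVal_append, h2] at h3
  exact h3.mono (by simp; omega)

theorem bounded_conj_inv_wordVal {w v : S.Word} {n : ℕ} (hw : w.length ≤ n) (hv : v.length ≤ n) :
    S.Bounded (3 * n) (GarsideStructure.conj (S.wordVal w) (S.wordVal v)⁻¹) := by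
  obtain ⟨v', h1, h2⟩ := exists_wordVal_inv v
  rw [← h2]
  exact bounded_conj_wordVal hw (by omega)

omit [Nontrivial G] in
theorem linCost_mul_le (O : S.Oracle) (C n : ℕ) {a : ℕ} (ha : 1 ≤ a) :
    linCost O C (a * n) ≤ a * linCost O C n := by
  rw [linCost, linCost, ← mul_assoc]
  exact Nat.mul_le_mul_right _ (by rw [mul_add]; omega)

omit [Nontrivial G] in
theorem linCost_add_two_le (O : S.Oracle) (C n : ℕ) :
    linCost O C (n + 2) ≤ 3 * linCost O C n := by
  have : linCost O C (n + 2) = linCost O C (n + 1) + opCost O C := linCost_succ O C (n + 1)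
  have := linCost_succ O C n
  have := opCost_le_linCost O C n
  omega

/-- The condition on the registers from `16` onwards lets a caller keep its own simple elements
there while the input is copied to the working registers. -/
theorem runs_onNF {p : Prog} {K : ℕ} {Q : S.State → Prop} (hC : 1 ≤ C) (σ : S.State) {x : G}
    {n : ℕ} (hx : σ.HasLNF 0 x) (hn : S.Bounded n x)
    (hp : ∀ τ : S.State, τ.HasNF x → (τ.simp 15) = σ.simp 0 →
      (∀ i, 16 ≤ i → τ.simp i = σ.simp i) → Runs O C p τ (K * linCost O C n) Q) :
    Runs O C (.onNF p) σ ((K + 10) * linCost O C n) Q := by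
  have hU := opCost_pos O hC
  have hUL := opCost_le_linCost O C n
  have hnL := lt_linCost O hC n
  obtain ⟨l, h1, h2⟩ := hx.lists
  have h3 := h1.length_eq
  have h4 := (h2.le_of_bounded hn).2.2
  refine .step (.copySimple ..) <| .step (.copyWord ..) <| .step (.setInt ..) <|
    .step (.add ..) <| (hp _ ⟨l, by simpa using h1, by simpa using h2⟩ (by simp) ?_).mono ?_
    fun _ => id
  · intro i hi
    simp; omega
  · simp [add_mul]; omega

theorem runs_storeNF (hC : 1 ≤ C) (σ : S.State) {x : G} {n : ℕ} (hx : σ.HasNF x)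
    (hn : S.Bounded n x) :
    Runs O C .storeNF σ (10 * linCost O C n) fun σ' => σ'.HasLNF 0 x := by
  have hU := opCost_pos O hC
  have hUL := opCost_le_linCost O C n
  have hnL := lt_linCost O hC n
  obtain ⟨l, h1, h2⟩ := hx
  have h3 := h1.length_eq
  have h4 := (h2.le_of_bounded hn).2.2
  refine .step (.copyWord ..) <| .step (.setInt ..) <| .step (.add ..) <| .skip (by omega) ⟨?_, ?_⟩
  · simpa using h1.forall_eq_true
  · simpa [h1.map_eq] using h2

theorem runs_transport (hC : 1 ≤ C) (σ : S.State) {x : G} {n : ℕ} (hx : σ.HasLNF 0 x)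
    (hn : S.Bounded n x) :
    Runs O C .transport σ (20000 * linCost O C n) fun σ' =>
      σ'.HasElt 0 (S.transport x (σ.simp 0).1) := by
  have hU := opCost_pos O hC
  have hUL := opCost_le_linCost O C n
  have hL := linCost_add_two_le O C n
  refine .step (.copySimple ..) <| Runs.mono (c := 20000 * linCost O C n - 1) (runs_onNF (O := O) (K := 15000) hC _ (x := x) (n := n) hx hn
    fun τ h1 h2 h3 => .call (runs_prefPrefix hC _ h1 hn) Prog.writesBelow_prefPrefix
    fun σ₁ h₁ f₁ => .step (.copySimple ..) <| .step (.copySimple ..) <|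
    .call (runs_normConj hC _ (x := x) (by simpa [HasNF] using h₁.2) hn) Prog.writesBelow_normConj
    fun σ₂ h₂ f₂ => .call (runs_prefPrefix hC _ h₂ (hn.conj (Subtype.property _)))
    Prog.writesBelow_prefPrefix fun σ₃ h₃ f₃ => .step (.clear ..) <|
    .step (.pushBack ..) <| .step (.pushBack ..) <| .step (.pushBack ..) <|
    .skip (by omega) ?_) (by omega) fun _ => id
  simp at h3
  have h4 := h3 20 (by omega)
  simp at h4
  simp [f₁.simp, h4] at h₃
  simp [HasElt, wordVal_cons, f₃.simp, f₂.simp, f₁.simp, h4, h₁.1, h₃.1, GarsideStructure.transport,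
    mul_assoc]

theorem runs_prefConjInv (hC : 1 ≤ C) (σ : S.State) {x : G} {n : ℕ} (hx : σ.HasLNF 0 x)
    (hn : S.Bounded n x) :
    Runs O C .prefConjInv σ (10000 * linCost O C n) fun σ' =>
      (σ'.simp 0).1 = S.prefPrefix (conj x (σ.simp 0).1⁻¹) := by
  have hU := opCost_pos O hC
  have hUL := opCost_le_linCost O C n
  have hL := linCost_add_two_le O C n
  refine (runs_onNF (O := O) (K := 9900) hC _ (x := x) (n := n) hx hn
    fun τ h1 h2 h3 => .comp (runs_normConjInv hC _ h1 hn) fun σ₁ h₁ =>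
    .comp (runs_prefPrefix hC _ h₁ (hn.conj_inv (Subtype.property _))) fun σ₂ h₂ =>
    .skip (by omega) ?_).mono (by omega) fun _ => id
  rw [h₂.1, h2]

/-- Conjugation by `s⁻¹` in the opposite group is conjugation by `s` in the group itself, so the
mirrored program computes exactly the factor `𝔭ᴿ(xˢ)` of the pullback formula. -/
theorem runs_prefConjInv_mirror (hC : 1 ≤ C) (σ : S.State) {x : G} {n : ℕ} (hx : σ.HasRNF 0 x)
    (hn : S.HasLengthAtMost n x) :
    Runs O C Prog.prefConjInv.mirror σ (10000 * linCost O C n) fun σ' =>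
      (σ'.simp 0).1 = S.prefSuffix (conj x (σ.simp 0).1) := by
  have h := (runs_prefConjInv (O := O.op) hC σ.op ((hasLNF_op_iff ..).2 hx)
    (hasLengthAtMost_op hn).bounded).mirror
  rw [linCost, opCost_op] at h
  refine h.mono le_rfl fun σ' h => ?_
  simpa [conj_op, prefPrefix_op, ← MulOpposite.op_inv] using h

theorem runs_pullback (hC : 1 ≤ C) (σ : S.State) {x z : G} {n : ℕ} (hx : σ.HasRNF 0 x)
    (hz : σ.HasLNF 1 z) (hn : S.HasLengthAtMost n x) (hzn : S.Bounded n z) :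
    Runs O C .pullback σ (1000000 * linCost O C n) fun σ' =>
      σ'.HasElt 0 (S.leftLcm (S.prefPrefix z * (σ.simp 0).1 *
        (S.prefSuffix (conj x (σ.simp 0).1))⁻¹) 1) := by
  have hU := opCost_pos O hC
  have hUL := opCost_le_linCost O C n
  have hnL := lt_linCost O hC n
  -- The lcm is taken of a word with three letters, so its quadratic cost is a constant multiple of
  -- `opCost`.
  have hQ : quadCost O C 3 = 16 * opCost O C := by rw [quadCost, linCost]; ring
  obtain ⟨l, h1, h2⟩ := hz.lists
  have h3 := h1.length_eq
  have h4 := (h2.le_of_bounded hzn).2.2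
  refine .step (.copyWord ..) <| .step (.setInt ..) <| .step (.add ..) <| .step (.copySimple ..) <|
    .call (runs_prefConjInv_mirror hC _ (x := x) (by simpa [HasRNF] using hx) hn)
    Prog.writesBelow_prefConjInv fun σ₁ h₁ f₁ => .step (.copySimple ..) <| .step (.copyWord ..) <|
    .step (.setInt ..) <| .step (.add ..) <|
    .call (runs_prefPrefix hC _ (x := z) (n := n) ⟨l, ?_, ?_⟩ hzn) Prog.writesBelow_prefPrefix
    fun σ₂ h₂ f₂ => .step (.clear ..) <| .step (.pushBack ..) <| .step (.pushBack ..) <|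
    .step (.pushBack ..) <| .step (.clear ..) <| .comp (runs_lcmWord hC _ (n := 3) ?_ ?_)
    fun σ₃ h₃ => .step (.copyWord ..) <| .skip ?_ ?_
  · simpa [f₁.word] using h1
  · simpa [f₁.int] using h2
  · simp
  · simp
  · simp [f₁.word] at h₃ ⊢
    omega
  · simp at h₁
    have h5 := h₃.1
    simp [wordVal_cons, f₂.simp, f₁.simp, h₁, h₂.1, ← mul_assoc] at h5
    simpa [HasElt] using h5

theorem runs_transportWord (hC : 1 ≤ C) (σ : S.State) {n : ℕ} (h0 : (σ.word 0).length ≤ n)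
    (h1 : (σ.word 1).length ≤ n) :
    Runs O C .transportWord σ (100000 * quadCost O C n) fun σ' =>
      σ'.HasElt 0 (S.transport (S.wordVal (σ.word 0)) (S.wordVal (σ.word 1))) := by
  have hU := opCost_pos O hC
  have hUL := opCost_le_linCost O C n
  have hLQ := linCost_le_quadCost O C n
  have hL := linCost_mul_le O C n (a := 3) (by omega)
  have hnL := lt_linCost O hC n
  refine .step (.copyWord ..) <| .step (.copyWord ..) <|
    .call (runs_normWord hC _ (n := n) (by simpa using h0)) Prog.writesBelow_normWord
    fun σ₁ h₁ f₁ => .call (runs_prefPrefix hC _ h₁ (n := n) ?_)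
    Prog.writesBelow_prefPrefix fun σ₂ h₂ f₂ => .step (.copySimple ..) <|
    .call (runs_normConjWord hC _ (n := n) ?_ ?_) Prog.writesBelow_normConjWord
    fun σ₃ h₃ f₃ => .call (runs_prefPrefix hC _ h₃ (n := 3 * n) ?_)
    Prog.writesBelow_prefPrefix fun σ₄ h₄ f₄ => .step (.copyWord ..) <| .step (.pushFront ..) <|
    .step (.pushBack ..) <| .skip ?_ ?_
  · exact (bounded_wordVal _).mono (by simpa using h0)
  · simpa [f₂.word, f₁.word] using h0
  · simpa [f₂.word, f₁.word] using h1
  · exact bounded_conj_wordVal (by simpa [f₂.word, f₁.word] using h0)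
      (by simpa [f₂.word, f₁.word] using h1)
  · simp [f₄.word, f₃.word, f₂.word, f₁.word]
    omega
  · simp [f₁.word, f₂.word] at h₂ h₄
    simp [HasElt, wordVal_cons, wordVal_append, f₄.word, f₃.word, f₂.word, f₁.word, f₄.simp,
      f₃.simp, h₂.1, h₄.1, GarsideStructure.transport, mul_assoc]

theorem runs_prefConjInvWord (hC : 1 ≤ C) (σ : S.State) {n : ℕ} (h0 : (σ.word 30).length ≤ n)
    (h1 : (σ.word 31).length ≤ n) :
    Runs O C .prefConjInvWord σ (80000 * quadCost O C n) fun σ' =>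
      (σ'.simp 0).1 = S.prefPrefix (conj (S.wordVal (σ.word 30)) (S.wordVal (σ.word 31))⁻¹) := by
  have hU := opCost_pos O hC
  have hUL := opCost_le_linCost O C n
  have hLQ := linCost_le_quadCost O C n
  have hL := linCost_mul_le O C n (a := 3) (by omega)
  refine .comp (runs_normConjInvWord hC _ h0 h1) fun σ₁ h₁ =>
    .comp (runs_prefPrefix hC _ h₁ (n := 3 * n) (bounded_conj_inv_wordVal h0 h1)) fun σ₂ h₂ =>
    .skip (by omega) h₂.1

theorem runs_prefConjInvWord_mirror (hC : 1 ≤ C) (σ : S.State) {n : ℕ}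
    (h0 : (σ.word 30).length ≤ n) (h1 : (σ.word 31).length ≤ n) :
    Runs O C Prog.prefConjInvWord.mirror σ (80000 * quadCost O C n) fun σ' =>
      (σ'.simp 0).1 = S.prefSuffix (conj (S.wordVal (σ.word 30)) (S.wordVal (σ.word 31))) := by
  have h := (runs_prefConjInvWord (O := O.op) hC σ.op (n := n) (by simpa [Word.op] using h0)
    (by simpa [Word.op] using h1)).mirror
  rw [quadCost, linCost, opCost_op] at h
  refine h.mono le_rfl fun σ' h => ?_
  simp only [State.op_word, wordVal_op] at h
  simpa [conj_op, prefPrefix_op, ← MulOpposite.op_inv] using h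

theorem runs_pullbackWord (hC : 1 ≤ C) (σ : S.State) {n : ℕ} (h0 : (σ.word 0).length ≤ n)
    (h1 : (σ.word 1).length ≤ n) (h2 : (σ.word 2).length ≤ n) :
    Runs O C .pullbackWord σ (1000000 * quadCost O C n) fun σ' =>
      σ'.HasElt 0 (S.leftLcm (S.prefPrefix (S.wordVal (σ.word 2)) * S.wordVal (σ.word 1) *
        (S.prefSuffix (conj (S.wordVal (σ.word 0)) (S.wordVal (σ.word 1))))⁻¹) 1) := by
  have hU := opCost_pos O hC
  have hUL := opCost_le_linCost O C n
  have hLQ := linCost_le_quadCost O C n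
  have hnL := lt_linCost O hC n
  have hQ : quadCost O C (n + 2) ≤ 9 * quadCost O C n := by
    have h1 := linCost_add_two_le O C n
    rw [quadCost, quadCost]
    calc _ ≤ (3 * (n + 1)) * (3 * linCost O C n) := Nat.mul_le_mul (by omega) h1
      _ = _ := by ring
  refine .step (.copyWord ..) <| .step (.copyWord ..) <| .step (.copyWord ..) <|
    .call (runs_normWord hC _ (n := n) (by simpa using h2)) Prog.writesBelow_normWord
    fun σ₁ h₁ f₁ => .call (runs_prefPrefix hC _ h₁ (n := n) ?_)
    Prog.writesBelow_prefPrefix fun σ₂ h₂ f₂ => .step (.copySimple ..) <| .step (.copyWord ..) <|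
    .step (.copyWord ..) <| .call (runs_prefConjInvWord_mirror hC _ (n := n) ?_ ?_)
    Prog.writesBelow_prefConjInvWord fun σ₃ h₃ f₃ => .step (.copyWord ..) <|
    .step (.pushFront ..) <| .step (.pushBack ..) <| .step (.clear ..) <|
    .comp (runs_lcmWord hC _ (n := n + 2) ?_ ?_) fun σ₄ h₄ => .step (.copyWord ..) <| .skip ?_ ?_
  · exact (bounded_wordVal _).mono (by simpa using h2)
  · simpa [f₂.word, f₁.word] using h0
  · simpa [f₂.word, f₁.word] using h1
  · simpa [f₃.word, f₂.word, f₁.word] using h1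
  · simp
  · simp [f₃.word, f₂.word, f₁.word] at h₄ ⊢
    omega
  · simp [f₂.word, f₁.word] at h₂ h₃
    have h5 := h₄.1
    simp [wordVal_cons, wordVal_append, f₃.word, f₃.simp, f₂.word, f₁.word, h₃, h₂.1,
      ← mul_assoc] at h5
    simpa [HasElt] using h5

end GarsideStructure

namespace GarsideStructure

open State

/-! ### The tasks -/

section

variable {input : ∀ (G : Type u) [Group G] (S : GarsideStructure G),
    S.Oracle → ℕ → S.State → G → G → G → Prop}
  {output : ∀ (G : Type u) [Group G] (S : GarsideStructure G), S.State → G → G → G → Prop}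

theorem performedIn_of_opCost (p : Prog) (K : ℕ)
    (h : ∀ (G : Type u) [Group G] [Nontrivial G] (S : GarsideStructure G) (O : S.Oracle) (C k : ℕ),
      1 ≤ C → ∀ (x y z : G) (σ : S.State), input G S O k σ x y z →
        Runs O C p σ (K * opCost O C) fun σ' => output G S σ' x y z) :
    PerformedIn.{u} (fun C l _ D => C * l * D) input output := by
  refine ⟨p, K, fun G _ _ S _ O C k hC _ x y z σ hi => ?_⟩
  obtain ⟨σ', n, h1, h2, h3⟩ := h G S O C k hC x y z σ hi
  exact ⟨σ', n, h1, h2.le, h3⟩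

/-- The estimates use `k + 1` factors; `k ≥ 1` allows the passage to `2k`. -/
theorem performedIn_of_linCost (p : Prog) (K : ℕ)
    (h : ∀ (G : Type u) [Group G] [Nontrivial G] (S : GarsideStructure G) (O : S.Oracle) (C k : ℕ),
      1 ≤ C → ∀ (x y z : G) (σ : S.State), input G S O k σ x y z →
        Runs O C p σ (K * linCost O C k) fun σ' => output G S σ' x y z) :
    PerformedIn.{u} (fun C l k D => C * l * k * D) input output := by
  refine ⟨p, K * 2, fun G _ _ S _ O C k hC hk x y z σ hi => ?_⟩
  obtain ⟨σ', n, h1, h2, h3⟩ := h G S O C k hC x y z σ hi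
  refine ⟨σ', n, h1, h2.le.trans ?_, h3⟩
  calc K * linCost O C k ≤ K * (2 * k * opCost O C) :=
        Nat.mul_le_mul_left _ (Nat.mul_le_mul_right _ (by omega))
    _ = _ := by rw [opCost]; ring

theorem performedIn_of_quadCost (p : Prog) (K : ℕ)
    (h : ∀ (G : Type u) [Group G] [Nontrivial G] (S : GarsideStructure G) (O : S.Oracle) (C k : ℕ),
      1 ≤ C → ∀ (x y z : G) (σ : S.State), input G S O k σ x y z →
        Runs O C p σ (K * quadCost O C k) fun σ' => output G S σ' x y z) :
    PerformedIn.{u} (fun C l k D => C * l * k ^ 2 * D) input output := by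
  refine ⟨p, K * 4, fun G _ _ S _ O C k hC hk x y z σ hi => ?_⟩
  obtain ⟨σ', n, h1, h2, h3⟩ := h G S O C k hC x y z σ hi
  refine ⟨σ', n, h1, h2.le.trans ?_, h3⟩
  calc K * quadCost O C k ≤ K * (2 * k * (2 * k * opCost O C)) :=
        Nat.mul_le_mul_left _ (Nat.mul_le_mul (by omega) (Nat.mul_le_mul_right _ (by omega)))
    _ = _ := by rw [opCost]; ring

end

theorem performedIn_isOne : PerformedIn.{u} (fun C l _ _ => C * l)
    (fun _ _ _ _ _ σ s _ _ => σ.HasSimple 0 s)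
    (fun _ _ _ σ' s _ _ => σ'.Answers (s = 1)) := by
  refine ⟨.isOne, 20, fun G _ _ S _ O C k hC _ x y z σ hi => ?_⟩
  obtain ⟨σ', n, h1, h2, h3⟩ := runs_isOne (O := O) hC σ
  exact ⟨σ', n, h1, h2.le, by rwa [show (σ.simp 0).1 = x from hi] at h3⟩

theorem performedIn_equal : PerformedIn.{u} (fun C l _ D => C * l * D)
    (fun _ _ _ _ _ σ s t _ => σ.HasSimple 0 s ∧ σ.HasSimple 1 t)
    (fun _ _ _ σ' s t _ => σ'.Answers (s = t)) := by
  refine performedIn_of_opCost .equal 90 ?_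
  rintro G _ _ S O C k hC _ _ _ σ ⟨rfl, rfl⟩
  exact runs_equal hC σ

theorem performedIn_rightCompl : PerformedIn.{u} (fun C l _ D => C * l * D)
    (fun _ _ _ _ _ σ s _ _ => σ.HasSimple 0 s)
    (fun _ _ S σ' s _ _ => σ'.HasSimple 0 (S.rightCompl s)) := by
  refine performedIn_of_opCost .rightCompl 40 ?_
  rintro G _ _ S O C k hC _ _ _ σ rfl
  exact runs_rightCompl hC σ

theorem performedIn_tau : PerformedIn.{u} (fun C l _ D => C * l * D)
    (fun _ _ _ _ _ σ s _ _ => σ.HasSimple 0 s)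
    (fun _ _ S σ' s _ _ => σ'.HasSimple 0 (S.tau s)) := by
  refine performedIn_of_opCost .tau 90 ?_
  rintro G _ _ S O C k hC _ _ _ σ rfl
  exact runs_tau hC σ

theorem performedIn_mulAtom : PerformedIn.{u} (fun C l _ D => C * l * D)
    (fun _ _ _ O _ σ a s _ => σ.HasAtom O 0 a ∧ σ.HasSimple 0 s)
    (fun _ _ S σ' a s _ => σ'.Answers (S.IsSimple (a * s)) ∧
      (S.IsSimple (a * s) → σ'.HasSimple 0 (a * s))) := by
  refine performedIn_of_opCost .mulAtom 100 ?_
  rintro G _ _ S O C k hC a _ _ σ ⟨ha, rfl⟩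
  exact runs_mulAtom hC σ a ha

theorem performedIn_leftGcd : PerformedIn.{u} (fun C l _ D => C * l * D)
    (fun _ _ _ _ _ σ s t _ => σ.HasSimple 0 s ∧ σ.HasSimple 1 t)
    (fun _ _ S σ' s t _ => σ'.HasSimple 0 (S.leftGcd s t)) := by
  refine performedIn_of_opCost .leftGcd 80 ?_
  rintro G _ _ S O C k hC _ _ _ σ ⟨rfl, rfl⟩
  exact runs_leftGcd hC σ

theorem performedIn_leftLcm : PerformedIn.{u} (fun C l _ D => C * l * D)
    (fun _ _ _ _ _ σ s t _ => σ.HasSimple 0 s ∧ σ.HasSimple 1 t)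
    (fun _ _ S σ' s t _ => σ'.HasSimple 0 (S.leftLcm s t)) := by
  refine performedIn_of_opCost .leftLcm 220 ?_
  rintro G _ _ S O C k hC _ _ _ σ ⟨rfl, rfl⟩
  exact runs_leftLcm hC σ

theorem performedIn_localSlide : PerformedIn.{u} (fun C l _ D => C * l * D)
    (fun _ _ _ _ _ σ s t _ => σ.HasSimple 0 s ∧ σ.HasSimple 1 t)
    (fun _ _ S σ' s t _ => σ'.HasSimple 0 (s * S.leftGcd (S.rightCompl s) t) ∧
      σ'.HasSimple 1 ((S.leftGcd (S.rightCompl s) t)⁻¹ * t)) := by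
  refine performedIn_of_opCost .localSlide 120 ?_
  rintro G _ _ S O C k hC _ _ _ σ ⟨rfl, rfl⟩
  exact runs_localSlide hC σ

/-- The local right sliding is the mirror image of the local left sliding of `t · s`. -/
theorem performedIn_localRightSlide : PerformedIn.{u} (fun C l _ D => C * l * D)
    (fun _ _ _ _ _ σ s t _ => σ.HasSimple 0 s ∧ σ.HasSimple 1 t)
    (fun _ _ S σ' s t _ => σ'.HasSimple 0 (s * (S.rightGcd s (S.leftCompl t))⁻¹) ∧
      σ'.HasSimple 1 (S.rightGcd s (S.leftCompl t) * t)) := by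
  -- Mirroring reverses products but not the numbering of registers. So the task to be mirrored is
  -- the left sliding of `t · s` with `s` still in register `0`, which requires exchanges before and
  -- after.
  have key : PerformedIn.{u} (fun C l _ D => C * l * D)
      (fun _ _ _ _ _ σ s t _ => σ.HasSimple 0 s ∧ σ.HasSimple 1 t)
      (fun _ _ S σ' s t _ => σ'.HasSimple 0 ((S.leftGcd s (S.rightCompl t))⁻¹ * s) ∧
        σ'.HasSimple 1 (t * S.leftGcd s (S.rightCompl t))) := by
    refine performedIn_of_opCost (.swap ⨟ .localSlide ⨟ .swap) 140 ?_
    rintro G _ _ S O C k hC _ _ _ σ ⟨rfl, rfl⟩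
    have hU := opCost_pos O hC
    refine .assoc <| .step (.copySimple ..) <| .assoc <| .step (.copySimple ..) <| .assoc <|
      .step (.copySimple ..) <| .skip_comp <| .comp (runs_localSlide hC _) fun σ₁ h₁ =>
      .step (.copySimple ..) <| .step (.copySimple ..) <| .step (.copySimple ..) <|
      .skip (by omega) ?_
    simp only [slideFst, slideSnd, S.gcd_comm (S.rightCompl _)] at h₁
    simpa [HasSimple, and_comm] using h₁
  refine key.mirror (fun G _ _ S O k σ x y z h => ?_) (fun G _ _ S σ x y z h => ?_)
  · simpa only [hasSimple_op_iff] using h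
  · simpa only [rightCompl_op, leftGcd_op, ← MulOpposite.op_mul, ← MulOpposite.op_inv,
      hasSimple_op_iff] using h

theorem performedIn_sameNF : PerformedIn.{u} (fun C l k D => C * l * k * D)
    (fun _ _ S _ k σ x y _ => σ.HasLNF 0 x ∧ σ.HasLNF 1 y ∧
      S.HasLengthAtMost k x ∧ S.HasLengthAtMost k y)
    (fun _ _ _ σ' x y _ => σ'.Answers (x = y)) := by
  refine performedIn_of_linCost .sameNF 300 ?_
  rintro G _ _ S O C k hC _ _ _ σ ⟨hx, hy, hxk, hyk⟩
  exact runs_sameNF hC σ hx hy hxk.bounded hyk.bounded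

/-- Operations on an element, given by its left normal form, and a simple element. -/
theorem performedIn_onNF (p : Prog) (K : ℕ) (f : ∀ (G : Type u) [Group G], G → G → G)
    (h : ∀ (G : Type u) [Group G] [Nontrivial G] (S : GarsideStructure G) (O : S.Oracle) (C k : ℕ),
      1 ≤ C → ∀ (x : G) (σ : S.State), σ.HasNF x → S.Bounded k x →
        Runs O C p σ (K * linCost O C k) fun σ' => σ'.HasNF (f G x (σ.simp 15).1))
    (h' : ∀ (G : Type u) [Group G] [Nontrivial G] (S : GarsideStructure G) (k : ℕ) (x s : G),
      S.Bounded k x → S.IsSimple s → S.Bounded (k + 2) (f G x s)) :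
    PerformedIn.{u} (fun C l k D => C * l * k * D)
      (fun _ _ S _ k σ x s _ => σ.HasLNF 0 x ∧ σ.HasSimple 0 s ∧ S.HasLengthAtMost k x)
      (fun G _ _ σ' x s _ => σ'.HasLNF 0 (f G x s)) := by
  refine performedIn_of_linCost (.onNF (p ⨟ .storeNF)) (K + 100) ?_
  rintro G _ _ S O C k hC x _ _ σ ⟨hx, rfl, hxk⟩
  have hU := opCost_pos O hC
  have hUL := opCost_le_linCost O C k
  have hL := linCost_add_two_le O C k
  refine (runs_onNF (K := K + 40) hC σ hx hxk.bounded fun τ h1 h2 _ => ?_).mono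
    (Nat.mul_le_mul_right _ (by omega)) fun _ => id
  rw [← h2]
  refine .comp (h G S O C k hC x τ h1 hxk.bounded) fun σ₁ h₁ => (runs_storeNF hC _ h₁
    (h' G S k x _ hxk.bounded (Subtype.property _))).mono ?_ fun _ => id
  rw [add_mul]
  omega

/-- The mirror image of `performedIn_onNF`. -/
theorem performedIn_onRNF {f g : ∀ (G : Type u) [Group G], G → G → G}
    (h : PerformedIn.{u} (fun C l k D => C * l * k * D)
      (fun _ _ S _ k σ x s _ => σ.HasLNF 0 x ∧ σ.HasSimple 0 s ∧ S.HasLengthAtMost k x)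
      (fun G _ _ σ' x s _ => σ'.HasLNF 0 (f G x s)))
    (hfg : ∀ (G : Type u) [Group G] (x s : G),
      f Gᵐᵒᵖ (MulOpposite.op x) (MulOpposite.op s) = MulOpposite.op (g G x s)) :
    PerformedIn.{u} (fun C l k D => C * l * k * D)
      (fun _ _ S _ k σ x s _ => σ.HasRNF 0 x ∧ σ.HasSimple 0 s ∧ S.HasLengthAtMost k x)
      (fun G _ _ σ' x s _ => σ'.HasRNF 0 (g G x s)) := by
  refine h.mirror (fun G _ _ S O k σ x s z h => ?_) (fun G _ _ S σ x s z h => ?_)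
  · exact ⟨(hasLNF_op_iff ..).2 h.1, (hasSimple_op_iff ..).2 h.2.1, hasLengthAtMost_op h.2.2⟩
  · rw [hfg] at h
    exact (hasLNF_op_iff ..).1 h

theorem performedIn_mul : PerformedIn.{u} (fun C l k D => C * l * k * D)
    (fun _ _ S _ k σ x s _ => σ.HasLNF 0 x ∧ σ.HasSimple 0 s ∧ S.HasLengthAtMost k x)
    (fun _ _ _ σ' x s _ => σ'.HasLNF 0 (x * s)) :=
  performedIn_onNF .normMul 1000 (fun _ _ x s => x * s)
    (fun _ _ _ _ _ _ _ hC _ σ hx hk => runs_normMul hC σ hx hk)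
    (fun _ _ _ _ _ _ _ hx hs => (hx.mul_simple hs).mono (by omega))

theorem performedIn_leftMul : PerformedIn.{u} (fun C l k D => C * l * k * D)
    (fun _ _ S _ k σ x s _ => σ.HasLNF 0 x ∧ σ.HasSimple 0 s ∧ S.HasLengthAtMost k x)
    (fun _ _ _ σ' x s _ => σ'.HasLNF 0 (s * x)) :=
  performedIn_onNF .normLeftMul 1500 (fun _ _ x s => s * x)
    (fun _ _ _ _ _ _ _ hC _ σ hx hk => runs_normLeftMul hC σ hx hk)
    (fun _ _ _ _ _ _ _ hx hs => (hx.simple_mul hs).mono (by omega))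

theorem performedIn_div : PerformedIn.{u} (fun C l k D => C * l * k * D)
    (fun _ _ S _ k σ x s _ => σ.HasLNF 0 x ∧ σ.HasSimple 0 s ∧ S.HasLengthAtMost k x)
    (fun _ _ _ σ' x s _ => σ'.HasLNF 0 (x * s⁻¹)) :=
  performedIn_onNF .normDiv 2000 (fun _ _ x s => x * s⁻¹)
    (fun _ _ _ _ _ _ _ hC _ σ hx hk => runs_normDiv hC σ hx hk)
    (fun _ _ _ _ _ _ _ hx hs => (hx.mul_simple_inv hs).mono (by omega))

theorem performedIn_leftDiv : PerformedIn.{u} (fun C l k D => C * l * k * D)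
    (fun _ _ S _ k σ x s _ => σ.HasLNF 0 x ∧ σ.HasSimple 0 s ∧ S.HasLengthAtMost k x)
    (fun _ _ _ σ' x s _ => σ'.HasLNF 0 (s⁻¹ * x)) :=
  performedIn_onNF .normLeftDiv 2000 (fun _ _ x s => s⁻¹ * x)
    (fun _ _ _ _ _ _ _ hC _ σ hx hk => runs_normLeftDiv hC σ hx hk)
    (fun _ _ _ _ _ _ _ hx hs => (hx.simple_inv_mul hs).mono (by omega))

theorem performedIn_conj : PerformedIn.{u} (fun C l k D => C * l * k * D)
    (fun _ _ S _ k σ x s _ => σ.HasLNF 0 x ∧ σ.HasSimple 0 s ∧ S.HasLengthAtMost k x)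
    (fun _ _ _ σ' x s _ => σ'.HasLNF 0 (conj x s)) :=
  performedIn_onNF .normConj 6000 (fun _ _ x s => conj x s)
    (fun _ _ _ _ _ _ _ hC _ σ hx hk => runs_normConj hC σ hx hk)
    (fun _ _ _ _ _ _ _ hx hs => hx.conj hs)

theorem performedIn_conj_inv : PerformedIn.{u} (fun C l k D => C * l * k * D)
    (fun _ _ S _ k σ x s _ => σ.HasLNF 0 x ∧ σ.HasSimple 0 s ∧ S.HasLengthAtMost k x)
    (fun _ _ _ σ' x s _ => σ'.HasLNF 0 (conj x s⁻¹)) :=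
  performedIn_onNF .normConjInv 6000 (fun _ _ x s => conj x s⁻¹)
    (fun _ _ _ _ _ _ _ hC _ σ hx hk => runs_normConjInv hC σ hx hk)
    (fun _ _ _ _ _ _ _ hx hs => hx.conj_inv hs)

theorem performedIn_prefPrefix : PerformedIn.{u} (fun C l k D => C * l * k * D)
    (fun _ _ S _ k σ x _ _ => σ.HasLNF 0 x ∧ S.HasLengthAtMost k x)
    (fun _ _ S σ' x _ _ => σ'.HasSimple 0 (S.prefPrefix x)) := by
  refine performedIn_of_linCost (.onNF .prefPrefix) 1010 ?_
  rintro G _ _ S O C k hC x _ _ σ ⟨hx, hk⟩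
  exact runs_onNF hC σ hx hk.bounded fun τ h1 _ _ =>
    (runs_prefPrefix hC τ h1 hk.bounded).mono le_rfl fun _ h => h.1

theorem bounded_slide {G : Type u} [Group G] [Nontrivial G] {S : GarsideStructure G} {x : G}
    {k : ℕ} (h : S.Bounded k x) : S.Bounded (k + 2) (S.slide x) :=
  h.conj (S.isSimple_prefPrefix x)

theorem performedIn_slide : PerformedIn.{u} (fun C l k D => C * l * k * D)
    (fun _ _ S _ k σ x _ _ => σ.HasLNF 0 x ∧ S.HasLengthAtMost k x)
    (fun _ _ S σ' x _ _ => σ'.HasLNF 0 (S.slide x)) := by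
  refine performedIn_of_linCost (.onNF (.slide ⨟ .storeNF)) 8110 ?_
  rintro G _ _ S O C k hC x _ _ σ ⟨hx, hk⟩
  have hL := linCost_add_two_le O C k
  exact runs_onNF (K := 8100) hC σ hx hk.bounded fun τ h1 _ _ =>
    .comp (runs_slide hC τ h1 hk.bounded) fun σ₁ h₁ =>
      (runs_storeNF hC _ h₁ (bounded_slide hk.bounded)).mono (by omega) fun _ => id

theorem performedIn_transport : PerformedIn.{u} (fun C l k D => C * l * k * D)
    (fun _ _ S _ k σ x s _ => σ.HasLNF 0 x ∧ σ.HasSimple 0 s ∧ S.HasLengthAtMost k x)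
    (fun _ _ S σ' x s _ => σ'.HasElt 0 (S.transport x s)) := by
  refine performedIn_of_linCost .transport 20000 ?_
  rintro G _ _ S O C k hC x _ _ σ ⟨hx, rfl, hk⟩
  exact runs_transport hC σ hx hk.bounded

theorem performedIn_pullback : PerformedIn.{u} (fun C l k D => C * l * k * D)
    (fun _ _ S _ k σ x s z => σ.HasRNF 0 x ∧ σ.HasLNF 1 z ∧ σ.HasSimple 0 s ∧
      S.HasLengthAtMost k x ∧ z ∈ S.SC x ∧ S.slide z = x ∧ conj x s ∈ S.SSS x)
    (fun _ _ S σ' x s z => ∃ v, S.IsPullback x z s v ∧ σ'.HasElt 0 v) := by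
  refine performedIn_of_linCost .pullback 1000000 ?_
  rintro G _ _ S O C k hC x _ z σ ⟨hx, hz, rfl, hk, hzx, hsl, hs⟩
  exact (runs_pullback hC σ hx hz hk (hk.bounded.of_mem_SC hzx hsl)).mono le_rfl fun σ' h =>
    ⟨_, S.isPullback_lcm hzx hsl hs, h⟩

theorem performedIn_normWord : PerformedIn.{u} (fun C l k D => C * l * k ^ 2 * D)
    (fun _ _ _ _ k σ x _ _ => σ.HasEltLE 0 k x)
    (fun _ _ _ σ' x _ _ => σ'.HasLNF 0 x) := by
  refine performedIn_of_quadCost (.instr (.copyWord 30 0) ⨟ .normWord ⨟ .storeNF) 7200 ?_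
  rintro G _ _ S O C k hC _ _ _ σ ⟨hk, rfl⟩
  have hU := opCost_pos O hC
  have hLQ := linCost_le_quadCost O C k
  have hkL := lt_linCost O hC k
  refine .step (.copyWord ..) <| .comp (runs_normWord hC _ (n := k) (by simpa using hk))
    fun σ₁ h₁ => (runs_storeNF hC _ (n := k) (by simpa using h₁)
      ((bounded_wordVal _).mono hk)).mono (by omega) fun _ => id

theorem performedIn_gcdWord : PerformedIn.{u} (fun C l k D => C * l * k ^ 2 * D)
    (fun _ _ _ _ k σ x y _ => σ.HasEltLE 0 k x ∧ σ.HasEltLE 1 k y)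
    (fun _ _ S σ' x y _ => σ'.HasElt 0 (S.leftGcd x y)) := by
  refine performedIn_of_quadCost (.instr (.copyWord 30 0) ⨟ .instr (.copyWord 31 1) ⨟ .gcdWord ⨟
    .instr (.copyWord 0 30) ⨟ .skip) 41000 ?_
  rintro G _ _ S O C k hC _ _ _ σ ⟨⟨hk, rfl⟩, hk', rfl⟩
  have hU := opCost_pos O hC
  have hUL := opCost_le_linCost O C k
  have hLQ := linCost_le_quadCost O C k
  have hkL := lt_linCost O hC k
  refine .step (.copyWord ..) <| .step (.copyWord ..) <| .comp (runs_gcdWord hC _ (n := k)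
    (by simpa using hk) (by simpa using hk')) fun σ₁ h₁ => .step (.copyWord ..) <| .skip ?_ ?_
  · simp; omega
  · simpa [HasElt] using h₁.1

theorem performedIn_lcmWord : PerformedIn.{u} (fun C l k D => C * l * k ^ 2 * D)
    (fun _ _ _ _ k σ x y _ => σ.HasEltLE 0 k x ∧ σ.HasEltLE 1 k y)
    (fun _ _ S σ' x y _ => σ'.HasElt 0 (S.leftLcm x y)) := by
  refine performedIn_of_quadCost (.instr (.copyWord 30 0) ⨟ .instr (.copyWord 31 1) ⨟ .lcmWord ⨟
    .instr (.copyWord 0 30) ⨟ .skip) 51000 ?_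
  rintro G _ _ S O C k hC _ _ _ σ ⟨⟨hk, rfl⟩, hk', rfl⟩
  have hU := opCost_pos O hC
  have hUL := opCost_le_linCost O C k
  have hLQ := linCost_le_quadCost O C k
  have hkL := lt_linCost O hC k
  refine .step (.copyWord ..) <| .step (.copyWord ..) <| .comp (runs_lcmWord hC _ (n := k)
    (by simpa using hk) (by simpa using hk')) fun σ₁ h₁ => .step (.copyWord ..) <| .skip ?_ ?_
  · simp; omega
  · simpa [HasElt] using h₁.1

theorem performedIn_prefPrefixWord : PerformedIn.{u} (fun C l k D => C * l * k ^ 2 * D)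
    (fun _ _ _ _ k σ x _ _ => σ.HasEltLE 0 k x)
    (fun _ _ S σ' x _ _ => σ'.HasSimple 0 (S.prefPrefix x)) := by
  refine performedIn_of_quadCost (.instr (.copyWord 30 0) ⨟ .normWord ⨟ .prefPrefix) 8200 ?_
  rintro G _ _ S O C k hC _ _ _ σ ⟨hk, rfl⟩
  have hU := opCost_pos O hC
  have hLQ := linCost_le_quadCost O C k
  have hkL := lt_linCost O hC k
  refine .step (.copyWord ..) <| .comp (runs_normWord hC _ (n := k) (by simpa using hk))
    fun σ₁ h₁ => (runs_prefPrefix hC _ (n := k) h₁ ((bounded_wordVal _).mono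
      (by simpa using hk))).mono (by omega) fun _ h => ?_
  simpa [HasSimple] using h.1

theorem performedIn_slideWord : PerformedIn.{u} (fun C l k D => C * l * k ^ 2 * D)
    (fun _ _ _ _ k σ x _ _ => σ.HasEltLE 0 k x)
    (fun _ _ S σ' x _ _ => σ'.HasLNF 0 (S.slide x)) := by
  refine performedIn_of_quadCost (.instr (.copyWord 30 0) ⨟ .normWord ⨟ .slide ⨟ .storeNF) 16000 ?_
  rintro G _ _ S O C k hC _ _ _ σ ⟨hk, rfl⟩
  have hU := opCost_pos O hC
  have hLQ := linCost_le_quadCost O C k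
  have hL := linCost_add_two_le O C k
  have hkL := lt_linCost O hC k
  refine .step (.copyWord ..) <| .comp (runs_normWord hC _ (n := k) (by simpa using hk))
    fun σ₁ h₁ => .comp (runs_slide hC _ (n := k) (by simpa using h₁)
      ((bounded_wordVal _).mono hk)) fun σ₂ h₂ =>
      (runs_storeNF hC _ h₂ (bounded_slide ((bounded_wordVal _).mono hk))).mono (by omega)
      fun _ => id

theorem performedIn_transportWord : PerformedIn.{u} (fun C l k D => C * l * k ^ 2 * D)
    (fun _ _ _ _ k σ x α _ => σ.HasEltLE 0 k x ∧ σ.HasEltLE 1 k α)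
    (fun _ _ S σ' x α _ => σ'.HasElt 0 (S.transport x α)) := by
  refine performedIn_of_quadCost .transportWord 100000 ?_
  rintro G _ _ S O C k hC _ _ _ σ ⟨⟨hk, rfl⟩, hk', rfl⟩
  exact runs_transportWord hC σ hk hk'

theorem performedIn_pullbackWord : PerformedIn.{u} (fun C l k D => C * l * k ^ 2 * D)
    (fun _ _ S _ k σ x α z => σ.HasEltLE 0 k x ∧ σ.HasEltLE 1 k α ∧ σ.HasEltLE 2 k z ∧
      α ∈ S.P ∧ z ∈ S.SC x ∧ S.slide z = x ∧ conj x α ∈ S.SSS x)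
    (fun _ _ S σ' x α z => ∃ v, S.IsPullback x z α v ∧ σ'.HasElt 0 v) := by
  refine performedIn_of_quadCost .pullbackWord 1000000 ?_
  rintro G _ _ S O C k hC _ _ _ σ ⟨⟨hk, rfl⟩, ⟨hk', rfl⟩, ⟨hk'', rfl⟩, -, hzx, hsl, hs⟩
  exact (runs_pullbackWord hC σ hk hk' hk'').mono le_rfl fun σ' h =>
    ⟨_, S.isPullback_lcm hzx hsl hs, h⟩

end GarsideStructure

/-! ### Assembly of the theorem by left-right symmetry -/

namespace GarsideStructure

open State

theorem exists_isRightPullback {G : Type u} [Group G] [Nontrivial G] {S : GarsideStructure G}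
    {σ : S.State} {x s z : G} (h : ∃ v, S.op.IsPullback (MulOpposite.op x) (MulOpposite.op z)
      (MulOpposite.op s) v ∧ σ.op.HasElt 0 v) : ∃ v, S.IsRightPullback x z s v ∧ σ.HasElt 0 v := by
  obtain ⟨v, h1, h2⟩ := h
  exact ⟨v.unop, (S.isPullback_op_iff ..).1 h1, (hasElt_op_iff ..).1 h2⟩

end GarsideStructure

open GarsideStructure GarsideStructure.State in
theorem theoremT :
  -- test whether s = 1
  GarsideStructure.PerformedIn.{u} (fun C l _ _ => C * l)
    (fun _ _ _ _ _ σ s _ _ => σ.HasSimple 0 s)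
    (fun _ _ _ σ' s _ _ => σ'.Answers (s = 1)) ∧
  -- test whether s = t
  GarsideStructure.PerformedIn.{u} (fun C l _ D => C * l * D)
    (fun _ _ _ _ _ σ s t _ => σ.HasSimple 0 s ∧ σ.HasSimple 1 t)
    (fun _ _ _ σ' s t _ => σ'.Answers (s = t)) ∧
  -- complements of s, conjugation of s by Δ and its inverse
  GarsideStructure.PerformedIn.{u} (fun C l _ D => C * l * D)
    (fun _ _ _ _ _ σ s _ _ => σ.HasSimple 0 s)
    (fun _ _ S σ' s _ _ => σ'.HasSimple 0 (S.rightCompl s)) ∧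
  GarsideStructure.PerformedIn.{u} (fun C l _ D => C * l * D)
    (fun _ _ _ _ _ σ s _ _ => σ.HasSimple 0 s)
    (fun _ _ S σ' s _ _ => σ'.HasSimple 0 (S.leftCompl s)) ∧
  GarsideStructure.PerformedIn.{u} (fun C l _ D => C * l * D)
    (fun _ _ _ _ _ σ s _ _ => σ.HasSimple 0 s)
    (fun _ _ S σ' s _ _ => σ'.HasSimple 0 (S.tau s)) ∧
  GarsideStructure.PerformedIn.{u} (fun C l _ D => C * l * D)
    (fun _ _ _ _ _ σ s _ _ => σ.HasSimple 0 s)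
    (fun _ _ S σ' s _ _ => σ'.HasSimple 0 (S.tauInv s)) ∧
  -- test whether as (resp. sa) is simple and, if so, compute it
  GarsideStructure.PerformedIn.{u} (fun C l _ D => C * l * D)
    (fun _ _ _ O _ σ a s _ => σ.HasAtom O 0 a ∧ σ.HasSimple 0 s)
    (fun _ _ S σ' a s _ => σ'.Answers (S.IsSimple (a * s)) ∧
      (S.IsSimple (a * s) → σ'.HasSimple 0 (a * s))) ∧
  GarsideStructure.PerformedIn.{u} (fun C l _ D => C * l * D)
    (fun _ _ _ O _ σ a s _ => σ.HasAtom O 0 a ∧ σ.HasSimple 0 s)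
    (fun _ _ S σ' a s _ => σ'.Answers (S.IsSimple (s * a)) ∧
      (S.IsSimple (s * a) → σ'.HasSimple 0 (s * a))) ∧
  -- gcds and lcms of s and t
  GarsideStructure.PerformedIn.{u} (fun C l _ D => C * l * D)
    (fun _ _ _ _ _ σ s t _ => σ.HasSimple 0 s ∧ σ.HasSimple 1 t)
    (fun _ _ S σ' s t _ => σ'.HasSimple 0 (S.leftGcd s t)) ∧
  GarsideStructure.PerformedIn.{u} (fun C l _ D => C * l * D)
    (fun _ _ _ _ _ σ s t _ => σ.HasSimple 0 s ∧ σ.HasSimple 1 t)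
    (fun _ _ S σ' s t _ => σ'.HasSimple 0 (S.rightGcd s t)) ∧
  GarsideStructure.PerformedIn.{u} (fun C l _ D => C * l * D)
    (fun _ _ _ _ _ σ s t _ => σ.HasSimple 0 s ∧ σ.HasSimple 1 t)
    (fun _ _ S σ' s t _ => σ'.HasSimple 0 (S.leftLcm s t)) ∧
  GarsideStructure.PerformedIn.{u} (fun C l _ D => C * l * D)
    (fun _ _ _ _ _ σ s t _ => σ.HasSimple 0 s ∧ σ.HasSimple 1 t)
    (fun _ _ S σ' s t _ => σ'.HasSimple 0 (S.rightLcm s t)) ∧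
  -- local left and right sliding of the product s · t
  GarsideStructure.PerformedIn.{u} (fun C l _ D => C * l * D)
    (fun _ _ _ _ _ σ s t _ => σ.HasSimple 0 s ∧ σ.HasSimple 1 t)
    (fun _ _ S σ' s t _ => σ'.HasSimple 0 (s * S.leftGcd (S.rightCompl s) t) ∧
      σ'.HasSimple 1 ((S.leftGcd (S.rightCompl s) t)⁻¹ * t)) ∧
  GarsideStructure.PerformedIn.{u} (fun C l _ D => C * l * D)
    (fun _ _ _ _ _ σ s t _ => σ.HasSimple 0 s ∧ σ.HasSimple 1 t)
    (fun _ _ S σ' s t _ => σ'.HasSimple 0 (s * (S.rightGcd s (S.leftCompl t))⁻¹) ∧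
      σ'.HasSimple 1 (S.rightGcd s (S.leftCompl t) * t)) ∧
  -- test whether x = y, from the left (resp. right) normal forms
  GarsideStructure.PerformedIn.{u} (fun C l k D => C * l * k * D)
    (fun _ _ S _ k σ x y _ => σ.HasLNF 0 x ∧ σ.HasLNF 1 y ∧
      S.HasLengthAtMost k x ∧ S.HasLengthAtMost k y)
    (fun _ _ _ σ' x y _ => σ'.Answers (x = y)) ∧
  GarsideStructure.PerformedIn.{u} (fun C l k D => C * l * k * D)
    (fun _ _ S _ k σ x y _ => σ.HasRNF 0 x ∧ σ.HasRNF 1 y ∧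
      S.HasLengthAtMost k x ∧ S.HasLengthAtMost k y)
    (fun _ _ _ σ' x y _ => σ'.Answers (x = y)) ∧
  -- left normal forms of xs, sx, xs⁻¹, s⁻¹x and of the conjugates of x by s and s⁻¹
  GarsideStructure.PerformedIn.{u} (fun C l k D => C * l * k * D)
    (fun _ _ S _ k σ x s _ => σ.HasLNF 0 x ∧ σ.HasSimple 0 s ∧ S.HasLengthAtMost k x)
    (fun _ _ _ σ' x s _ => σ'.HasLNF 0 (x * s)) ∧
  GarsideStructure.PerformedIn.{u} (fun C l k D => C * l * k * D)
    (fun _ _ S _ k σ x s _ => σ.HasLNF 0 x ∧ σ.HasSimple 0 s ∧ S.HasLengthAtMost k x)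
    (fun _ _ _ σ' x s _ => σ'.HasLNF 0 (s * x)) ∧
  GarsideStructure.PerformedIn.{u} (fun C l k D => C * l * k * D)
    (fun _ _ S _ k σ x s _ => σ.HasLNF 0 x ∧ σ.HasSimple 0 s ∧ S.HasLengthAtMost k x)
    (fun _ _ _ σ' x s _ => σ'.HasLNF 0 (x * s⁻¹)) ∧
  GarsideStructure.PerformedIn.{u} (fun C l k D => C * l * k * D)
    (fun _ _ S _ k σ x s _ => σ.HasLNF 0 x ∧ σ.HasSimple 0 s ∧ S.HasLengthAtMost k x)
    (fun _ _ _ σ' x s _ => σ'.HasLNF 0 (s⁻¹ * x)) ∧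
  GarsideStructure.PerformedIn.{u} (fun C l k D => C * l * k * D)
    (fun _ _ S _ k σ x s _ => σ.HasLNF 0 x ∧ σ.HasSimple 0 s ∧ S.HasLengthAtMost k x)
    (fun _ _ _ σ' x s _ => σ'.HasLNF 0 (GarsideStructure.conj x s)) ∧
  GarsideStructure.PerformedIn.{u} (fun C l k D => C * l * k * D)
    (fun _ _ S _ k σ x s _ => σ.HasLNF 0 x ∧ σ.HasSimple 0 s ∧ S.HasLengthAtMost k x)
    (fun _ _ _ σ' x s _ => σ'.HasLNF 0 (GarsideStructure.conj x s⁻¹)) ∧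
  -- right normal forms of xs, sx, xs⁻¹, s⁻¹x and of the conjugates of x by s and s⁻¹
  GarsideStructure.PerformedIn.{u} (fun C l k D => C * l * k * D)
    (fun _ _ S _ k σ x s _ => σ.HasRNF 0 x ∧ σ.HasSimple 0 s ∧ S.HasLengthAtMost k x)
    (fun _ _ _ σ' x s _ => σ'.HasRNF 0 (x * s)) ∧
  GarsideStructure.PerformedIn.{u} (fun C l k D => C * l * k * D)
    (fun _ _ S _ k σ x s _ => σ.HasRNF 0 x ∧ σ.HasSimple 0 s ∧ S.HasLengthAtMost k x)
    (fun _ _ _ σ' x s _ => σ'.HasRNF 0 (s * x)) ∧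
  GarsideStructure.PerformedIn.{u} (fun C l k D => C * l * k * D)
    (fun _ _ S _ k σ x s _ => σ.HasRNF 0 x ∧ σ.HasSimple 0 s ∧ S.HasLengthAtMost k x)
    (fun _ _ _ σ' x s _ => σ'.HasRNF 0 (x * s⁻¹)) ∧
  GarsideStructure.PerformedIn.{u} (fun C l k D => C * l * k * D)
    (fun _ _ S _ k σ x s _ => σ.HasRNF 0 x ∧ σ.HasSimple 0 s ∧ S.HasLengthAtMost k x)
    (fun _ _ _ σ' x s _ => σ'.HasRNF 0 (s⁻¹ * x)) ∧
  GarsideStructure.PerformedIn.{u} (fun C l k D => C * l * k * D)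
    (fun _ _ S _ k σ x s _ => σ.HasRNF 0 x ∧ σ.HasSimple 0 s ∧ S.HasLengthAtMost k x)
    (fun _ _ _ σ' x s _ => σ'.HasRNF 0 (GarsideStructure.conj x s)) ∧
  GarsideStructure.PerformedIn.{u} (fun C l k D => C * l * k * D)
    (fun _ _ S _ k σ x s _ => σ.HasRNF 0 x ∧ σ.HasSimple 0 s ∧ S.HasLengthAtMost k x)
    (fun _ _ _ σ' x s _ => σ'.HasRNF 0 (GarsideStructure.conj x s⁻¹)) ∧
  -- preferred prefix, cyclic sliding, preferred suffix, cyclic right sliding, from the normal form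
  GarsideStructure.PerformedIn.{u} (fun C l k D => C * l * k * D)
    (fun _ _ S _ k σ x _ _ => σ.HasLNF 0 x ∧ S.HasLengthAtMost k x)
    (fun _ _ S σ' x _ _ => σ'.HasSimple 0 (S.prefPrefix x)) ∧
  GarsideStructure.PerformedIn.{u} (fun C l k D => C * l * k * D)
    (fun _ _ S _ k σ x _ _ => σ.HasLNF 0 x ∧ S.HasLengthAtMost k x)
    (fun _ _ S σ' x _ _ => σ'.HasLNF 0 (S.slide x)) ∧
  GarsideStructure.PerformedIn.{u} (fun C l k D => C * l * k * D)
    (fun _ _ S _ k σ x _ _ => σ.HasRNF 0 x ∧ S.HasLengthAtMost k x)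
    (fun _ _ S σ' x _ _ => σ'.HasSimple 0 (S.prefSuffix x)) ∧
  GarsideStructure.PerformedIn.{u} (fun C l k D => C * l * k * D)
    (fun _ _ S _ k σ x _ _ => σ.HasRNF 0 x ∧ S.HasLengthAtMost k x)
    (fun _ _ S σ' x _ _ => σ'.HasRNF 0 (S.rightSlide x)) ∧
  -- left (resp. right) transport of s at x
  GarsideStructure.PerformedIn.{u} (fun C l k D => C * l * k * D)
    (fun _ _ S _ k σ x s _ => σ.HasLNF 0 x ∧ σ.HasSimple 0 s ∧ S.HasLengthAtMost k x)
    (fun _ _ S σ' x s _ => σ'.HasElt 0 (S.transport x s)) ∧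
  GarsideStructure.PerformedIn.{u} (fun C l k D => C * l * k * D)
    (fun _ _ S _ k σ x s _ => σ.HasRNF 0 x ∧ σ.HasSimple 0 s ∧ S.HasLengthAtMost k x)
    (fun _ _ S σ' x s _ => σ'.HasElt 0 (S.rightTransport x s)) ∧
  -- left (resp. right) pullback of s at x
  GarsideStructure.PerformedIn.{u} (fun C l k D => C * l * k * D)
    (fun _ _ S _ k σ x s z => σ.HasRNF 0 x ∧ σ.HasLNF 1 z ∧ σ.HasSimple 0 s ∧
      S.HasLengthAtMost k x ∧ z ∈ S.SC x ∧ S.slide z = x ∧ GarsideStructure.conj x s ∈ S.SSS x)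
    (fun _ _ S σ' x s z => ∃ v, S.IsPullback x z s v ∧ σ'.HasElt 0 v) ∧
  GarsideStructure.PerformedIn.{u} (fun C l k D => C * l * k * D)
    (fun _ _ S _ k σ x s z => σ.HasLNF 0 x ∧ σ.HasRNF 1 z ∧ σ.HasSimple 0 s ∧
      S.HasLengthAtMost k x ∧ z ∈ S.rightSC x ∧ S.rightSlide z = x ∧ GarsideStructure.conj x s⁻¹ ∈ S.SSS x)
    (fun _ _ S σ' x s z => ∃ v, S.IsRightPullback x z s v ∧ σ'.HasElt 0 v) ∧
  -- left and right normal form of x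
  GarsideStructure.PerformedIn.{u} (fun C l k D => C * l * k ^ 2 * D)
    (fun _ _ _ _ k σ x _ _ => σ.HasEltLE 0 k x)
    (fun _ _ _ σ' x _ _ => σ'.HasLNF 0 x) ∧
  GarsideStructure.PerformedIn.{u} (fun C l k D => C * l * k ^ 2 * D)
    (fun _ _ _ _ k σ x _ _ => σ.HasEltLE 0 k x)
    (fun _ _ _ σ' x _ _ => σ'.HasRNF 0 x) ∧
  -- gcds and lcms of x and y
  GarsideStructure.PerformedIn.{u} (fun C l k D => C * l * k ^ 2 * D)
    (fun _ _ _ _ k σ x y _ => σ.HasEltLE 0 k x ∧ σ.HasEltLE 1 k y)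
    (fun _ _ S σ' x y _ => σ'.HasElt 0 (S.leftGcd x y)) ∧
  GarsideStructure.PerformedIn.{u} (fun C l k D => C * l * k ^ 2 * D)
    (fun _ _ _ _ k σ x y _ => σ.HasEltLE 0 k x ∧ σ.HasEltLE 1 k y)
    (fun _ _ S σ' x y _ => σ'.HasElt 0 (S.rightGcd x y)) ∧
  GarsideStructure.PerformedIn.{u} (fun C l k D => C * l * k ^ 2 * D)
    (fun _ _ _ _ k σ x y _ => σ.HasEltLE 0 k x ∧ σ.HasEltLE 1 k y)
    (fun _ _ S σ' x y _ => σ'.HasElt 0 (S.leftLcm x y)) ∧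
  GarsideStructure.PerformedIn.{u} (fun C l k D => C * l * k ^ 2 * D)
    (fun _ _ _ _ k σ x y _ => σ.HasEltLE 0 k x ∧ σ.HasEltLE 1 k y)
    (fun _ _ S σ' x y _ => σ'.HasElt 0 (S.rightLcm x y)) ∧
  -- preferred prefix and suffix, cyclic left and right sliding
  GarsideStructure.PerformedIn.{u} (fun C l k D => C * l * k ^ 2 * D)
    (fun _ _ _ _ k σ x _ _ => σ.HasEltLE 0 k x)
    (fun _ _ S σ' x _ _ => σ'.HasSimple 0 (S.prefPrefix x)) ∧
  GarsideStructure.PerformedIn.{u} (fun C l k D => C * l * k ^ 2 * D)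
    (fun _ _ _ _ k σ x _ _ => σ.HasEltLE 0 k x)
    (fun _ _ S σ' x _ _ => σ'.HasSimple 0 (S.prefSuffix x)) ∧
  GarsideStructure.PerformedIn.{u} (fun C l k D => C * l * k ^ 2 * D)
    (fun _ _ _ _ k σ x _ _ => σ.HasEltLE 0 k x)
    (fun _ _ S σ' x _ _ => σ'.HasLNF 0 (S.slide x)) ∧
  GarsideStructure.PerformedIn.{u} (fun C l k D => C * l * k ^ 2 * D)
    (fun _ _ _ _ k σ x _ _ => σ.HasEltLE 0 k x)
    (fun _ _ S σ' x _ _ => σ'.HasRNF 0 (S.rightSlide x)) ∧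
  -- left and right transport of α at x
  GarsideStructure.PerformedIn.{u} (fun C l k D => C * l * k ^ 2 * D)
    (fun _ _ _ _ k σ x α _ => σ.HasEltLE 0 k x ∧ σ.HasEltLE 1 k α)
    (fun _ _ S σ' x α _ => σ'.HasElt 0 (S.transport x α)) ∧
  GarsideStructure.PerformedIn.{u} (fun C l k D => C * l * k ^ 2 * D)
    (fun _ _ _ _ k σ x α _ => σ.HasEltLE 0 k x ∧ σ.HasEltLE 1 k α)
    (fun _ _ S σ' x α _ => σ'.HasElt 0 (S.rightTransport x α)) ∧
  -- left (resp. right) pullback of α at x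
  GarsideStructure.PerformedIn.{u} (fun C l k D => C * l * k ^ 2 * D)
    (fun _ _ S _ k σ x α z => σ.HasEltLE 0 k x ∧ σ.HasEltLE 1 k α ∧ σ.HasEltLE 2 k z ∧
      α ∈ S.P ∧ z ∈ S.SC x ∧ S.slide z = x ∧ GarsideStructure.conj x α ∈ S.SSS x)
    (fun _ _ S σ' x α z => ∃ v, S.IsPullback x z α v ∧ σ'.HasElt 0 v) ∧
  GarsideStructure.PerformedIn.{u} (fun C l k D => C * l * k ^ 2 * D)
    (fun _ _ S _ k σ x α z => σ.HasEltLE 0 k x ∧ σ.HasEltLE 1 k α ∧ σ.HasEltLE 2 k z ∧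
      α ∈ S.P ∧ z ∈ S.rightSC x ∧ S.rightSlide z = x ∧ GarsideStructure.conj x α⁻¹ ∈ S.SSS x)
    (fun _ _ S σ' x α z => ∃ v, S.IsRightPullback x z α v ∧ σ'.HasElt 0 v) := by
  refine ⟨performedIn_isOne, performedIn_equal, performedIn_rightCompl, ?_, performedIn_tau, ?_,
    performedIn_mulAtom, ?_, performedIn_leftGcd, ?_, performedIn_leftLcm, ?_,
    performedIn_localSlide, performedIn_localRightSlide, performedIn_sameNF, ?_,
    performedIn_mul, performedIn_leftMul, performedIn_div, performedIn_leftDiv, performedIn_conj,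
    performedIn_conj_inv,
    -- Products are reversed in the opposite group: the right normal form of `xs` comes from the
    -- left normal form of `sx`, and likewise the conjugations by `s` and `s⁻¹` are exchanged.
    performedIn_onRNF (f := fun _ _ x s => s * x) performedIn_leftMul fun _ _ _ _ => rfl,
    performedIn_onRNF (f := fun _ _ x s => x * s) performedIn_mul fun _ _ _ _ => rfl,
    performedIn_onRNF (f := fun _ _ x s => s⁻¹ * x) performedIn_leftDiv fun _ _ _ _ => rfl,
    performedIn_onRNF (f := fun _ _ x s => x * s⁻¹) performedIn_div fun _ _ _ _ => rfl,
    performedIn_onRNF (f := fun _ _ x s => conj x s⁻¹) performedIn_conj_inv fun _ _ _ _ => ?_,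
    performedIn_onRNF (f := fun _ _ x s => conj x s) performedIn_conj fun _ _ _ _ => ?_,
    performedIn_prefPrefix, performedIn_slide, ?_, ?_, performedIn_transport, ?_,
    performedIn_pullback, ?_, performedIn_normWord, ?_, performedIn_gcdWord, ?_,
    performedIn_lcmWord, ?_, performedIn_prefPrefixWord, ?_, performedIn_slideWord, ?_,
    performedIn_transportWord, ?_, performedIn_pullbackWord, ?_⟩
  · refine performedIn_rightCompl.mirror (fun G _ _ S O k σ x y z h => ?_)
      (fun G _ _ S σ x y z h => ?_)
    · simpa only [hasSimple_op_iff] using h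
    · simpa only [rightCompl_op, hasSimple_op_iff] using h
  · refine performedIn_tau.mirror (fun G _ _ S O k σ x y z h => ?_) (fun G _ _ S σ x y z h => ?_)
    · simpa only [hasSimple_op_iff] using h
    · simpa only [tau_op, hasSimple_op_iff] using h
  · refine performedIn_mulAtom.mirror (fun G _ _ S O k σ x y z h => ?_)
      (fun G _ _ S σ x y z h => ?_)
    · simpa only [hasSimple_op_iff, hasAtom_op_iff] using h
    · simpa only [← MulOpposite.op_mul, hasSimple_op_iff, answers_op_iff, isSimple_op_iff] using h
  · refine performedIn_leftGcd.mirror (fun G _ _ S O k σ x y z h => ?_)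
      (fun G _ _ S σ x y z h => ?_)
    · simpa only [hasSimple_op_iff] using h
    · simpa only [leftGcd_op, hasSimple_op_iff] using h
  · refine performedIn_leftLcm.mirror (fun G _ _ S O k σ x y z h => ?_)
      (fun G _ _ S σ x y z h => ?_)
    · simpa only [hasSimple_op_iff] using h
    · simpa only [leftLcm_op, hasSimple_op_iff] using h
  · refine performedIn_sameNF.mirror (fun G _ _ S O k σ x y z h => ?_)
      (fun G _ _ S σ x y z h => ?_)
    · exact ⟨(hasLNF_op_iff ..).2 h.1, (hasLNF_op_iff ..).2 h.2.1, hasLengthAtMost_op h.2.2.1,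
        hasLengthAtMost_op h.2.2.2⟩
    · simpa only [answers_op_iff, MulOpposite.op_inj] using h
  · simp [conj_op, ← MulOpposite.op_inv]
  · simp [conj_op]
  · refine performedIn_prefPrefix.mirror (fun G _ _ S O k σ x y z h => ?_)
      (fun G _ _ S σ x y z h => ?_)
    · exact ⟨(hasLNF_op_iff ..).2 h.1, hasLengthAtMost_op h.2⟩
    · simpa only [prefPrefix_op, hasSimple_op_iff] using h
  · refine performedIn_slide.mirror (fun G _ _ S O k σ x y z h => ?_)
      (fun G _ _ S σ x y z h => ?_)
    · exact ⟨(hasLNF_op_iff ..).2 h.1, hasLengthAtMost_op h.2⟩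
    · simpa only [slide_op, hasLNF_op_iff] using h
  · refine performedIn_transport.mirror (fun G _ _ S O k σ x y z h => ?_)
      (fun G _ _ S σ x y z h => ?_)
    · exact ⟨(hasLNF_op_iff ..).2 h.1, (hasSimple_op_iff ..).2 h.2.1, hasLengthAtMost_op h.2.2⟩
    · simpa only [transport_op, hasElt_op_iff] using h
  · refine performedIn_pullback.mirror (fun G _ _ S O k σ x y z h => ?_)
      (fun G _ _ S σ x y z h => ?_)
    · obtain ⟨h1, h2, h3, h4, h5, h6, h7⟩ := h
      refine ⟨(hasRNF_op_iff ..).2 h1, (hasLNF_op_iff ..).2 h2, (hasSimple_op_iff ..).2 h3,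
        hasLengthAtMost_op h4, (S.mem_SC_op_iff ..).2 h5, ?_, ?_⟩
      · rw [slide_op, h6]
      · rwa [conj_op, mem_SSS_op_iff]
    · exact exists_isRightPullback h
  · refine performedIn_normWord.mirror (fun G _ _ S O k σ x y z h => ?_)
      (fun G _ _ S σ x y z h => ?_)
    · simpa only [hasEltLE_op_iff] using h
    · simpa only [hasLNF_op_iff] using h
  · refine performedIn_gcdWord.mirror (fun G _ _ S O k σ x y z h => ?_)
      (fun G _ _ S σ x y z h => ?_)
    · simpa only [hasEltLE_op_iff] using h
    · simpa only [leftGcd_op, hasElt_op_iff] using h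
  · refine performedIn_lcmWord.mirror (fun G _ _ S O k σ x y z h => ?_)
      (fun G _ _ S σ x y z h => ?_)
    · simpa only [hasEltLE_op_iff] using h
    · simpa only [leftLcm_op, hasElt_op_iff] using h
  · refine performedIn_prefPrefixWord.mirror (fun G _ _ S O k σ x y z h => ?_)
      (fun G _ _ S σ x y z h => ?_)
    · simpa only [hasEltLE_op_iff] using h
    · simpa only [prefPrefix_op, hasSimple_op_iff] using h
  · refine performedIn_slideWord.mirror (fun G _ _ S O k σ x y z h => ?_)
      (fun G _ _ S σ x y z h => ?_)
    · simpa only [hasEltLE_op_iff] using h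
    · simpa only [slide_op, hasLNF_op_iff] using h
  · refine performedIn_transportWord.mirror (fun G _ _ S O k σ x y z h => ?_)
      (fun G _ _ S σ x y z h => ?_)
    · simpa only [hasEltLE_op_iff] using h
    · simpa only [transport_op, hasElt_op_iff] using h
  · refine performedIn_pullbackWord.mirror (fun G _ _ S O k σ x y z h => ?_)
      (fun G _ _ S σ x y z h => ?_)
    · obtain ⟨h1, h2, h3, h4, h5, h6, h7⟩ := h
      refine ⟨(hasEltLE_op_iff ..).2 h1, (hasEltLE_op_iff ..).2 h2, (hasEltLE_op_iff ..).2 h3, h4,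
        (S.mem_SC_op_iff ..).2 h5, ?_, ?_⟩
      · rw [slide_op, h6]
      · rwa [conj_op, mem_SSS_op_iff]
    · exact exists_isRightPullback h
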